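/- Let $G$ be a locally compact Hausdorff étale groupoid with unit space $G^0$. For an (upper semicontinuous) Fell bundle $\mathcal A$ over $G$, let $\Gamma_c(\mathcal A)$ be the convolution $*$-algebra of its continuous compactly supported sections, and let $\mathcal A^0=\mathcal A|_{G^0}$. The full C*-algebra $C^*(\mathcal A)$, with canonical map $i_{\mathcal A}$, is the completion of $\Gamma_c(\mathcal A)$ in the norm $\sup\{\|\pi(f)\|:\pi$ a representation of $\Gamma_c(\mathcal A)$ on a Hilbert space$\}$. The reduced C*-algebra $C^*_r(\mathcal A)$, with canonical map $i_{\mathcal A,r}$, is the completion of $\Gamma_c(\mathcal A)$ in the operator norm of its left regular representation on the Hilbert module $L^2(\mathcal A)$, i.e. on the completion of $\Gamma_c(\mathcal A)$ in the norm $\|\xi\|_2=\|(\xi^**\xi)|_{G^0}\|_\infty^{1/2}$. Let $\mathcal C$ be the category of topologically $G$-graded C*-algebras. Its objects are the triples $(A,\mathcal A,i)$ where $A$ is a C*-algebra, $\mathcal A$ is a Fell bundle over $G$ and $i:\Gamma_c(\mathcal A)\to A$ is an injective $*$-homomorphism with dense range, such that there is a conditional expectation $E$ of $A$ onto $\overline{i(\Gamma_c(\mathcal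 A^0))}\cong\Gamma_0(\mathcal A^0)$ with $E(i(f))=i(f|_{G^0})$ for all $f$. A morphism $(\phi,\varphi):(A,\mathcal A,i)\to(B,\mathcal B,j)$ consists of a $*$-homomorphism $\phi:A\to B$ and a Fell bundle morphism $\varphi:\mathcal A\to\mathcal B$ with $\phi(i(f))=j(\varphi\circ f)$ for all $f\in\Gamma_c(\mathcal A)$. Then $(\mathcal A,i_{\mathcal A})$ and $(\mathcal A,i_{\mathcal A,r})$ are topological gradings of $C^*(\mathcal A)$ and $C^*_r(\mathcal A)$ for every Fell bundle $\mathcal A$ over $G$, and there are functors $M,N:\mathcal C\to\mathcal C$, $$M(A,\mathcal A,i)=(C^*(\mathcal A),\mathcal A,i_{\mathcal A}),\qquad N(A,\mathcal A,i)=(C^*_r(\mathcal A),\mathcal A,i_{\mathcal A,r}),$$ sending a morphism $(\phi,\varphi)$ to the pair of the homomorphism induced by $f\mapsto\varphi\circ f$ and $\varphi$ itself, and natural transformations $\psi:M\to\mathrm{id}_{\mathcal C}$ and $\eta:\mathrm{id}_{\mathcal C}\to N$ whose components are $(\psi_A,\mathrm{id}_{\mathcal A})$ and $(\eta_A,\mathrm{id}_{\mathcal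 A})$, where $\psi_A\circ i_{\mathcal A}=i$ and $\eta_A\circ i=i_{\mathcal A,r}$. Let $\mathcal M_G$ and $\mathcal N_G$ be the full subcategories of the objects $x$ of $\mathcal C$ for which $\psi_x$, respectively $\eta_x$, is an isomorphism. The functors $M$ and $N$ take values in $\mathcal M_G$ and $\mathcal N_G$; write $M^\psi:\mathcal C\to\mathcal M_G$ and $N^\eta:\mathcal C\to\mathcal N_G$ for the resulting functors. Then: 1. $\mathcal M_G$ and $\mathcal N_G$ are equivalent categories. 2. $\mathrm{Inc}_{\mathcal M_G}\dashv M^\psi$ with counit $\psi$, $N^\eta\dashv\mathrm{Inc}_{\mathcal N_G}$ with unit $\eta$, and the composite adjunction $N^\eta\circ\mathrm{Inc}_{\mathcal M_G}\dashv M^\psi\circ\mathrm{Inc}_{\mathcal N_G}$ is an adjoint equivalence between $\mathcal M_G$ and $\mathcal N_G$. 3. This equivalence is of "maximal-normal" type: for every object $x$ of $\mathcal C$, the pair $(Nx,\eta_x\circ\psi_x)$ is an initial object of the comma category $Mx\downarrow\mathcal N_G$, the pair $(Mx,\eta_x\circ\psi_x)$ is a final object of $\mathcal M_G\downarrow Nx$,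 and $M\eta:M\to MN$ and $N\psi:NM\to N$ are natural isomorphisms. 4. $N^\eta\cong(N^\eta\circ\mathrm{Inc}_{\mathcal M_G})\circ M^\psi$ and $M^\psi\cong(M^\psi\circ\mathrm{Inc}_{\mathcal N_G})\circ N^\eta$. -/

import Mathlib

open Topology CategoryTheory

universe u

/-- An étale topological groupoid, as a single-sorted structure: the elements are the arrows, the
units are the arrows `x` with `r x = x` (equivalently the values of `r`, or of `s`), and the
product `mul g h` is defined exactly on the composable pairs, i.e. those with `s g = r h`.
Étale means that the range map is a local homeomorphism of `G` into itself. -/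
class EtaleGroupoid (G : Type u) [TopologicalSpace G] where
  r : G → G
  s : G → G
  mul : (g h : G) → s g = r h → G
  inv : G → G
  r_r : ∀ g, r (r g) = r g
  s_r : ∀ g, s (r g) = r g
  r_s : ∀ g, r (s g) = s g
  s_s : ∀ g, s (s g) = s g
  r_mul : ∀ g h (e : s g = r h), r (mul g h e) = r g
  s_mul : ∀ g h (e : s g = r h), s (mul g h e) = s h
  mul_assoc : ∀ g h k (e : s g = r h) (e' : s h = r k),
    mul (mul g h e) k ((s_mul g h e).trans e') = mul g (mul h k e') (e.trans (r_mul h k e').symm)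
  r_mul_self : ∀ g, mul (r g) g (s_r g) = g
  self_mul_s : ∀ g, mul g (s g) (r_s g).symm = g
  r_inv : ∀ g, r (inv g) = s g
  s_inv : ∀ g, s (inv g) = r g
  mul_inv : ∀ g, mul g (inv g) (r_inv g).symm = r g
  inv_mul : ∀ g, mul (inv g) g (s_inv g) = s g
  continuous_mul : Continuous fun p : {p : G × G // s p.1 = r p.2} => mul p.1.1 p.1.2 p.2
  continuous_inv : Continuous inv
  isLocalHomeomorph_r : IsLocalHomeomorph r

namespace EtaleGroupoid

variable {G : Type u} [TopologicalSpace G] [EtaleGroupoid G]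

/-- `IsProd g h k`: the pair `(g, h)` is composable and `g h = k`. -/
def IsProd (g h k : G) : Prop := ∃ e : s g = r h, mul g h e = k

/-- `IsUnitArrow x`: the arrow `x` belongs to the unit space. -/
def IsUnitArrow (x : G) : Prop := r x = x

theorem IsProd.r_eq {g h k : G} (p : IsProd g h k) : r k = r g := by
  obtain ⟨e, rfl⟩ := p; exact r_mul g h e

theorem IsProd.s_eq {g h k : G} (p : IsProd g h k) : s k = s h := by
  obtain ⟨e, rfl⟩ := p; exact s_mul g h e

theorem IsProd.unique {g h k k' : G} (p : IsProd g h k) (p' : IsProd g h k') : k = k' := by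
  obtain ⟨e, rfl⟩ := p; obtain ⟨_, rfl⟩ := p'; rfl

theorem isProd_inv_left (g : G) : IsProd (inv g) g (s g) := ⟨s_inv g, inv_mul g⟩

theorem isProd_inv_right (g : G) : IsProd g (inv g) (r g) := ⟨(r_inv g).symm, mul_inv g⟩

theorem isProd_range (g : G) : IsProd (r g) g g := ⟨s_r g, r_mul_self g⟩

theorem isProd_source (g : G) : IsProd g (s g) g := ⟨(r_s g).symm, self_mul_s g⟩

theorem isProd_assoc_right {g h k x y : G} (p : IsProd g h x) (q : IsProd x k y) :
    ∃ z, IsProd h k z ∧ IsProd g z y := by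
  obtain ⟨e, rfl⟩ := p
  obtain ⟨e', rfl⟩ := q
  have e'' : s h = r k := (s_mul g h e).symm.trans e'
  exact ⟨mul h k e'', ⟨e'', rfl⟩, _, (mul_assoc g h k e e'').symm⟩

theorem isProd_assoc_left {g h k y z : G} (p : IsProd h k z) (q : IsProd g z y) :
    ∃ x, IsProd g h x ∧ IsProd x k y := by
  obtain ⟨e, rfl⟩ := p
  obtain ⟨e', rfl⟩ := q
  have e'' : s g = r h := e'.trans (r_mul h k e)
  exact ⟨mul g h e'', ⟨e'', rfl⟩, _, mul_assoc g h k e'' e⟩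

theorem IsProd.left {g h k : G} (p : IsProd g h k) : IsProd (inv g) k h := by
  obtain ⟨x, hx, hx'⟩ := isProd_assoc_left p
    (g := inv g) (y := mul (inv g) k ((s_inv g).trans p.r_eq.symm)) ⟨_, rfl⟩
  have h1 := hx.unique (isProd_inv_left g)
  subst h1
  obtain ⟨e, rfl⟩ := p
  have h2 : IsProd (s g) h h := by
    rw [e]; exact isProd_range h
  exact ⟨_, hx'.unique h2⟩

theorem IsProd.right {g h k : G} (p : IsProd g h k) : IsProd k (inv h) g := by
  obtain ⟨x, hx, hx'⟩ := isProd_assoc_right p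
    (k := inv h) (y := mul k (inv h) (p.s_eq.trans (r_inv h).symm)) ⟨_, rfl⟩
  have h1 := hx.unique (isProd_inv_right h)
  subst h1
  obtain ⟨e, rfl⟩ := p
  have h2 : IsProd g (r h) g := by
    rw [← e]; exact isProd_source g
  exact ⟨_, hx'.unique h2⟩

theorem IsProd.unique_right {g h h' k : G} (p : IsProd g h k) (p' : IsProd g h' k) : h = h' :=
  p.left.unique p'.left

theorem IsProd.unique_left {g g' h k : G} (p : IsProd g h k) (p' : IsProd g' h k) : g = g' :=
  p.right.unique p'.right

theorem isProd_of_r_eq {g h : G} (e : r h = r g) :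
    IsProd h (mul (inv h) g ((s_inv h).trans e)) g := by
  have p : IsProd (inv h) g (mul (inv h) g ((s_inv h).trans e)) := ⟨_, rfl⟩
  obtain ⟨x, hx, hx'⟩ := isProd_assoc_left p
    (g := h) (y := mul h _ ((r_inv h).symm.trans p.r_eq.symm)) ⟨_, rfl⟩
  have h1 := hx.unique (isProd_inv_right h)
  subst h1
  have h2 : IsProd (r h) g g := by rw [e]; exact isProd_range g
  exact ⟨_, hx'.unique h2⟩

theorem inv_inv_eq (g : G) : inv (inv g) = g :=
  ((isProd_inv_left g).left.unique
    (by have := isProd_source (inv (inv g)); rwa [s_inv, r_inv] at this)).symm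

theorem IsProd.inv {g h k : G} (p : IsProd g h k) : IsProd (inv h) (inv g) (inv k) := by
  have h1 := p.left.right
  exact h1.left

theorem inv_s (g : G) : inv (s g) = s g := by
  have h := isProd_inv_left (s g)
  rw [s_s] at h
  have h1 := isProd_source (inv (s g))
  rw [s_inv, r_s] at h1
  exact h1.unique h

theorem isProd_s_self (g : G) : IsProd (s g) (s g) (s g) := by
  have := isProd_source (s g); rwa [s_s] at this

theorem continuous_r : Continuous (r : G → G) := isLocalHomeomorph_r.continuous

theorem r_inv_eq : (s : G → G) = r ∘ inv := by
  funext g; exact (r_inv g).symm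

theorem continuous_s : Continuous (s : G → G) := by
  rw [r_inv_eq]; exact continuous_r.comp continuous_inv

theorem isClopen_isUnit [T2Space G] : IsClopen {x : G | IsUnitArrow x} := by
  refine ⟨isClosed_eq continuous_r continuous_id, ?_⟩
  have : {x : G | IsUnitArrow x} = Set.range (r : G → G) := by
    ext x
    exact ⟨fun h => ⟨x, h⟩, by rintro ⟨y, rfl⟩; exact r_r y⟩
  rw [this]
  exact isLocalHomeomorph_r.isOpenMap.isOpen_range

theorem finite_fiber_r [T2Space G] {K : Set G} (hK : IsCompact K) (x : G) :
    {h | h ∈ K ∧ r h = x}.Finite := by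
  have hc : IsCompact {h | h ∈ K ∧ r h = x} :=
    hK.inter_right (isClosed_singleton.preimage continuous_r)
  refine hc.finite ?_
  rw [isDiscrete_iff_discreteTopology, discreteTopology_subtype_iff]
  intro h hh
  rw [Filter.inf_principal_eq_bot, mem_nhdsWithin]
  refine ⟨(isLocalHomeomorph_r.localInverseAt h).target,
    (isLocalHomeomorph_r.localInverseAt h).open_target,
    isLocalHomeomorph_r.self_mem_localInverseAt_target, ?_⟩
  rintro k ⟨hk, hne⟩ hk'
  exact hne (isLocalHomeomorph_r.injOn_localInverseAt_target hk
    isLocalHomeomorph_r.self_mem_localInverseAt_target (hk'.2.trans hh.2.symm))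

end EtaleGroupoid

open EtaleGroupoid

/-- The total space of a family of fibres. It carries no topology by default: the topology is part
of the data of a bundle. -/
structure BundleTotal {G : Type u} (E : G → Type u) where
  base : G
  val : E base

/-- A Fell bundle over `G`: an upper semicontinuous bundle of complex Banach spaces over `G`
together with a continuous multiplication and a continuous involution covering those of `G`.
The product of `a` in the fibre over `g` and `b` in the fibre over `h`, where `g h = k`, is
`fmul p a b` in the fibre over `k`, with `p` a proof of `g h = k`; the adjoint of `a` is `fstar e a`
in the fibre over `h`, with `e` a proof of `h = g⁻¹`. -/
structure FellBundle (G : Type u) [TopologicalSpace G] [EtaleGroupoid G] where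
  fiber : G → Type u
  [normed : ∀ g, NormedAddCommGroup (fiber g)]
  [space : ∀ g, NormedSpace ℂ (fiber g)]
  [complete : ∀ g, CompleteSpace (fiber g)]
  [top : TopologicalSpace (BundleTotal fiber)]
  -- the Banach bundle
  continuous_base : Continuous (BundleTotal.base : BundleTotal fiber → G)
  isOpenMap_base : IsOpenMap (BundleTotal.base : BundleTotal fiber → G)
  upperSemicontinuous_norm : UpperSemicontinuous fun a : BundleTotal fiber => ‖a.val‖
  -- addition is continuous on the fibre product, which carries the topology induced by
  -- its inclusion into the square of the total space
  continuous_add : Continuous[TopologicalSpace.induced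
      (fun t : Σ g, fiber g × fiber g =>
        ((⟨t.1, t.2.1⟩, ⟨t.1, t.2.2⟩) : BundleTotal fiber × BundleTotal fiber)) inferInstance,
      inferInstance] fun t => (⟨t.1, t.2.1 + t.2.2⟩ : BundleTotal fiber)
  continuous_smul : ∀ c : ℂ,
    Continuous fun a : BundleTotal fiber => (⟨a.base, c • a.val⟩ : BundleTotal fiber)
  -- if the base points converge to `x` and the norms converge to `0`, then the points converge
  -- to the zero of the fibre over `x`
  tendsto_zero : ∀ x : G,
    Filter.comap BundleTotal.base (𝓝 x) ⊓
      Filter.comap (fun a : BundleTotal fiber => ‖a.val‖) (𝓝 0) ≤ 𝓝 ⟨x, 0⟩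
  -- the multiplication and the involution
  fmul : ∀ {g h k : G}, IsProd g h k → fiber g →ₗ[ℂ] fiber h →ₗ[ℂ] fiber k
  fstar : ∀ {g h : G}, h = inv g → fiber g →ₗ⋆[ℂ] fiber h
  continuous_fmul : Continuous
    fun p : {p : BundleTotal fiber × BundleTotal fiber // s p.1.base = r p.2.base} =>
      (⟨_, fmul ⟨p.2, rfl⟩ p.1.1.val p.1.2.val⟩ : BundleTotal fiber)
  continuous_fstar : Continuous
    fun a : BundleTotal fiber => (⟨inv a.base, fstar rfl a.val⟩ : BundleTotal fiber)
  fmul_assoc : ∀ {g h k x y z : G} (p : IsProd g h x) (q : IsProd x k y) (p' : IsProd h k z)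
    (q' : IsProd g z y) (a : fiber g) (b : fiber h) (c : fiber k),
    fmul q (fmul p a b) c = fmul q' a (fmul p' b c)
  norm_fmul_le : ∀ {g h k : G} (p : IsProd g h k) (a : fiber g) (b : fiber h),
    ‖fmul p a b‖ ≤ ‖a‖ * ‖b‖
  fstar_fstar : ∀ {g h : G} (e : h = inv g) (e' : g = inv h) (a : fiber g), fstar e' (fstar e a) = a
  fstar_fmul : ∀ {g h k g' h' k' : G} (p : IsProd g h k) (eg : g' = inv g) (eh : h' = inv h)
    (ek : k' = inv k) (p' : IsProd h' g' k') (a : fiber g) (b : fiber h),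
    fstar ek (fmul p a b) = fmul p' (fstar eh b) (fstar eg a)
  norm_fstar_fmul_self : ∀ {g : G} (a : fiber g),
    ‖fmul (isProd_inv_left g) (fstar rfl a) a‖ = ‖a‖ ^ 2
  -- `a* a` is a positive element of the C*-algebra over the unit `s g`
  fstar_fmul_self_pos : ∀ {g : G} (a : fiber g), ∃ b : fiber (s g),
    fmul (isProd_inv_left g) (fstar rfl a) a =
      fmul (isProd_s_self g) (fstar (inv_s g).symm b) b

attribute [instance] FellBundle.normed FellBundle.space FellBundle.complete FellBundle.top

namespace FellBundle

variable {G : Type u} [TopologicalSpace G] [EtaleGroupoid G]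

/-- The total space of a Fell bundle. -/
abbrev Total (𝒜 : FellBundle G) : Type u := BundleTotal 𝒜.fiber

variable (𝒜 : FellBundle G)

theorem mk_mul_eq {g h k : G} (p : IsProd g h k) (a : 𝒜.fiber g) (b : 𝒜.fiber h) :
    (⟨k, 𝒜.fmul p a b⟩ : 𝒜.Total) = ⟨mul g h p.1, 𝒜.fmul ⟨p.1, rfl⟩ a b⟩ := by
  obtain ⟨e, rfl⟩ := p; rfl

theorem mk_star_eq {g h : G} (e : h = inv g) (a : 𝒜.fiber g) :
    (⟨h, 𝒜.fstar e a⟩ : 𝒜.Total) = ⟨inv g, 𝒜.fstar rfl a⟩ := by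
  subst e; rfl

theorem continuous_zero : Continuous fun g : G => (⟨g, 0⟩ : 𝒜.Total) := by
  rw [continuous_iff_continuousAt]
  intro x
  refine Filter.Tendsto.mono_right ?_ (𝒜.tendsto_zero x)
  refine Filter.tendsto_inf.2 ⟨Filter.tendsto_comap_iff.2 Filter.tendsto_id,
    Filter.tendsto_comap_iff.2 ?_⟩
  have : ((fun a : 𝒜.Total => ‖a.val‖) ∘ fun g : G => (⟨g, 0⟩ : 𝒜.Total)) = fun _ => 0 := by
    funext g; simp
  rw [this]
  exact tendsto_const_nhds

theorem continuousAt_add {f₁ f₂ : ∀ g, 𝒜.fiber g} {x : G}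
    (h₁ : ContinuousAt (fun g => (⟨g, f₁ g⟩ : 𝒜.Total)) x)
    (h₂ : ContinuousAt (fun g => (⟨g, f₂ g⟩ : 𝒜.Total)) x) :
    ContinuousAt (fun g => (⟨g, f₁ g + f₂ g⟩ : 𝒜.Total)) x := by
  let _ : TopologicalSpace (Σ g, 𝒜.fiber g × 𝒜.fiber g) := TopologicalSpace.induced
      (fun t : Σ g, 𝒜.fiber g × 𝒜.fiber g =>
        ((⟨t.1, t.2.1⟩, ⟨t.1, t.2.2⟩) : 𝒜.Total × 𝒜.Total)) inferInstance
  have h : ContinuousAt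
      (fun g => (⟨g, f₁ g, f₂ g⟩ : Σ g, 𝒜.fiber g × 𝒜.fiber g)) x := by
    rw [(Topology.IsInducing.mk rfl :
      IsInducing (fun t : Σ g, 𝒜.fiber g × 𝒜.fiber g =>
        ((⟨t.1, t.2.1⟩, ⟨t.1, t.2.2⟩) : 𝒜.Total × 𝒜.Total))).continuousAt_iff]
    exact h₁.prodMk h₂
  exact (Continuous.continuousAt 𝒜.continuous_add).comp h

theorem continuousAt_sum {ι : Type*} (S : Finset ι) (f : ι → ∀ g, 𝒜.fiber g) {x : G}
    (h : ∀ i ∈ S, ContinuousAt (fun g => (⟨g, f i g⟩ : 𝒜.Total)) x) :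
    ContinuousAt (fun g => (⟨g, ∑ i ∈ S, f i g⟩ : 𝒜.Total)) x := by
  classical
  induction S using Finset.induction_on with
  | empty => simpa using 𝒜.continuous_zero.continuousAt
  | insert i S hi ih =>
    simp only [Finset.sum_insert hi]
    exact 𝒜.continuousAt_add (h i (by simp)) (ih fun j hj => h j (by simp [hj]))

/-- The convolution of two sections, `(f₁ * f₂)(g) = ∑ f₁(h) f₂(k)`, the sum over all pairs with
`h k = g`, i.e. over all `h` with `r h = r g`, with `k = h⁻¹ g`. -/
noncomputable def conv (f₁ f₂ : ∀ g, 𝒜.fiber g) (g : G) : 𝒜.fiber g :=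
  ∑ᶠ p : {p : G × G // IsProd p.1 p.2 g}, 𝒜.fmul p.2 (f₁ p.1.1) (f₂ p.1.2)

/-- The adjoint of a section, `f*(g) = f(g⁻¹)*`. -/
def conj (f : ∀ g, 𝒜.fiber g) (g : G) : 𝒜.fiber g :=
  𝒜.fstar (inv_inv_eq g).symm (f (inv g))

/-- `Γ_c(𝒜)`: the continuous sections of `𝒜` with compact support. -/
structure Cc where
  toFun : ∀ g, 𝒜.fiber g
  continuous_toFun : Continuous fun g => (⟨g, toFun g⟩ : 𝒜.Total)
  compact_support : ∃ K : Set G, IsCompact K ∧ ∀ g, g ∉ K → toFun g = 0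

namespace Cc

variable {𝒜}

instance : DFunLike 𝒜.Cc G 𝒜.fiber where
  coe := toFun
  coe_injective f f' h := by cases f; cases f'; congr

@[ext]
theorem ext {f f' : 𝒜.Cc} (h : ∀ g, f g = f' g) : f = f' := DFunLike.ext f f' h

section finiteness

variable [T2Space G]

theorem finite_left (f : 𝒜.Cc) (g : G) :
    {p : {p : G × G // IsProd p.1 p.2 g} | f p.1.1 ≠ 0}.Finite := by
  obtain ⟨K, hK, hf⟩ := f.compact_support
  refine Set.Finite.of_finite_image (f := fun p => p.1.1)
    ((finite_fiber_r hK (r g)).subset ?_) ?_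
  · rintro _ ⟨p, hp, rfl⟩
    exact ⟨by_contra fun h => hp (hf _ h), p.2.r_eq.symm⟩
  · rintro ⟨⟨a, b⟩, p⟩ _ ⟨⟨a', b'⟩, p'⟩ _ (rfl : a = a')
    cases IsProd.unique_right p p'
    rfl

theorem finite_right (f : 𝒜.Cc) (g : G) :
    {p : {p : G × G // IsProd p.1 p.2 g} | f p.1.2 ≠ 0}.Finite := by
  obtain ⟨K, hK, hf⟩ := f.compact_support
  refine Set.Finite.of_finite_image (f := fun p => inv p.1.2)
    ((finite_fiber_r (hK.image continuous_inv) (s g)).subset ?_) ?_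
  · rintro _ ⟨p, hp, rfl⟩
    exact ⟨⟨_, by_contra fun h => hp (hf _ h), rfl⟩, by rw [r_inv, p.2.s_eq]⟩
  · rintro ⟨⟨a, b⟩, p⟩ _ ⟨⟨a', b'⟩, p'⟩ _ (h : inv b = inv b')
    have h : b = b' := by rw [← inv_inv_eq b, h, inv_inv_eq]
    subst h
    cases IsProd.unique_left p p'
    rfl

theorem continuous_conv (f₁ f₂ : 𝒜.Cc) :
    Continuous fun g => (⟨g, 𝒜.conv f₁ f₂ g⟩ : 𝒜.Total) := by
  classical
  rw [continuous_iff_continuousAt]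
  intro x
  obtain ⟨K, hK, hf⟩ := f₁.compact_support
  have hT := finite_fiber_r hK (r x)
  set T := {h | h ∈ K ∧ r h = r x} with hTdef
  obtain ⟨U, hU, hdisj⟩ := hT.t2_separation
  -- the local inverses of the range map at the finitely many relevant points
  let σ : G → G → G := fun h g => isLocalHomeomorph_r.localInverseAt h (r g)
  let F : G → ∀ g, 𝒜.fiber g := fun h g =>
    if e : r (σ h g) = r g then
      𝒜.fmul (isProd_of_r_eq e) (f₁ (σ h g)) (f₂ _) else 0
  have hσx : ∀ h ∈ T, σ h x = h := by
    rintro h ⟨-, hh⟩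
    simp only [σ, ← hh]
    exact isLocalHomeomorph_r.localInverseAt_apply_self
  have hσc : ∀ h ∈ T, ContinuousAt (σ h) x := by
    rintro h ⟨-, hh⟩
    refine ContinuousAt.comp (f := r) ?_ continuous_r.continuousAt
    refine (isLocalHomeomorph_r.localInverseAt h).continuousAt ?_
    rw [← hh]
    exact isLocalHomeomorph_r.apply_self_mem_localInverseAt_source
  have hsrc : ∀ h ∈ T, ∀ᶠ g in 𝓝 x, r g ∈ (isLocalHomeomorph_r.localInverseAt h).source := by
    rintro h ⟨-, hh⟩
    refine continuous_r.continuousAt.eventually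
      ((isLocalHomeomorph_r.localInverseAt h).open_source.mem_nhds ?_)
    rw [← hh]
    exact isLocalHomeomorph_r.apply_self_mem_localInverseAt_source
  have hrσ : ∀ h ∈ T, ∀ᶠ g in 𝓝 x, r (σ h g) = r g := by
    intro h hh
    filter_upwards [hsrc h hh] with g hg
    exact isLocalHomeomorph_r.apply_localInverseAt_of_mem hg
  have hFc : ∀ h ∈ T, ContinuousAt (fun g => (⟨g, F h g⟩ : 𝒜.Total)) x := by
    intro h hh
    let W := {g | r (σ h g) = r g}
    have hW : W ∈ 𝓝 x := hrσ h hh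
    have hxW : x ∈ W := mem_of_mem_nhds hW
    rw [← continuousWithinAt_iff_continuousAt hW, continuousWithinAt_iff_continuousAt_domRestrict _ hxW]
    have hσW : ContinuousAt (fun g : W => σ h g) ⟨x, hxW⟩ :=
      ContinuousAt.comp (g := σ h) (f := fun g : W => (g : G)) (hσc h hh) continuous_subtype_val.continuousAt
    let q : W → {p : G × G // s p.1 = r p.2} := fun g =>
      ⟨(inv (σ h g), g), (s_inv _).trans g.2⟩
    have hq : ContinuousAt q ⟨x, hxW⟩ := by
      refine IsInducing.subtypeVal.continuousAt_iff.2 ?_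
      exact (continuous_inv.continuousAt.comp hσW).prodMk continuous_subtype_val.continuousAt
    have hk : ContinuousAt (fun g : W => mul (q g).1.1 (q g).1.2 (q g).2) ⟨x, hxW⟩ :=
      ContinuousAt.comp (f := q) EtaleGroupoid.continuous_mul.continuousAt hq
    let t : W → {p : 𝒜.Total × 𝒜.Total // s p.1.base = r p.2.base} := fun g =>
      ⟨(⟨σ h g, f₁ (σ h g)⟩, ⟨_, f₂ (mul (q g).1.1 (q g).1.2 (q g).2)⟩),
        (isProd_of_r_eq g.2).1⟩
    have ht : ContinuousAt t ⟨x, hxW⟩ := by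
      refine IsInducing.subtypeVal.continuousAt_iff.2 ?_
      exact (ContinuousAt.comp (f := fun g : W => σ h g)
        f₁.continuous_toFun.continuousAt hσW).prodMk
        (ContinuousAt.comp (f := fun g : W => mul (q g).1.1 (q g).1.2 (q g).2)
          f₂.continuous_toFun.continuousAt hk)
    have hmain := ContinuousAt.comp (f := t) 𝒜.continuous_fmul.continuousAt ht
    refine hmain.congr (Filter.Eventually.of_forall fun g => ?_)
    have hg : r (σ h g) = r (g : G) := g.2
    simp only [Function.comp, Set.domRestrict, F, dif_pos hg]
    exact (mk_mul_eq 𝒜 (isProd_of_r_eq hg) _ _).symm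
  -- near `x`, the convolution is the sum of the finitely many local terms
  let V : G → Set G := fun h => U h ∩ (isLocalHomeomorph_r.localInverseAt h).target
  have hVo : ∀ h, IsOpen (V h) := fun h =>
    (hU h).2.inter (isLocalHomeomorph_r.localInverseAt h).open_target
  have hL : IsCompact (K \ ⋃ h ∈ T, V h) := hK.diff (isOpen_biUnion fun h _ => hVo h)
  have hLx : ∀ᶠ g in 𝓝 x, r g ∉ r '' (K \ ⋃ h ∈ T, V h) := by
    refine continuous_r.continuousAt.eventually
      ((hL.image continuous_r).isClosed.isOpen_compl.mem_nhds ?_)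
    rintro ⟨h, ⟨hhK, hhV⟩, hh⟩
    exact hhV (Set.mem_biUnion (show h ∈ T from ⟨hhK, hh⟩)
      ⟨(hU h).1, isLocalHomeomorph_r.self_mem_localInverseAt_target⟩)
  have hσU : ∀ h ∈ T, ∀ᶠ g in 𝓝 x, σ h g ∈ U h := by
    intro h hh
    refine (hσc h hh).eventually ((hU h).2.mem_nhds ?_)
    rw [hσx h hh]
    exact (hU h).1
  have hev : ∀ᶠ g in 𝓝 x, ∑ h ∈ hT.toFinset, F h g = 𝒜.conv f₁ f₂ g := by
    have h1 := (hT.eventually_all (l := 𝓝 x)).2 hrσ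
    have h2 := (hT.eventually_all (l := 𝓝 x)).2 hσU
    filter_upwards [hLx, h1, h2] with g hg1 hg2 hg3
    let j : T → {p : G × G // IsProd p.1 p.2 g} := fun h =>
      ⟨(σ h g, _), isProd_of_r_eq (hg2 h h.2)⟩
    have hj : Function.Injective j := by
      intro h h' hhh
      have e : σ h g = σ h' g := congrArg (fun p => p.1.1) hhh
      by_contra hne
      have hne' : (h : G) ≠ h' := fun h'' => hne (Subtype.ext h'')
      exact Set.disjoint_left.1 (hdisj h.2 h'.2 hne') (hg3 h h.2) (e ▸ hg3 h' h'.2)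
    have hsupp : ∀ p : {p : G × G // IsProd p.1 p.2 g}, p ∉ Set.range j →
        𝒜.fmul p.2 (f₁ p.1.1) (f₂ p.1.2) = 0 := by
      rintro ⟨⟨a, b⟩, p⟩ hp
      by_cases ha : f₁ a = 0
      · simp [ha]
      exfalso
      have haK : a ∈ K := by_contra fun h => ha (hf _ h)
      have hra : r a = r g := p.r_eq.symm
      have haV : a ∈ ⋃ h ∈ T, V h := by_contra fun h => hg1 ⟨a, ⟨haK, h⟩, hra⟩
      simp only [Set.mem_iUnion] at haV
      obtain ⟨h, hh, haV⟩ := haV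
      refine hp ⟨⟨h, hh⟩, ?_⟩
      have e : σ h g = a := by
        simp only [σ, ← hra]
        have := (isLocalHomeomorph_r.localInverseAt h).right_inv haV.2
        rwa [IsLocalHomeomorph.localInverseAt_symm] at this
      apply Subtype.ext
      have p' := (j ⟨h, hh⟩).2
      have e' : (j ⟨h, hh⟩).1.1 = a := e
      refine Prod.ext e' ?_
      rw [e'] at p'
      exact p'.unique_right p
    have hfin : Finite T := hT
    let _ := Fintype.ofFinite T
    calc ∑ h ∈ hT.toFinset, F h g = ∑ h : T, F h g := by
          rw [← Finset.sum_coe_sort]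
          exact Fintype.sum_equiv (Equiv.subtypeEquivRight fun h => by simp) _ _ fun _ => rfl
      _ = ∑ᶠ h : T, 𝒜.fmul (j h).2 (f₁ (j h).1.1) (f₂ (j h).1.2) := by
          rw [finsum_eq_sum_of_fintype]
          exact Finset.sum_congr rfl fun h _ => dif_pos (hg2 h h.2)
      _ = ∑ᶠ p ∈ Set.range j, 𝒜.fmul p.2 (f₁ p.1.1) (f₂ p.1.2) :=
          (finsum_mem_range (f := fun p : {p : G × G // IsProd p.1 p.2 g} =>
            𝒜.fmul p.2 (f₁ p.1.1) (f₂ p.1.2)) hj).symm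
      _ = 𝒜.conv f₁ f₂ g := by
          refine finsum_congr fun p => ?_
          by_cases hp : p ∈ Set.range j
          · rw [finsum_eq_if, if_pos hp]
          · rw [finsum_eq_if, if_neg hp, hsupp p hp]
  refine (continuousAt_sum 𝒜 hT.toFinset F fun h hh => hFc h (hT.mem_toFinset.1 hh)).congr ?_
  filter_upwards [hev] with g hg
  rw [hg]

theorem compact_support_conv (f₁ f₂ : 𝒜.Cc) :
    ∃ K : Set G, IsCompact K ∧ ∀ g, g ∉ K → 𝒜.conv f₁ f₂ g = 0 := by
  obtain ⟨K₁, hK₁, h₁⟩ := f₁.compact_support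
  obtain ⟨K₂, hK₂, h₂⟩ := f₂.compact_support
  have hcl : IsClosed {p : G × G | s p.1 = r p.2} :=
    isClosed_eq (continuous_s.comp continuous_fst) (continuous_r.comp continuous_snd)
  have hC := hcl.isClosedEmbedding_subtypeVal.isCompact_preimage (hK₁.prod hK₂)
  refine ⟨_, hC.image EtaleGroupoid.continuous_mul, fun g hg => ?_⟩
  refine (finsum_congr fun p => ?_).trans finsum_zero
  by_cases ha : p.1.1 ∈ K₁
  · by_cases hb : p.1.2 ∈ K₂
    · exact absurd ⟨⟨p.1, p.2.1⟩, ⟨ha, hb⟩, p.2.2⟩ hg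
    · rw [show f₂ p.1.2 = 0 from h₂ _ hb, map_zero]
  · rw [show f₁ p.1.1 = 0 from h₁ _ ha, map_zero, LinearMap.zero_apply]

end finiteness

instance : Zero 𝒜.Cc where
  zero := ⟨fun _ => 0, 𝒜.continuous_zero, ∅, isCompact_empty, fun _ _ => rfl⟩

instance : Add 𝒜.Cc where
  add f f' := ⟨fun g => f g + f' g,
    continuous_iff_continuousAt.2 fun _ => 𝒜.continuousAt_add
      f.continuous_toFun.continuousAt f'.continuous_toFun.continuousAt, by
    obtain ⟨K, hK, h⟩ := f.compact_support
    obtain ⟨K', hK', h'⟩ := f'.compact_support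
    refine ⟨K ∪ K', hK.union hK', fun g hg => ?_⟩
    rw [Set.mem_union, not_or] at hg
    rw [show f g = 0 from h g hg.1, show f' g = 0 from h' g hg.2, add_zero]⟩

instance : Neg 𝒜.Cc where
  neg f := ⟨fun g => -f g, by
    have := (𝒜.continuous_smul (-1)).comp f.continuous_toFun
    simp only [Function.comp_def, neg_one_smul] at this
    exact this, by
    obtain ⟨K, hK, h⟩ := f.compact_support
    exact ⟨K, hK, fun g hg => by rw [show f g = 0 from h g hg, neg_zero]⟩⟩

instance : AddCommGroup 𝒜.Cc where
  add_assoc f f' f'' := ext fun g => add_assoc (f g) (f' g) (f'' g)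
  zero_add f := ext fun g => zero_add (f g)
  add_zero f := ext fun g => add_zero (f g)
  neg_add_cancel f := ext fun g => neg_add_cancel (f g)
  add_comm f f' := ext fun g => add_comm (f g) (f' g)
  nsmul := nsmulRec
  zsmul := zsmulRec

theorem add_apply (f f' : 𝒜.Cc) (g : G) : (f + f') g = f g + f' g := rfl

theorem zero_apply (g : G) : (0 : 𝒜.Cc) g = 0 := rfl

instance : Module ℂ 𝒜.Cc where
  smul c f := ⟨fun g => c • f g, (𝒜.continuous_smul c).comp f.continuous_toFun, by
    obtain ⟨K, hK, h⟩ := f.compact_support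
    exact ⟨K, hK, fun g hg => by rw [show f g = 0 from h g hg, smul_zero]⟩⟩
  one_smul f := ext fun g => one_smul ℂ (f g)
  mul_smul c d f := ext fun g => mul_smul c d (f g)
  smul_zero c := ext fun g => smul_zero c
  smul_add c f f' := ext fun g => smul_add c (f g) (f' g)
  add_smul c d f := ext fun g => add_smul c d (f g)
  zero_smul f := ext fun g => zero_smul ℂ (f g)

theorem smul_apply (c : ℂ) (f : 𝒜.Cc) (g : G) : (c • f) g = c • f g := rfl

/-- The involution of `Γ_c(𝒜)`. -/
instance : Star 𝒜.Cc where
  star f := ⟨𝒜.conj f, by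
    have h := 𝒜.continuous_fstar.comp (f.continuous_toFun.comp EtaleGroupoid.continuous_inv)
    refine h.congr fun g => ?_
    exact (mk_star_eq 𝒜 (inv_inv_eq g).symm (f (inv g))).symm, by
    obtain ⟨K, hK, h⟩ := f.compact_support
    refine ⟨_, hK.image EtaleGroupoid.continuous_inv, fun g hg => ?_⟩
    have : f (inv g) = 0 := h _ fun hi => hg ⟨_, hi, inv_inv_eq g⟩
    rw [conj, this, map_zero]⟩

theorem star_apply (f : 𝒜.Cc) (g : G) :
    (star f) g = 𝒜.fstar (inv_inv_eq g).symm (f (inv g)) := rfl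

theorem finsum_sigma' {ι : Type*} {κ : ι → Type*} {M : Type*} [AddCommMonoid M]
    (f : (i : ι) → κ i → M) (hI : {i | ∃ j, f i j ≠ 0}.Finite)
    (hJ : ∀ i, {j | f i j ≠ 0}.Finite) :
    ∑ᶠ i, ∑ᶠ j, f i j = ∑ᶠ p : Σ i, κ i, f p.1 p.2 := by
  classical
  rw [finsum_eq_sum_of_support_subset (s := hI.toFinset)]
  · rw [finsum_eq_sum_of_support_subset
      (s := hI.toFinset.sigma fun i => (hJ i).toFinset)]
    · rw [Finset.sum_sigma]
      refine Finset.sum_congr rfl fun i _ => ?_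
      exact finsum_eq_sum_of_support_subset _ (by intro j hj; simpa using hj)
    · rintro ⟨i, j⟩ h
      simp only [Finset.mem_coe, Finset.mem_sigma, Set.Finite.mem_toFinset]
      exact ⟨⟨j, h⟩, h⟩
  · intro i hi
    simp only [Finset.mem_coe, Set.Finite.mem_toFinset]
    by_contra hne
    exact hi ((finsum_congr fun j => by_contra fun h => hne ⟨j, h⟩).trans finsum_zero)

variable [T2Space G]

/-- The convolution product of `Γ_c(𝒜)`. -/
noncomputable instance : Mul 𝒜.Cc where
  mul f₁ f₂ := ⟨𝒜.conv f₁ f₂, continuous_conv f₁ f₂, compact_support_conv f₁ f₂⟩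

theorem mul_apply (f₁ f₂ : 𝒜.Cc) (g : G) :
    (f₁ * f₂) g =
      ∑ᶠ p : {p : G × G // IsProd p.1 p.2 g}, 𝒜.fmul p.2 (f₁ p.1.1) (f₂ p.1.2) := rfl

theorem finite_mul (f₁ f₂ : 𝒜.Cc) (g : G) : Function.HasFiniteSupport
    fun p : {p : G × G // IsProd p.1 p.2 g} => 𝒜.fmul p.2 (f₁ p.1.1) (f₂ p.1.2) :=
  (finite_left f₁ g).subset fun p hp h => hp (by
    show 𝒜.fmul p.2 (f₁ p.1.1) (f₂ p.1.2) = 0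
    rw [h, map_zero, LinearMap.zero_apply])

/-- Triple factorizations of `g`, bracketed in the two possible ways. -/
def assocEquiv (g : G) :
    (Σ p : {p : G × G // IsProd p.1 p.2 g}, {q : G × G // IsProd q.1 q.2 p.1.1}) ≃
      Σ p : {p : G × G // IsProd p.1 p.2 g}, {q : G × G // IsProd q.1 q.2 p.1.2} where
  toFun t := ⟨⟨(t.2.1.1, mul t.2.1.2 t.1.1.2
      (t.2.2.s_eq.symm.trans t.1.2.1)), by
        obtain ⟨z, ⟨e, rfl⟩, hz⟩ := isProd_assoc_right t.2.2 t.1.2; exact hz⟩,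
    ⟨(t.2.1.2, t.1.1.2), ⟨_, rfl⟩⟩⟩
  invFun t := ⟨⟨(mul t.1.1.1 t.2.1.1 (t.1.2.1.trans t.2.2.r_eq), t.2.1.2), by
        obtain ⟨z, ⟨e, rfl⟩, hz⟩ := isProd_assoc_left t.2.2 t.1.2; exact hz⟩,
    ⟨(t.1.1.1, t.2.1.1), ⟨_, rfl⟩⟩⟩
  left_inv := by
    rintro ⟨⟨⟨a, b⟩, p⟩, ⟨⟨c, d⟩, ⟨e, h⟩⟩⟩
    simp only at h
    subst h
    rfl
  right_inv := by
    rintro ⟨⟨⟨a, b⟩, p⟩, ⟨⟨c, d⟩, ⟨e, h⟩⟩⟩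
    simp only at h
    subst h
    rfl

theorem mul_assoc' (f₁ f₂ f₃ : 𝒜.Cc) : f₁ * f₂ * f₃ = f₁ * (f₂ * f₃) := by
  ext g
  have hL : (f₁ * f₂ * f₃) g = ∑ᶠ p : {p : G × G // IsProd p.1 p.2 g},
      ∑ᶠ q : {q : G × G // IsProd q.1 q.2 p.1.1},
        𝒜.fmul p.2 (𝒜.fmul q.2 (f₁ q.1.1) (f₂ q.1.2)) (f₃ p.1.2) := by
    rw [mul_apply]
    refine finsum_congr fun p => ?_
    rw [mul_apply]
    exact AddMonoidHom.map_finsum ((𝒜.fmul p.2).flip (f₃ p.1.2)).toAddMonoidHom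
      (finite_mul f₁ f₂ _)
  have hR : (f₁ * (f₂ * f₃)) g = ∑ᶠ p : {p : G × G // IsProd p.1 p.2 g},
      ∑ᶠ q : {q : G × G // IsProd q.1 q.2 p.1.2},
        𝒜.fmul p.2 (f₁ p.1.1) (𝒜.fmul q.2 (f₂ q.1.1) (f₃ q.1.2)) := by
    rw [mul_apply]
    refine finsum_congr fun p => ?_
    rw [mul_apply]
    exact AddMonoidHom.map_finsum (𝒜.fmul p.2 (f₁ p.1.1)).toAddMonoidHom
      (finite_mul f₂ f₃ _)
  rw [hL, hR, finsum_sigma', finsum_sigma', ← finsum_comp_equiv (assocEquiv g)]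
  · refine finsum_congr fun t => ?_
    exact 𝒜.fmul_assoc t.2.2 t.1.2 _ _ _ _ _
  · refine (finite_left f₁ g).subset ?_
    rintro p ⟨q, hq⟩ h
    exact hq (by rw [h, map_zero, LinearMap.zero_apply])
  · intro p
    refine (finite_left f₂ _).subset ?_
    intro q hq h
    exact hq (by rw [h, map_zero, LinearMap.zero_apply, map_zero])
  · refine (finite_right f₃ g).subset ?_
    rintro p ⟨q, hq⟩ h
    exact hq (by rw [h, map_zero])
  · intro p
    refine (finite_left f₁ _).subset ?_
    intro q hq h
    exact hq (by rw [h, map_zero, LinearMap.zero_apply, map_zero, LinearMap.zero_apply])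

/-- `Γ_c(𝒜)` with the convolution product. -/
noncomputable instance : NonUnitalRing 𝒜.Cc where
  left_distrib f f₁ f₂ := by
    ext g
    rw [add_apply, mul_apply, mul_apply, mul_apply,
      ← finsum_add_distrib (finite_mul f f₁ g) (finite_mul f f₂ g)]
    exact finsum_congr fun p => by rw [add_apply, map_add]
  right_distrib f₁ f₂ f := by
    ext g
    rw [add_apply, mul_apply, mul_apply, mul_apply,
      ← finsum_add_distrib (finite_mul f₁ f g) (finite_mul f₂ f g)]
    exact finsum_congr fun p => by rw [add_apply, map_add, LinearMap.add_apply]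
  zero_mul f := by
    ext g
    rw [mul_apply]
    exact (finsum_congr fun p => by rw [zero_apply, map_zero, LinearMap.zero_apply]).trans
      finsum_zero
  mul_zero f := by
    ext g
    rw [mul_apply]
    exact (finsum_congr fun p => by rw [zero_apply, map_zero]).trans finsum_zero
  mul_assoc := mul_assoc'

instance : IsScalarTower ℂ 𝒜.Cc 𝒜.Cc where
  smul_assoc c f f' := by
    ext g
    rw [smul_eq_mul, smul_eq_mul, smul_apply, mul_apply, mul_apply,
      smul_finsum]
    exact finsum_congr fun p => by rw [smul_apply, map_smul, LinearMap.smul_apply]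

instance : SMulCommClass ℂ 𝒜.Cc 𝒜.Cc where
  smul_comm c f f' := by
    ext g
    rw [smul_eq_mul, smul_eq_mul, smul_apply, mul_apply, mul_apply,
      smul_finsum]
    exact finsum_congr fun p => by rw [smul_apply, map_smul]

/-- Inversion exchanges the factorizations of `g⁻¹` and those of `g`. -/
def invEquiv (g : G) : {p : G × G // IsProd p.1 p.2 (inv g)} ≃
    {p : G × G // IsProd p.1 p.2 g} where
  toFun p := ⟨(inv p.1.2, inv p.1.1), by
    have := p.2.inv; rwa [inv_inv_eq] at this⟩
  invFun p := ⟨(inv p.1.2, inv p.1.1), p.2.inv⟩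
  left_inv p := by ext <;> simp [inv_inv_eq]
  right_inv p := by ext <;> simp [inv_inv_eq]

/-- `Γ_c(𝒜)` is a `*`-algebra. -/
noncomputable instance : StarRing 𝒜.Cc where
  star_involutive f := by
    ext g
    rw [star_apply, star_apply]
    have key : ∀ (h : G) (e : h = g) (e₁ : h = inv (inv g))
        (e₂ : inv g = inv h)
        (e₃ : g = inv (inv g)),
        𝒜.fstar e₃ (𝒜.fstar e₂ (f h)) = f g := by
      rintro h rfl _ e₂ e₃
      exact 𝒜.fstar_fstar _ _ _
    exact key _ (inv_inv_eq g) rfl _ _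
  star_mul f f' := by
    ext g
    rw [star_apply, mul_apply, mul_apply]
    have h1 := AddMonoidHom.map_finsum
      (𝒜.fstar (inv_inv_eq g).symm).toAddMonoidHom (finite_mul f f' (inv g))
    refine h1.trans ?_
    rw [← finsum_comp_equiv (invEquiv g)]
    refine finsum_congr fun p => ?_
    have key : ∀ (h k h' k' : G) (eh : h' = inv h) (ek : k' = inv k)
        (q : IsProd h k (inv g)) (q' : IsProd k' h' g),
        𝒜.fstar (inv_inv_eq g).symm (𝒜.fmul q (f h) (f' k)) =
          𝒜.fmul q' (star f' k') (star f h') := by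
      rintro h k _ _ rfl rfl q q'
      have hs : ∀ (f : 𝒜.Cc) (h : G), (star f) (inv h) = 𝒜.fstar rfl (f h) := by
        intro f h
        rw [star_apply]
        have : ∀ (k : G) (e : inv h = inv k), k = h →
            𝒜.fstar e (f k) = 𝒜.fstar rfl (f h) := by rintro k _ rfl; rfl
        exact this _ _ (inv_inv_eq h)
      rw [hs, hs]
      exact 𝒜.fstar_fmul _ _ _ _ _ _ _
    exact key _ _ _ _ rfl rfl _ _
  star_add f f' := by
    ext g
    rw [star_apply, add_apply, map_add]
    rfl

instance : StarModule ℂ 𝒜.Cc where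
  star_smul c f := by
    ext g
    rw [star_apply, smul_apply, smul_apply, star_apply, map_smulₛₗ]
    rfl

open Classical in
/-- `P_𝒜`: restriction of a section to the unit space. A section over the (clopen) unit space is
identified with its extension by zero to `G`, so that `Γ_c(𝒜⁰)` is the `*`-subalgebra of the
sections in `Γ_c(𝒜)` that vanish outside the unit space. -/
noncomputable def restrict (f : 𝒜.Cc) : 𝒜.Cc where
  toFun g := if IsUnitArrow g then f g else 0
  continuous_toFun := by
    have : (fun g => (⟨g, if IsUnitArrow g then f g else 0⟩ : 𝒜.Total)) =
        fun g => if IsUnitArrow g then (⟨g, f g⟩ : 𝒜.Total) else ⟨g, 0⟩ := by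
      funext g; split_ifs <;> rfl
    rw [this]
    refine Continuous.if ?_ f.continuous_toFun 𝒜.continuous_zero
    intro g hg
    rw [isClopen_isUnit.frontier_eq] at hg
    exact hg.elim
  compact_support := by
    obtain ⟨K, hK, h⟩ := f.compact_support
    refine ⟨K, hK, fun g hg => ?_⟩
    split_ifs
    · exact h g hg
    · rfl

/-- `f` belongs to `Γ_c(𝒜⁰)`. -/
def IsDiagonal (f : 𝒜.Cc) : Prop := ∀ g, ¬ IsUnitArrow g → f g = 0

/-- The supremum norm of a section (a maximum over a compact set, hence finite). -/
noncomputable def supNorm (f : 𝒜.Cc) : ℝ := ⨆ g, ‖f g‖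

/-- The norm of the Hilbert module `L²(𝒜)` on `Γ_c(𝒜)`: `‖ξ‖₂ = ‖⟨ξ, ξ⟩‖_∞ ^ (1/2)`, where
`⟨ξ, η⟩ = P_𝒜(ξ* * η)`. -/
noncomputable def norm₂ (ξ : 𝒜.Cc) : ℝ := √(supNorm (restrict (star ξ * ξ)))

end Cc

/-- Morphisms of Fell bundles over `G`: continuous, fibrewise linear, multiplicative and
involutive maps covering the identity of `G`. -/
structure Hom (𝒜 ℬ : FellBundle G) where
  toFun : ∀ g, 𝒜.fiber g →ₗ[ℂ] ℬ.fiber g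
  continuous_total : Continuous fun a : 𝒜.Total => (⟨a.base, toFun a.base a.val⟩ : ℬ.Total)
  map_fmul : ∀ {g h k : G} (p : IsProd g h k) (a : 𝒜.fiber g) (b : 𝒜.fiber h),
    toFun k (𝒜.fmul p a b) = ℬ.fmul p (toFun g a) (toFun h b)
  map_fstar : ∀ {g h : G} (e : h = inv g) (a : 𝒜.fiber g),
    toFun h (𝒜.fstar e a) = ℬ.fstar e (toFun g a)

namespace Hom

variable {𝒜} {ℬ 𝒟 : FellBundle G}

@[ext]
theorem ext {φ φ' : Hom 𝒜 ℬ} (h : ∀ g a, φ.toFun g a = φ'.toFun g a) : φ = φ' := by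
  cases φ; cases φ'
  congr
  funext g
  exact LinearMap.ext (h g)

/-- The identity morphism. -/
def id (𝒜 : FellBundle G) : Hom 𝒜 𝒜 where
  toFun _ := LinearMap.id
  continuous_total := continuous_id
  map_fmul _ _ _ := rfl
  map_fstar _ _ := rfl

/-- The composition `γ ∘ φ`. -/
def comp (γ : Hom ℬ 𝒟) (φ : Hom 𝒜 ℬ) : Hom 𝒜 𝒟 where
  toFun g := γ.toFun g ∘ₗ φ.toFun g
  continuous_total := γ.continuous_total.comp φ.continuous_total
  map_fmul p a b := by simp [φ.map_fmul, γ.map_fmul]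
  map_fstar e a := by simp [φ.map_fstar, γ.map_fstar]

/-- `φ^c : Γ_c(𝒜) → Γ_c(ℬ)`, `f ↦ φ ∘ f`. -/
def mapCc (φ : Hom 𝒜 ℬ) (f : 𝒜.Cc) : ℬ.Cc where
  toFun g := φ.toFun g (f g)
  continuous_toFun := φ.continuous_total.comp f.continuous_toFun
  compact_support := by
    obtain ⟨K, hK, h⟩ := f.compact_support
    exact ⟨K, hK, fun g hg => by rw [show f g = 0 from h g hg, map_zero]⟩

end Hom

end FellBundle

/-- `E` is a conditional expectation of the C*-algebra `A` onto its C*-subalgebra `B`: a positive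
contractive linear projection onto `B` which is a `B`-bimodule map. -/
structure IsConditionalExpectation {A : Type u} [NonUnitalCStarAlgebra A] (B : Set A)
    (E : A →ₗ[ℂ] A) : Prop where
  mem : ∀ a, E a ∈ B
  eq_self : ∀ b ∈ B, E b = b
  norm_le : ∀ a, ‖E a‖ ≤ ‖a‖
  pos : ∀ a, ∃ b ∈ B, E (star a * a) = star b * b
  mul_left : ∀ b ∈ B, ∀ a, E (b * a) = b * E a
  mul_right : ∀ a, ∀ b ∈ B, E (a * b) = E a * b

/-- A C*-algebra `alg` topologically graded by the Fell bundle `𝒜`: an injective homomorphism `i`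
of `Γ_c(𝒜)` onto a dense `*`-subalgebra such that restriction of sections to the unit space
extends to a conditional expectation of `alg` onto (the canonical copy of `Γ_0(𝒜⁰)`, namely)
the closure of `i(Γ_c(𝒜⁰))`. -/
structure TopGrading {G : Type u} [TopologicalSpace G] [EtaleGroupoid G] [T2Space G]
    (𝒜 : FellBundle G) where
  alg : Type u
  [cstar : NonUnitalCStarAlgebra alg]
  i : 𝒜.Cc →⋆ₙₐ[ℂ] alg
  injective_i : Function.Injective i
  denseRange_i : DenseRange i
  exists_condExp : ∃ E : alg →ₗ[ℂ] alg,
    IsConditionalExpectation (closure (i '' {f | f.IsDiagonal})) E ∧ ∀ f, E (i f) = i f.restrict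

attribute [instance] TopGrading.cstar

/-- The objects `(A, 𝒜, i)`: C*-algebras `A` with a topological `G`-grading `(𝒜, i)`. -/
structure TopGradedAlg (G : Type u) [TopologicalSpace G] [EtaleGroupoid G] [T2Space G] where
  bundle : FellBundle G
  grading : TopGrading bundle

section graded

variable {G : Type u} [TopologicalSpace G] [EtaleGroupoid G] [T2Space G]

namespace TopGrading

variable {𝒜 : FellBundle G}

/-- `alg` is the full C*-algebra `C*(𝒜)` with its canonical embedding `i`, i.e. the completion of
`Γ_c(𝒜)` in the norm `‖f‖ = sup {‖π f‖ : π a representation of Γ_c(𝒜) on a Hilbert space}`. -/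
def IsFull (T : TopGrading 𝒜) : Prop :=
  ∀ f : 𝒜.Cc, IsLUB {t : ℝ | ∃ (H : Type u) (_ : NormedAddCommGroup H)
    (_ : InnerProductSpace ℂ H) (_ : CompleteSpace H) (π : 𝒜.Cc →⋆ₙₐ[ℂ] (H →L[ℂ] H)),
    t = ‖π f‖} ‖T.i f‖

/-- `alg` is the reduced C*-algebra `C*_r(𝒜)` with its canonical embedding `i`, i.e. the
completion of `Γ_c(𝒜)` in the operator norm of the left regular representation
`f ↦ (ξ ↦ f * ξ)` on `L²(𝒜)`, the completion of `Γ_c(𝒜)` in the norm `norm₂`. -/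
def IsReduced (T : TopGrading 𝒜) : Prop :=
  ∀ f : 𝒜.Cc, IsLUB {t : ℝ | ∃ ξ : 𝒜.Cc, ξ.norm₂ ≤ 1 ∧ t = (f * ξ).norm₂} ‖T.i f‖

open scoped CStarAlgebra in
theorem hom_ext (T : TopGrading 𝒜) {D : Type u} [NonUnitalCStarAlgebra D]
    {Φ Ψ : T.alg →⋆ₙₐ[ℂ] D} (h : ∀ f, Φ (T.i f) = Ψ (T.i f)) : Φ = Ψ :=
  DFunLike.coe_injective
    (T.denseRange_i.equalizer (map_continuous Φ) (map_continuous Ψ) (funext h))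

end TopGrading

namespace TopGradedAlg

/-- A morphism `(ϕ, φ) : (A, 𝒜, i) → (B, ℬ, j)`: a homomorphism `ϕ : A → B` and a Fell bundle
morphism `φ : 𝒜 → ℬ` with `ϕ ∘ i = j ∘ φ^c`. -/
@[ext]
structure Hom (X Y : TopGradedAlg G) where
  algHom : X.grading.alg →⋆ₙₐ[ℂ] Y.grading.alg
  bundleHom : FellBundle.Hom X.bundle Y.bundle
  comm : ∀ f, algHom (X.grading.i f) = Y.grading.i (bundleHom.mapCc f)

theorem Hom.ext' {X Y : TopGradedAlg G} {Φ Ψ : Hom X Y} (h : Φ.bundleHom = Ψ.bundleHom) :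
    Φ = Ψ :=
  Hom.ext (X.grading.hom_ext fun f => by rw [Φ.comm, Ψ.comm, h]) h

/-- The category of topologically `G`-graded C*-algebras. -/
instance : Category (TopGradedAlg G) where
  Hom := Hom
  id X := ⟨NonUnitalStarAlgHom.id ℂ _, FellBundle.Hom.id _, fun _ => rfl⟩
  comp Φ Ψ := ⟨Ψ.algHom.comp Φ.algHom, Ψ.bundleHom.comp Φ.bundleHom, fun f => by
    rw [NonUnitalStarAlgHom.comp_apply, Φ.comm, Ψ.comm]; rfl⟩
  id_comp _ := rfl
  comp_id _ := rfl
  assoc _ _ _ := rfl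

end TopGradedAlg

/-- The choice `T` of a grading for each Fell bundle has induced maps: each `φ : 𝒜 → ℬ` induces a
homomorphism `Φ` (necessarily unique) of the C*-algebras with `Φ ∘ i = j ∘ φ^c`. For `C*(𝒜)` it is
`φ^m`, for `C*_r(𝒜)` it is `φ^n`. -/
def HasInducedMaps (T : ∀ 𝒜 : FellBundle G, TopGrading 𝒜) : Prop :=
  ∀ (𝒜 ℬ : FellBundle G) (φ : FellBundle.Hom 𝒜 ℬ), ∃ Φ : (T 𝒜).alg →⋆ₙₐ[ℂ] (T ℬ).alg,
    ∀ f, Φ ((T 𝒜).i f) = (T ℬ).i (φ.mapCc f)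

/-- The functor given by `(A, 𝒜, i) ↦ (T 𝒜, 𝒜, i_{T 𝒜})` on objects and `(ϕ, φ) ↦ (Φ, φ)` on
morphisms, with `Φ` the homomorphism induced by `φ`. For `T = C*` it is the maximalization functor
`M`, for `T = C*_r` it is the normalization functor `N`. -/
noncomputable def gradingFunctor (T : ∀ 𝒜 : FellBundle G, TopGrading 𝒜) (hT : HasInducedMaps T) :
    TopGradedAlg G ⥤ TopGradedAlg G where
  obj X := ⟨X.bundle, T X.bundle⟩
  map {X Y} Φ := ⟨(hT X.bundle Y.bundle Φ.bundleHom).choose, Φ.bundleHom,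
    (hT X.bundle Y.bundle Φ.bundleHom).choose_spec⟩
  map_id _ := TopGradedAlg.Hom.ext' rfl
  map_comp _ _ := TopGradedAlg.Hom.ext' rfl

/-- `T` maps onto every topological grading: there are homomorphisms (necessarily unique)
`ψ_(A, 𝒜, i)` with `ψ_(A, 𝒜, i) ∘ i_{T 𝒜} = i`. -/
def MapsOnto (T : ∀ 𝒜 : FellBundle G, TopGrading 𝒜) : Prop :=
  ∀ X : TopGradedAlg G, ∃ Ψ : (T X.bundle).alg →⋆ₙₐ[ℂ] X.grading.alg,
    ∀ f, Ψ ((T X.bundle).i f) = X.grading.i f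

/-- The natural transformation `ψ` with components `(ψ_(A, 𝒜, i), id)`. -/
noncomputable def psi (T : ∀ 𝒜 : FellBundle G, TopGrading 𝒜) (hT : HasInducedMaps T)
    (hψ : MapsOnto T) : gradingFunctor T hT ⟶ 𝟭 (TopGradedAlg G) where
  app X := (⟨(hψ X).choose, FellBundle.Hom.id _, (hψ X).choose_spec⟩ :
    TopGradedAlg.Hom ⟨X.bundle, T X.bundle⟩ X)
  naturality _ _ _ := TopGradedAlg.Hom.ext' rfl

/-- Every topological grading maps onto `T`: there are homomorphisms (necessarily unique)
`η_(A, 𝒜, i)` with `η_(A, 𝒜, i) ∘ i = i_{T 𝒜}`. -/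
def MapsFrom (T : ∀ 𝒜 : FellBundle G, TopGrading 𝒜) : Prop :=
  ∀ X : TopGradedAlg G, ∃ H : X.grading.alg →⋆ₙₐ[ℂ] (T X.bundle).alg,
    ∀ f, H (X.grading.i f) = (T X.bundle).i f

/-- The natural transformation `η` with components `(η_(A, 𝒜, i), id)`. -/
noncomputable def eta (T : ∀ 𝒜 : FellBundle G, TopGrading 𝒜) (hT : HasInducedMaps T)
    (hη : MapsFrom T) : 𝟭 (TopGradedAlg G) ⟶ gradingFunctor T hT where
  app X := (⟨(hη X).choose, FellBundle.Hom.id _, (hη X).choose_spec⟩ :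
    TopGradedAlg.Hom X ⟨X.bundle, T X.bundle⟩)
  naturality _ _ _ := TopGradedAlg.Hom.ext' rfl

end graded

namespace MaxNor

open CategoryTheory.Limits

universe v w

variable {𝒞 : Type w} [Category.{v} 𝒞] {M N : 𝒞 ⥤ 𝒞} (ψ : M ⟶ 𝟭 𝒞) (η : 𝟭 𝒞 ⟶ N)

/-- The objects of the full subcategory `𝒞^ψ`: those `y` for which `ψ_y` is an isomorphism. -/
def maximal : ObjectProperty 𝒞 := fun y => IsIso (ψ.app y)

/-- The objects of the full subcategory `𝒞^η`: those `y` for which `η_y` is an isomorphism. -/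
def normal : ObjectProperty 𝒞 := fun y => IsIso (η.app y)

/-- `M^ψ`: the functor `M` with values in `𝒞^ψ`. -/
abbrev corefl (hM : ∀ x, IsIso (ψ.app (M.obj x))) : 𝒞 ⥤ (maximal ψ).FullSubcategory :=
  (maximal ψ).lift M hM

/-- `N^η`: the functor `N` with values in `𝒞^η`. -/
abbrev refl (hN : ∀ x, IsIso (η.app (N.obj x))) : 𝒞 ⥤ (normal η).FullSubcategory :=
  (normal η).lift N hN

/-- The conditions that make an equivalence between `𝒞^ψ` and `𝒞^η` a "maximal-normal" one: for
each object `x`, the pair `(N x, η_x ∘ ψ_x)` is initial in the comma category `M x ↓ 𝒞^η`, and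
`(M x, η_x ∘ ψ_x)` is final in `𝒞^ψ ↓ N x`; and also in the form that `M η` and `N ψ` are natural
isomorphisms. -/
structure IsMaximalNormal (hM : ∀ x, IsIso (ψ.app (M.obj x)))
    (hN : ∀ x, IsIso (η.app (N.obj x))) : Prop where
  initial : ∀ x : 𝒞, Nonempty (IsInitial (StructuredArrow.mk (S := M.obj x) (T := (normal η).ι)
    (Y := (refl η hN).obj x) (ψ.app x ≫ η.app x)))
  final : ∀ x : 𝒞, Nonempty (IsTerminal (CostructuredArrow.mk (T := N.obj x)
    (S := (maximal ψ).ι) (Y := (corefl ψ hM).obj x) (ψ.app x ≫ η.app x)))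
  isIso_map_eta : ∀ x : 𝒞, IsIso (M.map (η.app x))
  isIso_map_psi : ∀ x : 𝒞, IsIso (N.map (ψ.app x))

/-- `M^ψ` is right adjoint to the inclusion of `𝒞^ψ` with counit `ψ`, `N^η` is left adjoint to the
inclusion of `𝒞^η` with unit `η`, the composite adjunction `N^η ∘ Inc ⊣ M^ψ ∘ Inc` between `𝒞^ψ`
and `𝒞^η` is an adjoint equivalence (its unit and its counit are isomorphisms), it is of
maximal-normal type, and `N^η ≅ (N^η ∘ Inc) ∘ M^ψ` and `M^ψ ≅ (M^ψ ∘ Inc) ∘ N^η`. -/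
def MaximalNormalEquivalence : Prop :=
  ∃ (hM : ∀ x, IsIso (ψ.app (M.obj x))) (hN : ∀ x, IsIso (η.app (N.obj x)))
    (adjM : (maximal ψ).ι ⊣ corefl ψ hM) (adjN : refl η hN ⊣ (normal η).ι),
    (∀ x, adjM.counit.app x = ψ.app x) ∧
    (∀ x, adjN.unit.app x = η.app x) ∧
    IsIso (adjM.comp adjN).unit ∧
    IsIso (adjM.comp adjN).counit ∧
    IsMaximalNormal ψ η hM hN ∧
    Nonempty (refl η hN ≅ corefl ψ hM ⋙ ((maximal ψ).ι ⋙ refl η hN)) ∧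
    Nonempty (corefl ψ hM ≅ refl η hN ⋙ ((normal η).ι ⋙ corefl ψ hM))

end MaxNor

/-! A morphism of gradings is determined by its Fell bundle component, because i has dense range
(`TopGradedAlg.Hom.ext'`). The functors M and N depend on the bundle alone, and the components of ψ
and η are the identity on bundles. So M x, M M x and M N x are the same object, and an endomorphism
over the identity of the bundle is the identity: all relations such as M(ψ_x) = ψ_{Mx}, or the
invertibility of M(η_x) and N(ψ_x), are automatic once the morphisms exist. The rest is formal: an
idempotent coreflection and an idempotent reflection with M η and N ψ invertible form a
maximal-normal equivalence (`maximalNormalEquivalence_of_isIso_map`).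

The analysis lies in the existence. For C*(𝒜), a section is a finite sum of sections k supported in
sets on which s is injective. Then k k* lives on the units, and ‖π(k)‖² = ‖π(k k*)‖ ≤ ‖k k*‖_∞ for
every representation π, since the sections over the units supported in a fixed compact set form a
C*-algebra. So the universal norm is finite (`exists_norm_map_le`). By Gelfand–Naimark it dominates
every homomorphism into a C*-algebra, whence ψ and the induced maps.

For C*_r(𝒜), everything rests on a growth principle (`norm₂_mul_le_of_growth`,
`redNorm_le_sqrt_of_growth`): if for each ξ the norms of ⟨ξ, (f* f)ⁿ ξ⟩ are at most C_ξ ρⁿ, then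
‖f‖_r² ≤ ρ. Indeed, by Cauchy–Schwarz the sequence ‖(f* f)ⁿ ξ‖₂ is logarithmically convex, so its
first ratio is at most its exponential growth rate. The constant C_ξ does not matter, so crude
estimates give sharp norms. Estimates in the supremum norm show that the regular representation is
bounded and that f ↦ φ ∘ f does not increase ‖·‖_r; estimates through the conditional expectation
show ‖f‖_r ≤ ‖i(f)‖ for every topological grading, whence η. Finally ‖f‖_∞ ≤ ‖f‖_r
(`supNorm_le_redNorm`) makes both seminorms norms and makes restriction to the units extend to a
conditional expectation. -/

/-! ### Completion of a *-algebra in a C*-seminorm -/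

section completion

set_option linter.unusedSectionVars false

open UniformSpace

/-- A C*-seminorm on a complex `*`-algebra. -/
structure CStarSeminorm (R : Type u) [NonUnitalRing R] [StarRing R] [Module ℂ R] where
  toFun : R → ℝ
  add_le' : ∀ a b, toFun (a + b) ≤ toFun a + toFun b
  smul' : ∀ (c : ℂ) a, toFun (c • a) = ‖c‖ * toFun a
  mul_le' : ∀ a b, toFun (a * b) ≤ toFun a * toFun b
  sq_le' : ∀ a, toFun a ^ 2 ≤ toFun (star a * a)

namespace CStarSeminorm

variable {R : Type u} [NonUnitalRing R] [StarRing R] [Module ℂ R]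

instance : CoeFun (CStarSeminorm R) fun _ => R → ℝ := ⟨toFun⟩

variable (p : CStarSeminorm R)

/-- The underlying seminorm. -/
noncomputable def toSeminorm : Seminorm ℂ R := Seminorm.of p p.add_le' p.smul'

/-- From p(a)² ≤ p(a* a) ≤ p(a*) p(a). The involution is therefore isometric without this being an
axiom. -/
theorem le_star (a : R) : p a ≤ p (star a) := by
  have h : p a ^ 2 ≤ p (star a) * p a := (p.sq_le' a).trans (p.mul_le' _ _)
  rcases (apply_nonneg p.toSeminorm a).eq_or_lt with h0 | h0
  · exact h0.symm.le.trans (apply_nonneg p.toSeminorm _)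
  · rw [sq] at h
    exact le_of_mul_le_mul_right h h0

theorem star_eq (a : R) : p (star a) = p a :=
  le_antisymm (by simpa using p.le_star (star a)) (p.le_star a)

/-- The algebra `R`, seminormed by `p`. -/
def Core (_ : CStarSeminorm R) : Type u := R

instance : AddCommGroup p.Core := inferInstanceAs (AddCommGroup R)

instance : Module ℂ p.Core := inferInstanceAs (Module ℂ R)

noncomputable instance : SeminormedAddCommGroup p.Core :=
  AddGroupSeminorm.toSeminormedAddCommGroup (E := p.Core) p.toSeminorm.toAddGroupSeminorm

noncomputable instance : NormedSpace ℂ p.Core where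
  norm_smul_le c a := (map_smul_eq_mul p.toSeminorm c a).le

/-- The completion of `R` in the seminorm `p`. -/
abbrev Compl : Type u := Completion p.Core

/-- The canonical map into the completion. -/
noncomputable def ofCore : p.Core →L[ℂ] p.Compl := Completion.toComplL

theorem norm_ofCore (a : R) : ‖p.ofCore (a : p.Core)‖ = p a := Completion.norm_coe _

theorem denseRange_ofCore : DenseRange p.ofCore := Completion.denseRange_coe

variable [IsScalarTower ℂ R R] [SMulCommClass ℂ R R] [StarModule ℂ R]

/-- The product of `R`. -/
noncomputable def mulCore : p.Core →L[ℂ] p.Core →L[ℂ] p.Core :=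
  LinearMap.mkContinuous₂ (LinearMap.mul ℂ R) 1 fun a b => by
    rw [one_mul]; exact p.mul_le' a b

/-- The involution of `R`. -/
noncomputable def starCore : p.Core →L⋆[ℂ] p.Core :=
  LinearMap.mkContinuous
    ({ toFun := fun a => star (a : R), map_add' := star_add (R := R),
       map_smul' := fun c a => star_smul c (a : R) } : R →ₗ⋆[ℂ] R) 1 fun a => by
    rw [one_mul]; exact (p.star_eq a).le

/-- Left multiplication by elements of `R` on the completion. -/
noncomputable def mulLeft : p.Core →L[ℂ] p.Compl →L[ℂ] p.Compl :=
  LinearMap.mkContinuous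
    { toFun := fun a => (p.mulCore a).completion
      map_add' := fun a b => ContinuousLinearMap.ext fun x =>
        p.denseRange_ofCore.induction_on
          (p := fun x => ((p.mulCore (a + b)).completion : p.Compl → p.Compl) x =
            (p.mulCore a).completion x + (p.mulCore b).completion x) x
          (isClosed_eq (ContinuousLinearMap.continuous _)
            ((ContinuousLinearMap.continuous _).add (ContinuousLinearMap.continuous _)))
          fun y => by
            refine (ContinuousLinearMap.completion_apply_coe _ _).trans ?_
            erw [ContinuousLinearMap.completion_apply_coe, ContinuousLinearMap.completion_apply_coe]
            rw [map_add, add_apply]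
            exact Completion.coe_add _ _
      map_smul' := fun c a => ContinuousLinearMap.ext fun x =>
        p.denseRange_ofCore.induction_on
          (p := fun x => ((p.mulCore (c • a)).completion : p.Compl → p.Compl) x =
            c • (p.mulCore a).completion x) x
          (isClosed_eq (ContinuousLinearMap.continuous _)
            ((ContinuousLinearMap.continuous _).const_smul c))
          fun y => by
            refine (ContinuousLinearMap.completion_apply_coe _ _).trans ?_
            erw [ContinuousLinearMap.completion_apply_coe]
            rw [map_smul, smul_apply]
            exact Completion.coe_smul _ _ } 1 fun a => by
    rw [one_mul]
    refine ContinuousLinearMap.opNorm_le_bound _ (norm_nonneg _) fun x => ?_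
    refine p.denseRange_ofCore.induction_on
      (p := fun x : p.Compl => ‖((p.mulCore a).completion : p.Compl → p.Compl) x‖ ≤ ‖a‖ * ‖x‖) x
      (isClosed_le (ContinuousLinearMap.continuous _).norm (continuous_const.mul continuous_norm))
      fun y => ?_
    erw [ContinuousLinearMap.completion_apply_coe, Completion.norm_coe, Completion.norm_coe]
    exact p.mul_le' _ _

/-- The product of the completion. -/
noncomputable def mulCompl : p.Compl →L[ℂ] p.Compl →L[ℂ] p.Compl := p.mulLeft.fromCompletion

/-- The involution of the completion. -/
noncomputable def starCompl : p.Compl →L⋆[ℂ] p.Compl := p.starCore.completion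

theorem mulCompl_coe (a b : R) :
    p.mulCompl (p.ofCore a) (p.ofCore b) = p.ofCore ((a * b : R) : p.Core) := by
  refine (DFunLike.congr_fun (ContinuousLinearMap.fromCompletion_apply_coe p.mulLeft a) _).trans ?_
  exact ContinuousLinearMap.completion_apply_coe _ _

theorem starCompl_coe (a : R) : p.starCompl (p.ofCore a) = p.ofCore ((star a : R) : p.Core) :=
  ContinuousLinearMap.completion_apply_coe _ _

noncomputable instance : Mul p.Compl := ⟨fun x y => p.mulCompl x y⟩

noncomputable instance : Star p.Compl := ⟨fun x => p.starCompl x⟩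

theorem ofCore_mul (a b : R) :
    p.ofCore ((a * b : R) : p.Core) = p.ofCore a * p.ofCore b := (p.mulCompl_coe a b).symm

theorem ofCore_star (a : R) : p.ofCore ((star a : R) : p.Core) = star (p.ofCore a) :=
  (p.starCompl_coe a).symm

theorem continuous_mul_compl : Continuous fun x : p.Compl × p.Compl => x.1 * x.2 :=
  (p.mulCompl.continuous.comp continuous_fst).clm_apply continuous_snd

theorem continuous_star_compl : Continuous fun x : p.Compl => star x := p.starCompl.continuous

/-- The algebraic identities and norm inequalities of a C*-algebra are closed conditions, so they
pass from `R` to its completion one variable at a time. -/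
theorem compl_induction {P : p.Compl → Prop} (hP : IsClosed {x | P x})
    (h : ∀ a : R, P (p.ofCore a)) (x : p.Compl) : P x :=
  p.denseRange_ofCore.induction_on x hP h

instance : ContinuousMul p.Compl := ⟨p.continuous_mul_compl⟩

instance : ContinuousStar p.Compl := ⟨p.continuous_star_compl⟩

noncomputable instance : NonUnitalNormedRing p.Compl where
  __ := (inferInstance : NormedAddCommGroup p.Compl)
  left_distrib x y z := (p.mulCompl x).map_add y z
  right_distrib x y z := by
    change p.mulCompl (x + y) z = p.mulCompl x z + p.mulCompl y z
    rw [map_add, add_apply]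
  zero_mul x := by
    change p.mulCompl 0 x = 0
    rw [map_zero, zero_apply]
  mul_zero x := (p.mulCompl x).map_zero
  mul_assoc x y z := by
    refine p.compl_induction (P := fun x => x * y * z = x * (y * z))
      (isClosed_eq (by fun_prop) (by fun_prop)) (fun a => ?_) x
    refine p.compl_induction (P := fun y => p.ofCore a * y * z = p.ofCore a * (y * z))
      (isClosed_eq (by fun_prop) (by fun_prop)) (fun b => ?_) y
    refine p.compl_induction
      (P := fun z => p.ofCore a * p.ofCore b * z = p.ofCore a * (p.ofCore b * z))
      (isClosed_eq (by fun_prop) (by fun_prop)) (fun c => ?_) z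
    rw [← ofCore_mul, ← ofCore_mul, ← ofCore_mul, ← ofCore_mul, mul_assoc]
  norm_mul_le x y := by
    refine p.compl_induction (P := fun x => ‖x * y‖ ≤ ‖x‖ * ‖y‖)
      (isClosed_le (by fun_prop) (by fun_prop)) (fun a => ?_) x
    refine p.compl_induction (P := fun y => ‖p.ofCore a * y‖ ≤ ‖p.ofCore a‖ * ‖y‖)
      (isClosed_le (by fun_prop) (by fun_prop)) (fun b => ?_) y
    rw [← ofCore_mul]
    simp only [norm_ofCore]
    exact p.mul_le' a b

noncomputable instance : StarRing p.Compl where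
  star_involutive x := by
    refine p.compl_induction (P := fun x => star (star x) = x)
      (isClosed_eq (by fun_prop) (by fun_prop)) (fun a => ?_) x
    rw [← ofCore_star, ← ofCore_star, star_star]
  star_mul x y := by
    refine p.compl_induction (P := fun x => star (x * y) = star y * star x)
      (isClosed_eq (by fun_prop) (by fun_prop)) (fun a => ?_) x
    refine p.compl_induction (P := fun y => star (p.ofCore a * y) = star y * star (p.ofCore a))
      (isClosed_eq (by fun_prop) (by fun_prop)) (fun b => ?_) y
    rw [← ofCore_mul, ← ofCore_star, ← ofCore_star, ← ofCore_star, ← ofCore_mul, star_mul]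
  star_add x y := p.starCompl.map_add x y

noncomputable instance : NonUnitalCStarAlgebra p.Compl where
  norm_mul_self_le x := by
    refine p.compl_induction (P := fun x => ‖x‖ * ‖x‖ ≤ ‖star x * x‖)
      (isClosed_le (by fun_prop) (by fun_prop)) (fun a => ?_) x
    rw [← ofCore_star, ← ofCore_mul, ← sq]
    simp only [norm_ofCore]
    exact p.sq_le' a
  smul_assoc c x y := by
    change p.mulCompl (c • x) y = c • p.mulCompl x y
    rw [map_smul, smul_apply]
  smul_comm c x y := ((p.mulCompl x).map_smul c y).symm
  star_smul c x := p.starCompl.map_smulₛₗ c x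

/-- The canonical homomorphism into the completion. -/
noncomputable def toCompl : R →⋆ₙₐ[ℂ] p.Compl where
  toFun a := p.ofCore a
  map_smul' c a := p.ofCore.map_smul c a
  map_zero' := p.ofCore.map_zero
  map_add' a b := p.ofCore.map_add a b
  map_mul' := p.ofCore_mul
  map_star' := p.ofCore_star

theorem norm_toCompl (a : R) : ‖p.toCompl a‖ = p a := p.norm_ofCore a

theorem denseRange_toCompl : DenseRange p.toCompl := p.denseRange_ofCore

end CStarSeminorm

/-- A `*`-homomorphism extends along a dense `*`-homomorphism that dominates it in norm. -/
theorem exists_starAlgHom_extension {R A B : Type*} [NonUnitalRing R] [StarRing R] [Module ℂ R]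
    [NonUnitalCStarAlgebra A] [NonUnitalCStarAlgebra B] (i : R →⋆ₙₐ[ℂ] A) (hi : DenseRange i)
    (j : R →⋆ₙₐ[ℂ] B) (h : ∀ f, ‖j f‖ ≤ ‖i f‖) : ∃ Φ : A →⋆ₙₐ[ℂ] B, ∀ f, Φ (i f) = j f := by
  let il : R →ₗ[ℂ] A := { toFun := i, map_add' := map_add i, map_smul' := map_smul i }
  let jl : R →ₗ[ℂ] B := { toFun := j, map_add' := map_add j, map_smul' := map_smul j }
  let Φ : A →L[ℂ] B := jl.extendOfNorm il
  have hΦ : ∀ f, Φ (i f) = j f := fun f =>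
    LinearMap.extendOfNorm_eq (f := jl) (e := il) hi ⟨1, fun f => by rw [one_mul]; exact h f⟩ f
  have hc : Continuous Φ := Φ.continuous
  refine ⟨{ toFun := Φ, map_add' := Φ.map_add, map_smul' := Φ.map_smul, map_zero' := Φ.map_zero,
            map_mul' := fun a b => ?_, map_star' := fun a => ?_ }, hΦ⟩
  · refine hi.induction_on (p := fun a => Φ (a * b) = Φ a * Φ b) a
      (isClosed_eq (by fun_prop) (by fun_prop)) fun f => ?_
    refine hi.induction_on (p := fun b => Φ (i f * b) = Φ (i f) * Φ b) b
      (isClosed_eq (by fun_prop) (by fun_prop)) fun g => ?_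
    rw [← map_mul, hΦ, hΦ, hΦ, map_mul]
  · refine hi.induction_on (p := fun a => Φ (star a) = star (Φ a)) a
      (isClosed_eq (by fun_prop) (by fun_prop)) fun f => ?_
    rw [← map_star, hΦ, hΦ, map_star]

end completion

/-! ### Logarithmically convex sequences -/

/-- A logarithmically convex sequence of exponential growth `ρ` has first ratio at most `ρ`. -/
theorem le_mul_of_sq_le_mul_of_growth {a : ℕ → ℝ} {ρ C : ℝ} (h0 : ∀ n, 0 ≤ a n) (hρ : 0 ≤ ρ)
    (hlog : ∀ n, a (n + 1) ^ 2 ≤ a n * a (n + 2)) (hC : ∀ n, a n ≤ C * ρ ^ n) :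
    a 1 ≤ ρ * a 0 := by
  by_contra! hlt
  have ha1 : 0 < a 1 := (mul_nonneg hρ (h0 0)).trans_lt hlt
  have ha0 : 0 < a 0 := by
    refine (h0 0).lt_of_ne' fun h => ?_
    have := hlog 0
    rw [h, zero_mul, zero_add] at this
    exact (pow_pos ha1 2).not_ge this
  set q := a 1 / a 0
  have hq : ρ < q := (lt_div_iff₀ ha0).2 hlt
  have hq0 : 0 < q := div_pos ha1 ha0
  -- Log-convexity makes the successive ratios nondecreasing, so all of them are at least the first
  -- one, `q`. Positivity is carried along to allow the cancellation of `a n`.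
  have key : ∀ n, 0 < a n ∧ q * a n ≤ a (n + 1) := by
    intro n
    induction n with
    | zero => exact ⟨ha0, by simp [q, ha0.ne']⟩
    | succ n ih =>
      have h1 : 0 < a (n + 1) := (mul_pos hq0 ih.1).trans_le ih.2
      refine ⟨h1, le_of_mul_le_mul_left ?_ ih.1⟩
      calc a n * (q * a (n + 1)) = q * a n * a (n + 1) := by ring
        _ ≤ a (n + 1) * a (n + 1) := by gcongr; exact ih.2
        _ ≤ a n * a (n + 1 + 1) := by rw [← sq]; exact hlog n
  have hpow : ∀ n, a 0 * q ^ n ≤ a n := by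
    intro n
    induction n with
    | zero => simp
    | succ n ih =>
      calc a 0 * q ^ (n + 1) = q * (a 0 * q ^ n) := by ring
        _ ≤ q * a n := by gcongr
        _ ≤ _ := (key n).2
  have hCpos : 0 ≤ C := by simpa using (h0 0).trans (hC 0)
  rcases hρ.eq_or_lt with hρ0 | hρ0
  · have := hC 1
    rw [← hρ0] at this
    simp at this
    linarith
  · obtain ⟨n, hn⟩ := pow_unbounded_of_one_lt (C / a 0) ((one_lt_div hρ0).2 hq)
    rw [div_pow, div_lt_div_iff₀ ha0 (pow_pos hρ0 n)] at hn
    have := (hpow n).trans (hC n)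
    linarith

/-! ### States and the Gelfand–Naimark theorem -/

section GelfandNaimark

open scoped ComplexOrder CStarAlgebra

/-- A functional on a unital C*-algebra of norm at most one with value one at the unit is
positive. -/
theorem nonneg_of_norm_le_one {A : Type*} [CStarAlgebra A] [PartialOrder A] [StarOrderedRing A]
    [Nontrivial A] (f : A →L[ℂ] ℂ) (hf : ‖f‖ ≤ 1) (h1 : f 1 = 1) {a : A} (ha : 0 ≤ a) :
    0 ≤ f a := by
  have hbound : ∀ x, ‖f x‖ ≤ ‖x‖ := fun x =>
    (f.le_opNorm x).trans (mul_le_of_le_one_left (norm_nonneg _) hf)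
  have hsa : IsSelfAdjoint a := ha.isSelfAdjoint
  have him : (f a).im = 0 := by
    by_contra hne
    -- Evaluate `f` at a + it, whose norm squared is at most ‖a‖² + t². The t² terms cancel, and
    -- what is left is affine in t and bounded above, which forces the imaginary part to vanish. The
    -- contradiction comes from the t that makes the linear term equal to ‖a‖² + 1.
    have key : ∀ t : ℝ, (f a).im ^ 2 + 2 * t * (f a).im ≤ ‖a‖ ^ 2 := by
      intro t
      have h2 : ‖a + (Complex.I * t) • (1 : A)‖ ^ 2 ≤ ‖a‖ ^ 2 + t ^ 2 := by
        rw [sq, ← CStarRing.norm_star_mul_self]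
        have : star (a + (Complex.I * t) • (1 : A)) * (a + (Complex.I * t) • (1 : A)) =
            a * a + ((t ^ 2 : ℝ) : ℂ) • (1 : A) := by
          rw [star_add, hsa.star_eq, star_smul, star_one, add_mul, mul_add, mul_add,
            mul_smul_comm, smul_mul_assoc, smul_mul_assoc, mul_smul_comm, smul_smul]
          simp only [mul_one, one_mul, Complex.star_def, map_mul, Complex.conj_I,
            Complex.conj_ofReal]
          have e : -Complex.I * t * (Complex.I * t) = ((t ^ 2 : ℝ) : ℂ) := by
            push_cast; linear_combination -(t : ℂ) ^ 2 * Complex.I_mul_I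
          rw [e, neg_mul, neg_smul]
          abel
        rw [this]
        refine (norm_add_le _ _).trans (add_le_add ((norm_mul_le _ _).trans (sq _).ge) ?_)
        rw [norm_smul, norm_one, mul_one, Complex.norm_real, Real.norm_of_nonneg (sq_nonneg t)]
      have h3 : ((f a).im + t) ^ 2 ≤ ‖f (a + (Complex.I * t) • (1 : A))‖ ^ 2 := by
        have e : (f (a + (Complex.I * t) • (1 : A))).im = (f a).im + t := by
          rw [map_add, map_smul, h1]; simp
        rw [← e, ← sq_abs]
        gcongr
        exact Complex.abs_im_le_norm _
      have h4 := h3.trans ((pow_le_pow_left₀ (norm_nonneg _) (hbound _) 2).trans h2)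
      nlinarith
    have := key ((‖a‖ ^ 2 + 1) / (2 * (f a).im))
    have e : 2 * ((‖a‖ ^ 2 + 1) / (2 * (f a).im)) * (f a).im = ‖a‖ ^ 2 + 1 := by
      field_simp
    rw [e] at this
    nlinarith [sq_nonneg (f a).im]
  -- Since 0 ≤ a ≤ ‖a‖, the element ‖a‖ - a has norm at most ‖a‖, hence ‖a‖ - Re f(a) ≤ ‖a‖.
  have hre : 0 ≤ (f a).re := by
    have h2 : ‖(‖a‖ : ℂ) • (1 : A) - a‖ ≤ ‖a‖ := by
      have e : (‖a‖ : ℂ) • (1 : A) = algebraMap ℝ A ‖a‖ := by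
        rw [Algebra.algebraMap_eq_smul_one, Complex.coe_smul]
      rw [e]
      exact (CStarAlgebra.norm_le_iff_le_algebraMap _ (norm_nonneg _)
        (sub_nonneg.2 hsa.le_algebraMap_norm_self)).2 (sub_le_self _ ha)
    have h3 := (Complex.re_le_norm _).trans ((hbound _).trans h2)
    rw [map_sub, map_smul, h1] at h3
    simp at h3
    exact h3
  exact Complex.nonneg_iff.2 ⟨hre, him.symm⟩

/-- Every element of a C*-algebra attains its norm in a representation on a Hilbert space. -/
theorem exists_representation_norm_le {A : Type u} [NonUnitalCStarAlgebra A] (a : A) :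
    ∃ (H : Type u) (_ : NormedAddCommGroup H) (_ : InnerProductSpace ℂ H) (_ : CompleteSpace H)
      (π : A →⋆ₙₐ[ℂ] (H →L[ℂ] H)), ‖a‖ ≤ ‖π a‖ := by
  let B := Unitization ℂ A
  let b : B := (a : Unitization ℂ A)
  have hb : ‖b‖ = ‖a‖ := Unitization.norm_inr (𝕜 := ℂ) a
  let h : B := star b * b
  have hh : 0 ≤ h := star_mul_self_nonneg b
  have hnh : ‖h‖ = ‖b‖ ^ 2 := by rw [CStarRing.norm_star_mul_self, sq]
  by_cases ha : ‖a‖ = 0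
  · exact ⟨PUnit, inferInstance, inferInstance, inferInstance, 0, by rw [ha]; exact norm_nonneg _⟩
  have hpos : 0 < ‖h‖ := by
    rw [hnh, hb]; exact pow_pos ((norm_nonneg a).lt_of_ne' ha) 2
  -- A functional `f` of norm at most one that norms ‖h‖ + h, an element of norm 2‖h‖, must satisfy
  -- both f(1) = 1 and f(h) = ‖h‖: neither summand of ‖h‖ f(1) + f(h) = 2‖h‖ exceeds ‖h‖ in modulus.
  -- So `f` is a state attaining the norm of `h`.
  let y : B := algebraMap ℝ B ‖h‖ + h
  have hy : ‖y‖ = 2 * ‖h‖ := by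
    refine le_antisymm ?_ ?_
    · refine (norm_add_le _ _).trans ?_
      rw [norm_algebraMap']
      rw [two_mul, Real.norm_of_nonneg (norm_nonneg h)]
    · have h1 : 2 * ‖h‖ ∈ spectrum ℝ y := by
        rw [two_mul, ← spectrum.singleton_add_eq]
        exact Set.add_mem_add rfl (CStarAlgebra.norm_mem_spectrum_of_nonneg hh)
      refine (le_abs_self _).trans (spectrum.norm_le_norm_of_mem h1)
  obtain ⟨f, hf, hfy⟩ := exists_dual_vector'' ℂ y
  have hbound : ∀ x, ‖f x‖ ≤ ‖x‖ := fun x =>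
    (f.le_opNorm x).trans (mul_le_of_le_one_left (norm_nonneg _) hf)
  have hsum : (‖h‖ : ℂ) * f 1 + f h = 2 * ‖h‖ := by
    have e : f y = (‖h‖ : ℂ) * f 1 + f h := by
      simp only [y]
      rw [map_add, Algebra.algebraMap_eq_smul_one, ← Complex.coe_smul, map_smul, smul_eq_mul]
    rw [← e, hfy, hy]; push_cast; rfl
  have key : ∀ {z : ℂ} {t : ℝ}, ‖z‖ ≤ t → z.re = t → z = t := by
    intro z t hz hre
    refine Complex.ext hre ?_
    have h1 := Complex.sq_norm z
    rw [Complex.normSq_apply, hre] at h1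
    have h2 : ‖z‖ ^ 2 ≤ t ^ 2 := pow_le_pow_left₀ (norm_nonneg z) hz 2
    have h3 : z.im * z.im ≤ 0 := by nlinarith
    rw [Complex.ofReal_im]
    nlinarith [mul_self_nonneg z.im]
  have h1n : ‖f 1‖ ≤ 1 := (hbound 1).trans norm_one.le
  have hre := congrArg Complex.re hsum
  simp only [Complex.add_re, Complex.mul_re, Complex.ofReal_re, Complex.ofReal_im, zero_mul,
    sub_zero, Complex.re_ofNat, Complex.im_ofNat] at hre
  have hr1 := (Complex.re_le_norm (f 1)).trans h1n
  have hrh := (Complex.re_le_norm (f h)).trans (hbound h)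
  have hf1 : f 1 = 1 := by
    simpa using key (t := 1) h1n (by nlinarith)
  have hfh : f h = ‖h‖ := key (hbound h) (by nlinarith)
  let φ : B →ₚ[ℂ] ℂ := PositiveLinearMap.mk₀ f.toLinearMap
    fun x hx => nonneg_of_norm_le_one f hf hf1 hx
  refine ⟨φ.GNS, inferInstance, inferInstance, inferInstance,
    φ.gnsNonUnitalStarAlgHom.comp (Unitization.inrNonUnitalStarAlgHom ℂ A), ?_⟩
  -- The cyclic vector: it has norm f(1)^(1/2) = 1, and `b` sends it to a vector of squared norm
  -- f(b* b) = ‖a‖².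
  let ξ : φ.PreGNS := φ.toPreGNS 1
  have hξ : ‖(ξ : φ.GNS)‖ = 1 := by
    rw [UniformSpace.Completion.norm_coe, φ.preGNS_norm_def]
    have : φ (star (φ.ofPreGNS ξ) * φ.ofPreGNS ξ) = f 1 := by
      simp only [ξ, PositiveLinearMap.ofPreGNS_toPreGNS, star_one, mul_one]; rfl
    rw [this, hf1]; simp
  have hbξ : ‖φ.gnsNonUnitalStarAlgHom b (ξ : φ.GNS)‖ = ‖a‖ := by
    rw [PositiveLinearMap.gnsNonUnitalStarAlgHom_apply_coe, UniformSpace.Completion.norm_coe,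
      φ.preGNS_norm_def]
    have : φ (star (φ.ofPreGNS (φ.leftMulMapPreGNS b ξ)) *
        φ.ofPreGNS (φ.leftMulMapPreGNS b ξ)) = f h := by
      simp only [ξ, PositiveLinearMap.leftMulMapPreGNS_apply,
        PositiveLinearMap.ofPreGNS_toPreGNS, mul_one]; rfl
    rw [this, hfh, hnh, hb, Complex.ofReal_re, Real.sqrt_sq (norm_nonneg a)]
  have := (φ.gnsNonUnitalStarAlgHom b).le_opNorm (ξ : φ.GNS)
  rw [hξ, hbξ, mul_one] at this
  exact this

end GelfandNaimark

/-! ### Units of the groupoid -/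

namespace EtaleGroupoid

variable {G : Type u} [TopologicalSpace G] [EtaleGroupoid G]

theorem IsUnitArrow.s_eq {x : G} (hx : IsUnitArrow x) : s x = x := by
  have h := s_r x
  rwa [show r x = x from hx] at h

theorem IsUnitArrow.isProd_self {x : G} (hx : IsUnitArrow x) : IsProd x x x := by
  have h := isProd_s_self x
  rwa [hx.s_eq] at h

theorem IsUnitArrow.inv_eq {x : G} (hx : IsUnitArrow x) : x = inv x := by
  have h := inv_s x
  rw [hx.s_eq] at h
  exact h.symm

theorem isUnitArrow_s (g : G) : IsUnitArrow (s g) := r_s g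

theorem IsProd.eq_inv {g h x : G} (p : IsProd g h x) (hx : IsUnitArrow x) :
    g = EtaleGroupoid.inv h := by
  have h1 : x = s h := by rw [← p.s_eq, hx.s_eq]
  subst h1
  exact p.unique_left (isProd_inv_left h)

end EtaleGroupoid

set_option linter.unusedSectionVars false

/-! ### Fibres over units and sections restricted to the unit space -/

namespace FellBundle

variable {G : Type u} [TopologicalSpace G] [EtaleGroupoid G] (𝒜 : FellBundle G)

theorem norm_fmul_fstar_self {g g' k : G} (p : IsProd g' g k) (e : g' = inv g) (a : 𝒜.fiber g) :
    ‖𝒜.fmul p (𝒜.fstar e a) a‖ = ‖a‖ ^ 2 := by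
  subst e
  obtain rfl := p.unique (isProd_inv_left g)
  exact 𝒜.norm_fstar_fmul_self a

theorem exists_fmul_fstar_self_eq {g g' x : G} (p : IsProd g' g x) (e : g' = inv g)
    (hx : IsUnitArrow x) (a : 𝒜.fiber g) : ∃ b : 𝒜.fiber x,
    𝒜.fmul p (𝒜.fstar e a) a = 𝒜.fmul hx.isProd_self (𝒜.fstar hx.inv_eq b) b := by
  subst e
  obtain rfl := p.unique (isProd_inv_left g)
  exact 𝒜.fstar_fmul_self_pos a

theorem norm_le_norm_fstar {g h : G} (e : h = inv g) (a : 𝒜.fiber g) : ‖a‖ ≤ ‖𝒜.fstar e a‖ := by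
  subst e
  have h := (𝒜.norm_fstar_fmul_self a).symm.le.trans (𝒜.norm_fmul_le _ _ _)
  rcases (norm_nonneg a).eq_or_lt with h0 | h0
  · rw [← h0]; exact norm_nonneg _
  · rw [sq] at h
    exact le_of_mul_le_mul_right h h0

theorem norm_fstar {g h : G} (e : h = inv g) (a : 𝒜.fiber g) : ‖𝒜.fstar e a‖ = ‖a‖ := by
  refine le_antisymm ?_ (𝒜.norm_le_norm_fstar e a)
  have e' : g = inv h := by rw [e, inv_inv_eq]
  exact (𝒜.norm_le_norm_fstar e' _).trans_eq (by rw [𝒜.fstar_fstar])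

/-- The fibre over a unit, as a C*-algebra. -/
def UnitFiber (x : {x : G // IsUnitArrow x}) : Type u := 𝒜.fiber x.1

variable (x : {x : G // IsUnitArrow x})

instance : NormedAddCommGroup (𝒜.UnitFiber x) := inferInstanceAs (NormedAddCommGroup (𝒜.fiber x.1))

instance : NormedSpace ℂ (𝒜.UnitFiber x) := inferInstanceAs (NormedSpace ℂ (𝒜.fiber x.1))

instance : CompleteSpace (𝒜.UnitFiber x) := inferInstanceAs (CompleteSpace (𝒜.fiber x.1))

instance : Mul (𝒜.UnitFiber x) := ⟨fun a b => 𝒜.fmul x.2.isProd_self a b⟩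

instance : Star (𝒜.UnitFiber x) := ⟨fun a => 𝒜.fstar x.2.inv_eq a⟩

instance : NonUnitalNormedRing (𝒜.UnitFiber x) where
  __ := (inferInstance : NormedAddCommGroup (𝒜.UnitFiber x))
  left_distrib a b c := (𝒜.fmul x.2.isProd_self a).map_add b c
  right_distrib a b c := by
    change 𝒜.fmul x.2.isProd_self (a + b) c = _
    erw [map_add]; rfl
  zero_mul a := by
    change 𝒜.fmul x.2.isProd_self 0 a = _
    rw [map_zero]; rfl
  mul_zero a := (𝒜.fmul x.2.isProd_self a).map_zero
  mul_assoc a b c := 𝒜.fmul_assoc _ _ _ _ a b c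
  norm_mul_le a b := 𝒜.norm_fmul_le _ a b

instance : StarRing (𝒜.UnitFiber x) where
  star_involutive a := 𝒜.fstar_fstar x.2.inv_eq x.2.inv_eq a
  star_mul a b := 𝒜.fstar_fmul _ _ _ _ _ a b
  star_add a b := (𝒜.fstar x.2.inv_eq).map_add a b

noncomputable instance : NonUnitalCStarAlgebra (𝒜.UnitFiber x) where
  norm_mul_self_le a := by
    rw [← sq]; exact (𝒜.norm_fmul_fstar_self x.2.isProd_self x.2.inv_eq a).symm.le
  smul_assoc c a b := by
    change 𝒜.fmul x.2.isProd_self (c • a) b = _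
    erw [map_smul]; rfl
  smul_comm c a b := ((𝒜.fmul x.2.isProd_self a).map_smul c b).symm
  star_smul c a := (𝒜.fstar x.2.inv_eq).map_smulₛₗ c a

attribute [local instance] CStarAlgebra.spectralOrder CStarAlgebra.spectralOrderedRing

/-- The positivity axiom of a Fell bundle replaces `a`, which may lie over any arrow, by an element
`b` of the C*-algebra over the unit. -/
theorem UnitFiber.nonneg_fmul_fstar_self {g g' : G} {x : {x : G // IsUnitArrow x}}
    (p : IsProd g' g x) (e : g' = inv g) (a : 𝒜.fiber g) :
    0 ≤ (show 𝒜.UnitFiber x from 𝒜.fmul p (𝒜.fstar e a) a) := by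
  obtain ⟨b, hb⟩ := 𝒜.exists_fmul_fstar_self_eq p e x.2 a
  rw [hb]
  exact star_mul_self_nonneg (show 𝒜.UnitFiber x from b)

/-- The C*-algebra of bounded families of elements of the fibres over the units. -/
abbrev UnitAlg : Type u := lp 𝒜.UnitFiber ⊤

namespace Cc

variable {𝒜}

/-- The norm of a continuous section is only upper semicontinuous, which still bounds it above on a
compact support. -/
theorem bddAbove_norm (f : 𝒜.Cc) : BddAbove (Set.range fun g => ‖f g‖) := by
  obtain ⟨K, hK, hf⟩ := f.compact_support
  have husc : UpperSemicontinuous fun g => ‖f g‖ :=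
    𝒜.upperSemicontinuous_norm.comp f.continuous_toFun
  obtain ⟨C, hC⟩ := (husc.upperSemicontinuousOn K).bddAbove_of_isCompact hK
  refine ⟨max C 0, ?_⟩
  rintro _ ⟨g, rfl⟩
  by_cases hg : g ∈ K
  · exact (hC ⟨g, hg, rfl⟩).trans (le_max_left _ _)
  · have : f g = 0 := hf g hg
    simp [this]

theorem norm_apply_le (f : 𝒜.Cc) (g : G) : ‖f g‖ ≤ f.supNorm := le_ciSup f.bddAbove_norm g

theorem supNorm_nonneg (f : 𝒜.Cc) : 0 ≤ f.supNorm := Real.iSup_nonneg fun _ => norm_nonneg _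

theorem supNorm_le {f : 𝒜.Cc} {C : ℝ} (hC : 0 ≤ C) (h : ∀ g, ‖f g‖ ≤ C) : f.supNorm ≤ C :=
  Real.iSup_le h hC

theorem supNorm_star (f : 𝒜.Cc) : (star f).supNorm = f.supNorm := by
  have key : ∀ f : 𝒜.Cc, (star f).supNorm ≤ f.supNorm := fun f =>
    supNorm_le f.supNorm_nonneg fun g => by
      rw [star_apply, norm_fstar]; exact f.norm_apply_le _
  refine le_antisymm (key f) ?_
  -- The ring structure on `Γ_c(𝒜)` needs a Hausdorff `G`, not assumed here, so the involutivity is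
  -- taken from `fstar_fstar` directly.
  have hs : conj 𝒜 (conj 𝒜 f) = f := by
    funext g
    have : ∀ (h : G) (_ : h = g) (e₂ : inv g = inv h) (e₃ : g = inv (inv g)),
        𝒜.fstar e₃ (𝒜.fstar e₂ (f h)) = f g := by
      rintro h rfl e₂ e₃
      exact 𝒜.fstar_fstar _ _ _
    exact this _ (inv_inv_eq g) _ _
  have hs' : star (star f) = f := Cc.ext fun g => congrFun hs g
  calc f.supNorm = (star (star f)).supNorm := by rw [hs']
    _ ≤ _ := key _

theorem eq_zero_of_supNorm {f : 𝒜.Cc} (h : f.supNorm = 0) : f = 0 :=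
  Cc.ext fun g => norm_le_zero_iff.1 ((f.norm_apply_le g).trans h.le)

/-- The values of a section on the unit space. -/
def onUnits : 𝒜.Cc →ₗ[ℂ] 𝒜.UnitAlg where
  toFun f := ⟨fun x => f x.1, memℓp_infty
    ⟨f.supNorm, by rintro _ ⟨x, rfl⟩; exact f.norm_apply_le x.1⟩⟩
  map_add' _ _ := rfl
  map_smul' _ _ := rfl

theorem onUnits_star (f : 𝒜.Cc) : onUnits (star f) = star (onUnits f) := by
  refine Subtype.ext (funext fun x => ?_)
  change 𝒜.fstar _ (f (inv x.1)) = 𝒜.fstar x.2.inv_eq (f x.1)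
  have : ∀ (k : G) (e : x.1 = inv k), k = x.1 →
      𝒜.fstar e (f k) = 𝒜.fstar x.2.inv_eq (f x.1) := by
    rintro k e rfl; rfl
  exact this _ _ x.2.inv_eq.symm

theorem norm_onUnits_le (f : 𝒜.Cc) : ‖onUnits f‖ ≤ f.supNorm :=
  lp.norm_le_of_forall_le f.supNorm_nonneg fun x => f.norm_apply_le x.1

theorem norm_apply_le_norm_onUnits (f : 𝒜.Cc) {x : G} (hx : IsUnitArrow x) :
    ‖f x‖ ≤ ‖onUnits f‖ :=
  lp.norm_apply_le_norm ENNReal.top_ne_zero (onUnits f) ⟨x, hx⟩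

theorem IsDiagonal.supNorm_eq {f : 𝒜.Cc} (hf : f.IsDiagonal) : f.supNorm = ‖onUnits f‖ := by
  refine le_antisymm (supNorm_le (norm_nonneg _) fun g => ?_) f.norm_onUnits_le
  by_cases hg : IsUnitArrow g
  · exact f.norm_apply_le_norm_onUnits hg
  · rw [hf g hg, norm_zero]; exact norm_nonneg _

theorem IsDiagonal.ext {f f' : 𝒜.Cc} (hf : f.IsDiagonal) (hf' : f'.IsDiagonal)
    (h : onUnits f = onUnits f') : f = f' := by
  refine Cc.ext fun g => ?_
  by_cases hg : IsUnitArrow g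
  · exact congrFun (congrArg Subtype.val h) ⟨g, hg⟩
  · rw [hf g hg, hf' g hg]

variable [T2Space G]

theorem restrict_apply_of_isUnit (f : 𝒜.Cc) {g : G} (hg : IsUnitArrow g) :
    f.restrict g = f g := if_pos hg

theorem isDiagonal_restrict (f : 𝒜.Cc) : f.restrict.IsDiagonal := fun _ hg => if_neg hg

theorem onUnits_restrict (f : 𝒜.Cc) : onUnits f.restrict = onUnits f :=
  Subtype.ext (funext fun x => f.restrict_apply_of_isUnit x.2)

theorem IsDiagonal.restrict_eq {f : 𝒜.Cc} (hf : f.IsDiagonal) : f.restrict = f :=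
  f.isDiagonal_restrict.ext hf f.onUnits_restrict

theorem supNorm_restrict (f : 𝒜.Cc) : f.restrict.supNorm = ‖onUnits f‖ := by
  rw [f.isDiagonal_restrict.supNorm_eq, onUnits_restrict]

theorem norm₂_sq (f : 𝒜.Cc) : f.norm₂ ^ 2 = ‖onUnits (star f * f)‖ := by
  rw [norm₂, Real.sq_sqrt (supNorm_nonneg _), supNorm_restrict]

theorem norm₂_nonneg (f : 𝒜.Cc) : 0 ≤ f.norm₂ := Real.sqrt_nonneg _

/-- A factorization of g whose left factor is a unit is (r g, g), so a single term of the
convolution survives. Restriction to the units is thereby a bimodule map over Γ_c(𝒜⁰). -/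
theorem mul_apply_of_isDiagonal_left {d : 𝒜.Cc} (hd : d.IsDiagonal) (f : 𝒜.Cc) (g : G) :
    (d * f) g = 𝒜.fmul (isProd_range g) (d (r g)) (f g) := by
  rw [mul_apply, finsum_eq_single _ ⟨(r g, g), isProd_range g⟩]
  rintro ⟨⟨a, b⟩, p⟩ hne
  by_cases ha : IsUnitArrow a
  · refine absurd ?_ hne
    have h1 : a = r g := by rw [p.r_eq]; exact ha.symm
    subst h1
    have h2 : b = g := p.unique_right (isProd_range g)
    subst h2
    rfl
  · rw [hd a ha, map_zero, LinearMap.zero_apply]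

theorem mul_apply_of_isDiagonal_right (f : 𝒜.Cc) {d : 𝒜.Cc} (hd : d.IsDiagonal) (g : G) :
    (f * d) g = 𝒜.fmul (isProd_source g) (f g) (d (s g)) := by
  rw [mul_apply, finsum_eq_single _ ⟨(g, s g), isProd_source g⟩]
  rintro ⟨⟨a, b⟩, p⟩ hne
  by_cases hb : IsUnitArrow b
  · refine absurd ?_ hne
    have h1 : b = s g := by rw [p.s_eq, hb.s_eq]
    subst h1
    have h2 : a = g := p.unique_left (isProd_source g)
    subst h2
    rfl
  · rw [hd b hb, map_zero]

theorem fmul_congr {g h g' h' k : G} (p : IsProd g h k) (p' : IsProd g' h' k) (f f' : 𝒜.Cc)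
    (hg : g = g') (hh : h = h') : 𝒜.fmul p (f g) (f' h) = 𝒜.fmul p' (f g') (f' h') := by
  subst hg; subst hh; rfl

theorem onUnits_mul_of_isDiagonal_left {d : 𝒜.Cc} (hd : d.IsDiagonal) (f : 𝒜.Cc) :
    onUnits (d * f) = onUnits d * onUnits f :=
  Subtype.ext (funext fun x => (mul_apply_of_isDiagonal_left hd f x.1).trans
    (fmul_congr _ x.2.isProd_self d f x.2 rfl))

theorem onUnits_mul_of_isDiagonal_right (f : 𝒜.Cc) {d : 𝒜.Cc} (hd : d.IsDiagonal) :
    onUnits (f * d) = onUnits f * onUnits d :=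
  Subtype.ext (funext fun x => (mul_apply_of_isDiagonal_right f hd x.1).trans
    (fmul_congr _ x.2.isProd_self f d rfl x.2.s_eq))

theorem IsDiagonal.mul {d d' : 𝒜.Cc} (hd : d.IsDiagonal) (hd' : d'.IsDiagonal) :
    (d * d').IsDiagonal := fun g hg => by
  rw [mul_apply_of_isDiagonal_left hd, hd' g hg, map_zero]

theorem IsDiagonal.star {d : 𝒜.Cc} (hd : d.IsDiagonal) : (star d).IsDiagonal := fun g hg => by
  rw [star_apply, hd, map_zero]
  intro h
  apply hg
  have := h.inv_eq
  rw [inv_inv_eq] at this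
  rwa [this] at h

theorem restrict_mul_left {d : 𝒜.Cc} (hd : d.IsDiagonal) (f : 𝒜.Cc) :
    (d * f).restrict = d * f.restrict := by
  refine (isDiagonal_restrict _).ext (hd.mul f.isDiagonal_restrict) ?_
  rw [onUnits_restrict, onUnits_mul_of_isDiagonal_left hd, onUnits_mul_of_isDiagonal_left hd,
    onUnits_restrict]

theorem restrict_mul_right (f : 𝒜.Cc) {d : 𝒜.Cc} (hd : d.IsDiagonal) :
    (f * d).restrict = f.restrict * d := by
  refine (isDiagonal_restrict _).ext (f.isDiagonal_restrict.mul hd) ?_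
  rw [onUnits_restrict, onUnits_mul_of_isDiagonal_right f hd,
    onUnits_mul_of_isDiagonal_right _ hd, onUnits_restrict]

section order

/-- The terms of the convolution `(f* * f)(x)`, where `x` is a unit. -/
def starMulTerm (f : 𝒜.Cc) (x : {x : G // IsUnitArrow x})
    (p : {p : G × G // IsProd p.1 p.2 x.1}) : 𝒜.UnitFiber x :=
  𝒜.fmul p.2 (𝒜.fstar (p.2.eq_inv x.2) (f p.1.2)) (f p.1.2)

theorem star_mul_self_apply (f : 𝒜.Cc) (x : {x : G // IsUnitArrow x}) :
    (show 𝒜.UnitFiber x from (star f * f) x.1) = ∑ᶠ p, f.starMulTerm x p := by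
  refine (mul_apply _ _ _).trans (finsum_congr fun p => ?_)
  have : ∀ (h k : G) (q : IsProd h k x.1) (e : h = inv k),
      𝒜.fmul q (star f h) (f k) = 𝒜.fmul q (𝒜.fstar e (f k)) (f k) := by
    rintro h k q rfl
    congr 1
    rw [star_apply]
    have : ∀ (l : G) (e : inv k = inv l), l = k →
        𝒜.fstar e (f l) = 𝒜.fstar rfl (f k) := by rintro l _ rfl; rfl
    rw [this _ _ (inv_inv_eq k)]
  exact this _ _ p.2 _

theorem starMulTerm_nonneg (f : 𝒜.Cc) (x : {x : G // IsUnitArrow x})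
    (p : {p : G × G // IsProd p.1 p.2 x.1}) : 0 ≤ f.starMulTerm x p :=
  UnitFiber.nonneg_fmul_fstar_self 𝒜 p.2 _ _

theorem finite_starMulTerm (f : 𝒜.Cc) (x : {x : G // IsUnitArrow x}) :
    (Function.support (f.starMulTerm x)).Finite :=
  (finite_right f x.1).subset fun p hp h => hp (by
    show 𝒜.fmul p.2 _ (f p.1.2) = 0
    rw [h, map_zero])

theorem star_mul_self_apply_nonneg (f : 𝒜.Cc) (x : {x : G // IsUnitArrow x}) :
    0 ≤ (show 𝒜.UnitFiber x from (star f * f) x.1) := by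
  rw [star_mul_self_apply]
  exact finsum_nonneg (f.starMulTerm_nonneg x)

/-- The value of f* * f at the unit s g is a sum of positive terms. One of them is f(g)* f(g), of
norm ‖f(g)‖², and in a C*-algebra a positive summand has norm at most that of the sum. -/
theorem norm_apply_le_norm₂ (f : 𝒜.Cc) (g : G) : ‖f g‖ ≤ f.norm₂ := by
  let x : {x : G // IsUnitArrow x} := ⟨s g, isUnitArrow_s g⟩
  let p : {p : G × G // IsProd p.1 p.2 x.1} := ⟨(inv g, g), isProd_inv_left g⟩
  have h1 : f.starMulTerm x p ≤ (show 𝒜.UnitFiber x from (star f * f) x.1) := by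
    rw [star_mul_self_apply]
    exact single_le_finsum p (f.finite_starMulTerm x) (f.starMulTerm_nonneg x)
  have h2 := CStarAlgebra.norm_le_norm_of_nonneg_of_le (f.starMulTerm_nonneg x p) h1
  have h3 : ‖f.starMulTerm x p‖ = ‖f g‖ ^ 2 := 𝒜.norm_fmul_fstar_self _ _ _
  rw [h3] at h2
  have h4 : ‖f g‖ ^ 2 ≤ f.norm₂ ^ 2 := by
    rw [norm₂_sq]
    exact h2.trans ((star f * f).norm_apply_le_norm_onUnits x.2)
  exact (sq_le_sq₀ (norm_nonneg _) f.norm₂_nonneg).1 h4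

/-- A bounded family of positive elements is a positive element of the C*-algebra of bounded
families. -/
theorem _root_.lp.nonneg_of_forall_nonneg {ι : Type*} {A : ι → Type*}
    [∀ i, NonUnitalCStarAlgebra (A i)] (a : lp A ⊤) (h : ∀ i, 0 ≤ a i) : 0 ≤ a := by
  choose b hb using fun i => CStarAlgebra.nonneg_iff_eq_star_mul_self.1 (h i)
  -- The square roots chosen fibrewise satisfy ‖b i‖² = ‖a i‖, so they form a bounded family.
  have hbn : ∀ i, ‖b i‖ ≤ √‖a‖ := fun i => by
    refine Real.le_sqrt_of_sq_le ?_
    rw [sq, ← CStarRing.norm_star_mul_self, ← hb i]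
    exact lp.norm_apply_le_norm ENNReal.top_ne_zero a i
  let b' : lp A ⊤ := ⟨b, memℓp_infty ⟨√‖a‖, by rintro _ ⟨i, rfl⟩; exact hbn i⟩⟩
  have : a = star b' * b' := Subtype.ext (funext hb)
  rw [this]
  exact star_mul_self_nonneg b'

theorem onUnits_star_mul_self_nonneg (f : 𝒜.Cc) : 0 ≤ onUnits (star f * f) :=
  lp.nonneg_of_forall_nonneg _ f.star_mul_self_apply_nonneg

end order

end Cc

end FellBundle

/-! ### Cauchy–Schwarz and the left regular representation -/

namespace EtaleGroupoid

variable {G : Type u} [TopologicalSpace G] [EtaleGroupoid G]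

theorem exists_isOpen_injOn_r (g : G) : ∃ U : Set G, IsOpen U ∧ g ∈ U ∧ Set.InjOn r U :=
  ⟨_, (isLocalHomeomorph_r.localInverseAt g).open_target,
    isLocalHomeomorph_r.self_mem_localInverseAt_target,
    isLocalHomeomorph_r.injOn_localInverseAt_target⟩

theorem exists_isOpen_injOn_s (g : G) : ∃ U : Set G, IsOpen U ∧ g ∈ U ∧ Set.InjOn s U := by
  obtain ⟨U, hU, hg, hinj⟩ := exists_isOpen_injOn_r (inv g)
  refine ⟨inv ⁻¹' U, hU.preimage continuous_inv, hg, fun a ha b hb h => ?_⟩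
  rw [← r_inv, ← r_inv] at h
  rw [← inv_inv_eq a, hinj ha hb h, inv_inv_eq]

end EtaleGroupoid

namespace FellBundle

variable {G : Type u} [TopologicalSpace G] [T2Space G] [EtaleGroupoid G] {𝒜 : FellBundle G}

namespace Cc

section CauchySchwarz

attribute [local instance] CStarAlgebra.spectralOrder CStarAlgebra.spectralOrderedRing

/-- The hypothesis is ⟨tξc - η, tξc - η⟩ ≥ 0 written out with c = ⟨ξ, η⟩, X = ⟨ξ, ξ⟩ and Y = ⟨η, η⟩.
It says 2t c*c ≤ t² c*Xc + Y, and the norm is monotone on positive elements. -/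
theorem _root_.CStarAlgebra.norm_sq_le_of_nonneg {D : Type*} [NonUnitalCStarAlgebra D]
    {c X Y : D} {t : ℝ} (ht : 0 ≤ t)
    (h : 0 ≤ (t : ℂ) • ((t : ℂ) • (star c * (X * c))) - (t : ℂ) • (star c * c) -
      ((t : ℂ) • (star c * c) - Y)) :
    2 * t * ‖c‖ ^ 2 ≤ t ^ 2 * ‖c‖ ^ 2 * ‖X‖ + ‖Y‖ := by
  have e : (t : ℂ) • ((t : ℂ) • (star c * (X * c))) - (t : ℂ) • (star c * c) -
      ((t : ℂ) • (star c * c) - Y) = (t ^ 2 : ℝ) • (star c * (X * c)) + Y -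
        (2 * t : ℝ) • (star c * c) := by
    rw [Complex.coe_smul, Complex.coe_smul, Complex.coe_smul, smul_smul, two_mul, add_smul, ← sq]
    abel
  rw [e, sub_nonneg] at h
  have h0 : 0 ≤ (2 * t : ℝ) • (star c * c) :=
    smul_nonneg (by positivity) (star_mul_self_nonneg c)
  have h2 := CStarAlgebra.norm_le_norm_of_nonneg_of_le h0 h
  rw [norm_smul, CStarRing.norm_star_mul_self, Real.norm_of_nonneg (by positivity), ← sq] at h2
  refine h2.trans ((norm_add_le _ _).trans ?_)
  rw [norm_smul, Real.norm_of_nonneg (by positivity), _root_.mul_assoc (t ^ 2)]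
  gcongr
  calc ‖star c * (X * c)‖ ≤ ‖star c‖ * (‖X‖ * ‖c‖) :=
        (norm_mul_le _ _).trans (by gcongr; exact norm_mul_le _ _)
    _ = ‖c‖ ^ 2 * ‖X‖ := by rw [norm_star]; ring

/-- Cauchy–Schwarz for the inner product of L²(𝒜). Positivity of the square of tξ⟨ξ, η⟩ - η gives a
quadratic in t that is nonnegative everywhere; its discriminant is the inequality, up to a factor
‖c‖². -/
theorem norm_onUnits_star_mul_le (ξ η : 𝒜.Cc) :
    ‖onUnits (star ξ * η)‖ ≤ ξ.norm₂ * η.norm₂ := by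
  set c := onUnits (star ξ * η) with hc
  set X := onUnits (star ξ * ξ) with hX
  set Y := onUnits (star η * η) with hY
  -- A section with the values of `c` on the units, so that the product ξc is available inside
  -- `Γ_c(𝒜)`.
  let d := (star ξ * η).restrict
  have hd : d.IsDiagonal := isDiagonal_restrict _
  have hdc : onUnits d = c := onUnits_restrict _
  have hc' : onUnits (star η * ξ) = star c := by
    rw [hc, ← onUnits_star, star_mul, star_star]
  have key : ∀ t : ℝ, 0 ≤ t → 2 * t * ‖c‖ ^ 2 ≤ t ^ 2 * ‖c‖ ^ 2 * ξ.norm₂ ^ 2 + η.norm₂ ^ 2 := by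
    intro t ht
    let ζ := (t : ℂ) • (ξ * d) - η
    have e1 : star ζ * ζ = (t : ℂ) • ((t : ℂ) • (star d * (star ξ * ξ * d))) -
        (t : ℂ) • (star d * (star ξ * η)) - ((t : ℂ) • (star η * ξ * d) - star η * η) := by
      simp only [ζ, star_sub, star_smul, star_mul, sub_mul, mul_sub, smul_mul_assoc, smul_sub,
        mul_smul_comm, _root_.mul_assoc, Complex.star_def, Complex.conj_ofReal]
      abel
    have e2 : onUnits (star ζ * ζ) = (t : ℂ) • ((t : ℂ) • (star c * (X * c))) -
        (t : ℂ) • (star c * c) - ((t : ℂ) • (star c * c) - Y) := by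
      rw [e1, map_sub, map_sub, map_sub, map_smul, map_smul, map_smul, map_smul,
        onUnits_mul_of_isDiagonal_left hd.star, onUnits_mul_of_isDiagonal_right _ hd,
        onUnits_mul_of_isDiagonal_left hd.star, onUnits_mul_of_isDiagonal_right _ hd, onUnits_star,
        hdc, hc']
    have h1 : 0 ≤ onUnits (star ζ * ζ) := onUnits_star_mul_self_nonneg ζ
    rw [e2] at h1
    rw [norm₂_sq, norm₂_sq]
    exact CStarAlgebra.norm_sq_le_of_nonneg ht h1
  have hx := ξ.norm₂_nonneg
  have hy := η.norm₂_nonneg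
  have hdisc : discrim (‖c‖ ^ 2 * ξ.norm₂ ^ 2) (-2 * ‖c‖ ^ 2) (η.norm₂ ^ 2) ≤ 0 := by
    refine discrim_le_zero fun t => ?_
    -- For negative t every term of the quadratic is already nonnegative.
    rcases le_total 0 t with ht | ht
    · nlinarith [key t ht]
    · have h1 : 0 ≤ -t * ‖c‖ ^ 2 := mul_nonneg (neg_nonneg.2 ht) (sq_nonneg _)
      have h2 : 0 ≤ ‖c‖ ^ 2 * ξ.norm₂ ^ 2 * (t * t) :=
        mul_nonneg (by positivity) (mul_self_nonneg t)
      nlinarith [sq_nonneg η.norm₂]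
  rw [discrim] at hdisc
  rcases (norm_nonneg c).eq_or_lt with h0 | h0
  · rw [← h0]; positivity
  have h1 : ‖c‖ ^ 2 * ‖c‖ ^ 2 ≤ ‖c‖ ^ 2 * (ξ.norm₂ * η.norm₂) ^ 2 := by nlinarith
  exact (sq_le_sq₀ h0.le (by positivity)).1 (le_of_mul_le_mul_left h1 (by positivity))

end CauchySchwarz

theorem norm₂_add_le (ξ η : 𝒜.Cc) : (ξ + η).norm₂ ≤ ξ.norm₂ + η.norm₂ := by
  refine (sq_le_sq₀ (norm₂_nonneg _) (add_nonneg ξ.norm₂_nonneg η.norm₂_nonneg)).1 ?_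
  rw [norm₂_sq, star_add, add_mul, mul_add, mul_add, map_add, map_add, map_add]
  refine (norm_add_le _ _).trans
    ((add_le_add (norm_add_le _ _) (norm_add_le _ _)).trans ?_)
  have h1 := norm_onUnits_star_mul_le ξ η
  have h2 := norm_onUnits_star_mul_le η ξ
  have h3 := ξ.norm₂_sq
  have h4 := η.norm₂_sq
  nlinarith

theorem norm₂_smul (c : ℂ) (ξ : 𝒜.Cc) : (c • ξ).norm₂ = ‖c‖ * ξ.norm₂ := by
  refine (sq_eq_sq₀ (norm₂_nonneg _) (mul_nonneg (norm_nonneg c) ξ.norm₂_nonneg)).1 ?_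
  rw [norm₂_sq, star_smul, smul_mul_assoc, mul_smul_comm, map_smul, map_smul, norm_smul, norm_smul,
    norm_star, mul_pow, norm₂_sq]
  ring

/-! ### Boundedness of the left regular representation -/

/-- Left multiplication by a section is bounded for the supremum norm. -/
theorem exists_supNorm_mul_le (f : 𝒜.Cc) :
    ∃ L : ℝ, 0 ≤ L ∧ ∀ g : 𝒜.Cc, (f * g).supNorm ≤ L * g.supNorm := by
  classical
  obtain ⟨K, hK, hf⟩ := f.compact_support
  choose U hU hmem hinj using exists_isOpen_injOn_r (G := G)
  obtain ⟨t, -, ht⟩ := hK.elim_nhds_subcover U fun g _ => (hU g).mem_nhds (hmem g)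
  -- Each covering set contains at most one arrow with range r x, so at most `t.card` factorizations
  -- x = hk have f(h) ≠ 0.
  refine ⟨t.card * f.supNorm, mul_nonneg (Nat.cast_nonneg _) f.supNorm_nonneg, fun g => ?_⟩
  have hnn : 0 ≤ f.supNorm * g.supNorm := mul_nonneg f.supNorm_nonneg g.supNorm_nonneg
  rw [_root_.mul_assoc]
  refine supNorm_le (mul_nonneg (Nat.cast_nonneg _) hnn) fun x => ?_
  rw [mul_apply, finsum_eq_sum_of_support_subset (s := (finite_left f x).toFinset)]
  · refine (norm_sum_le_of_le _ fun p _ => (𝒜.norm_fmul_le _ _ _).trans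
      (mul_le_mul (f.norm_apply_le _) (g.norm_apply_le _) (norm_nonneg _)
        f.supNorm_nonneg)).trans ?_
    rw [Finset.sum_const, nsmul_eq_mul]
    gcongr
    have hex : ∀ p : {p : G × G // IsProd p.1 p.2 x}, ∃ c, p ∈ (finite_left f x).toFinset →
        c ∈ t ∧ p.1.1 ∈ U c := by
      intro p
      by_cases hp : p ∈ (finite_left f x).toFinset
      · have h1 : p.1.1 ∈ K := by
          by_contra h
          exact (Set.Finite.mem_toFinset _).1 hp (hf _ h)
        obtain ⟨c, hc, h⟩ : ∃ c ∈ t, p.1.1 ∈ U c := by simpa using ht h1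
        exact ⟨c, fun _ => ⟨hc, h⟩⟩
      -- The value `x` is arbitrary: `c` matters only on the support.
      · exact ⟨x, fun h => absurd h hp⟩
    choose c hc using hex
    refine Finset.card_le_card_of_injOn c (fun p hp => (hc p hp).1) ?_
    intro p hp q hq hpq
    have h1 : p.1.1 = q.1.1 :=
      hinj (c p) (hc p hp).2 (hpq ▸ (hc q hq).2) (p.2.r_eq.symm.trans q.2.r_eq)
    refine Subtype.ext (Prod.ext h1 ?_)
    have hp2 := p.2
    rw [h1] at hp2
    exact hp2.unique_right q.2
  · intro p hp
    simp only [Set.Finite.coe_toFinset, Set.mem_ofPred_eq]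
    intro h
    exact hp (by show 𝒜.fmul p.2 (f p.1.1) (g p.1.2) = 0; rw [h, map_zero, LinearMap.zero_apply])

/-- ⟨cⁿξ, η⟩ = ⟨ξ, cⁿη⟩ for selfadjoint c. The convolution algebra need not have a unit, so cⁿξ is
written as an iterate, which makes sense also at n = 0. -/
theorem star_iterate_mul (c : 𝒜.Cc) (hc : star c = c) (ξ η : 𝒜.Cc) (n : ℕ) :
    star ((c * ·)^[n] ξ) * η = star ξ * (c * ·)^[n] η := by
  induction n generalizing η with
  | zero => rfl
  | succ n ih =>
    rw [Function.iterate_succ_apply', star_mul, hc, _root_.mul_assoc, ih, ← Function.iterate_succ_apply]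

/-- The norm of multiplication by a selfadjoint section is controlled by the growth of its
powers. -/
theorem norm₂_mul_le_of_growth {c ξ : 𝒜.Cc} (hc : star c = c) {ρ C : ℝ} (hρ : 0 ≤ ρ)
    (h : ∀ n, ‖onUnits (star ξ * (c * ·)^[n] ξ)‖ ≤ C * ρ ^ n) :
    (c * ξ).norm₂ ≤ ρ * ξ.norm₂ := by
  have hC : 0 ≤ C := by simpa using (norm_nonneg _).trans (h 0)
  refine le_mul_of_sq_le_mul_of_growth (a := fun n => ((c * ·)^[n] ξ).norm₂) (C := √C)
    (fun n => norm₂_nonneg _) hρ (fun n => ?_) fun n => ?_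
  -- Log-convexity: ‖cⁿ⁺¹ξ‖₂² is the norm of ⟨cⁿξ, cⁿ⁺²ξ⟩, to which Cauchy–Schwarz applies.
  · change norm₂ ((c * ·)^[n + 1] ξ) ^ 2 ≤ norm₂ ((c * ·)^[n] ξ) * norm₂ ((c * ·)^[n + 2] ξ)
    rw [norm₂_sq, Function.iterate_succ_apply', star_mul, hc, _root_.mul_assoc,
      ← Function.iterate_succ_apply' (c * ·) n, ← Function.iterate_succ_apply' (c * ·) (n + 1)]
    exact norm_onUnits_star_mul_le _ _
  -- Growth: ‖cⁿξ‖₂² is the norm of ⟨ξ, c²ⁿξ⟩, at most C ρ²ⁿ, hence the constant √C.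
  · refine (sq_le_sq₀ (norm₂_nonneg _) (by positivity)).1 ?_
    rw [norm₂_sq, star_iterate_mul c hc, ← Function.iterate_add_apply, mul_pow, Real.sq_sqrt hC,
      ← pow_mul, mul_two]
    exact h _

/-- Cauchy–Schwarz for ⟨fξ, fξ⟩ = ⟨ξ, f* f ξ⟩. It reduces bounds for f to bounds for the selfadjoint
f* f, and later gives the C*-inequality of the reduced norm. -/
theorem norm₂_mul_sq_le (f ξ : 𝒜.Cc) :
    (f * ξ).norm₂ ^ 2 ≤ ξ.norm₂ * (star f * f * ξ).norm₂ := by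
  rw [norm₂_sq, star_mul, _root_.mul_assoc, ← _root_.mul_assoc (star f)]
  exact norm_onUnits_star_mul_le _ _

theorem star_star_mul_self (f : 𝒜.Cc) : star (star f * f) = star f * f := by
  rw [star_mul, star_star]

theorem supNorm_iterate_le {c : 𝒜.Cc} {L : ℝ} (hL : 0 ≤ L)
    (h : ∀ g : 𝒜.Cc, (c * g).supNorm ≤ L * g.supNorm) (n : ℕ) (ξ : 𝒜.Cc) :
    ((c * ·)^[n] ξ).supNorm ≤ L ^ n * ξ.supNorm := by
  induction n with
  | zero => simp
  | succ n ih =>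
    rw [Function.iterate_succ_apply', pow_succ', _root_.mul_assoc]
    exact (h _).trans (by gcongr)

/-- Left multiplication by f* f is bounded by some L in the supremum norm, so the iterates on ξ grow
at most like Lⁿ there; pairing with ξ costs a constant only. The growth principle turns this into
the bound L in the norm of L²(𝒜), for a constant independent of ξ. -/
theorem exists_norm₂_mul_le (f : 𝒜.Cc) :
    ∃ C : ℝ, 0 ≤ C ∧ ∀ ξ : 𝒜.Cc, (f * ξ).norm₂ ≤ C * ξ.norm₂ := by
  obtain ⟨L, hL, hfL⟩ := exists_supNorm_mul_le (star f * f)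
  refine ⟨√L, by positivity, fun ξ => ?_⟩
  obtain ⟨L', hL', hξ⟩ := exists_supNorm_mul_le (star ξ)
  have h1 : (star f * f * ξ).norm₂ ≤ L * ξ.norm₂ := by
    refine norm₂_mul_le_of_growth (star_star_mul_self f) hL (C := L' * ξ.supNorm) fun n => ?_
    calc _ ≤ _ := norm_onUnits_le _
      _ ≤ L' * (L ^ n * ξ.supNorm) := (hξ _).trans (by gcongr; exact supNorm_iterate_le hL hfL n ξ)
      _ = _ := by ring
  refine (sq_le_sq₀ (norm₂_nonneg _) (mul_nonneg (Real.sqrt_nonneg _) ξ.norm₂_nonneg)).1 ?_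
  rw [mul_pow, Real.sq_sqrt hL]
  refine (norm₂_mul_sq_le f ξ).trans ?_
  nlinarith [ξ.norm₂_nonneg]

/-- The norm of the left regular representation. -/
noncomputable def redNorm (f : 𝒜.Cc) : ℝ :=
  sSup {t : ℝ | ∃ ξ : 𝒜.Cc, ξ.norm₂ ≤ 1 ∧ t = (f * ξ).norm₂}

theorem norm₂_zero : (0 : 𝒜.Cc).norm₂ = 0 := by
  simpa using norm₂_smul (0 : ℂ) (0 : 𝒜.Cc)

theorem isLUB_redNorm (f : 𝒜.Cc) :
    IsLUB {t : ℝ | ∃ ξ : 𝒜.Cc, ξ.norm₂ ≤ 1 ∧ t = (f * ξ).norm₂} f.redNorm := by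
  obtain ⟨C, hC, h⟩ := exists_norm₂_mul_le f
  refine isLUB_csSup ⟨_, 0, by rw [norm₂_zero]; exact zero_le_one, rfl⟩ ⟨C, ?_⟩
  rintro _ ⟨ξ, hξ, rfl⟩
  exact (h ξ).trans (mul_le_of_le_one_right hC hξ)

theorem norm₂_mul_le (f ξ : 𝒜.Cc) : (f * ξ).norm₂ ≤ f.redNorm * ξ.norm₂ := by
  obtain ⟨C, hC, h⟩ := exists_norm₂_mul_le f
  rcases ξ.norm₂_nonneg.eq_or_lt with h0 | h0
  · have := h ξ
    rwa [← h0, mul_zero] at this ⊢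
  · have h1 : ((((ξ.norm₂)⁻¹ : ℝ) : ℂ) • ξ).norm₂ = 1 := by
      rw [norm₂_smul, Complex.norm_real, Real.norm_of_nonneg (by positivity), inv_mul_cancel₀ h0.ne']
    have h2 := (isLUB_redNorm f).1 ⟨_, h1.le, rfl⟩
    rw [mul_smul_comm, norm₂_smul, Complex.norm_real, Real.norm_of_nonneg (by positivity)] at h2
    rwa [inv_mul_le_iff₀ h0, mul_comm] at h2

theorem redNorm_le {f : 𝒜.Cc} {C : ℝ} (hC : 0 ≤ C)
    (h : ∀ ξ : 𝒜.Cc, (f * ξ).norm₂ ≤ C * ξ.norm₂) : f.redNorm ≤ C := by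
  refine (isLUB_redNorm f).2 ?_
  rintro _ ⟨ξ, hξ, rfl⟩
  exact (h ξ).trans (mul_le_of_le_one_right hC hξ)

theorem redNorm_nonneg (f : 𝒜.Cc) : 0 ≤ f.redNorm :=
  (norm₂_nonneg _).trans ((isLUB_redNorm f).1 ⟨0, by rw [norm₂_zero]; exact zero_le_one, rfl⟩)

theorem redNorm_sq_le (f : 𝒜.Cc) : f.redNorm ^ 2 ≤ (star f * f).redNorm := by
  have h0 := (star f * f).redNorm_nonneg
  refine (Real.le_sqrt f.redNorm_nonneg h0).1 (redNorm_le (Real.sqrt_nonneg _) fun ξ => ?_)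
  refine (sq_le_sq₀ (norm₂_nonneg _) (mul_nonneg (Real.sqrt_nonneg _) ξ.norm₂_nonneg)).1 ?_
  rw [mul_pow, Real.sq_sqrt h0]
  refine (norm₂_mul_sq_le f ξ).trans ?_
  have := norm₂_mul_le (star f * f) ξ
  nlinarith [ξ.norm₂_nonneg]

theorem redNorm_mul_le (f g : 𝒜.Cc) : (f * g).redNorm ≤ f.redNorm * g.redNorm :=
  redNorm_le (mul_nonneg f.redNorm_nonneg g.redNorm_nonneg) fun ξ => by
    rw [_root_.mul_assoc, _root_.mul_assoc]
    exact (norm₂_mul_le f _).trans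
      (mul_le_mul_of_nonneg_left (norm₂_mul_le g ξ) f.redNorm_nonneg)

theorem redNorm_smul_le (c : ℂ) (f : 𝒜.Cc) : (c • f).redNorm ≤ ‖c‖ * f.redNorm :=
  redNorm_le (mul_nonneg (norm_nonneg c) f.redNorm_nonneg) fun ξ => by
    rw [smul_mul_assoc, norm₂_smul, _root_.mul_assoc]
    exact mul_le_mul_of_nonneg_left (norm₂_mul_le f ξ) (norm_nonneg c)

/-- The reduced norm, as a C*-seminorm. -/
noncomputable def redSeminorm (𝒜 : FellBundle G) : CStarSeminorm 𝒜.Cc where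
  toFun := redNorm
  add_le' f g := redNorm_le (add_nonneg f.redNorm_nonneg g.redNorm_nonneg) fun ξ => by
    rw [add_mul, add_mul]
    exact (norm₂_add_le _ _).trans (add_le_add (norm₂_mul_le f ξ) (norm₂_mul_le g ξ))
  smul' c f := by
    refine le_antisymm (redNorm_smul_le c f) ?_
    by_cases hc : c = 0
    · rw [hc, norm_zero, zero_mul]; exact redNorm_nonneg _
    · have := redNorm_smul_le c⁻¹ (c • f)
      rwa [smul_smul, inv_mul_cancel₀ hc, one_smul, norm_inv,
        le_inv_mul_iff₀ (norm_pos_iff.2 hc)] at this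
  mul_le' := redNorm_mul_le
  sq_le' := redNorm_sq_le

/-! ### Cutting sections down, and the supremum norm below the reduced norm -/

/-- The product of a section with a continuous scalar function. -/
noncomputable def scale (χ : C(G, ℂ)) (f : 𝒜.Cc) : 𝒜.Cc where
  toFun g := χ g • f g
  continuous_toFun := by
    rw [continuous_iff_continuousAt]
    intro x
    -- Scalar multiplication is assumed continuous for a fixed scalar only. So χ(g)f(g) is split as
    -- χ(x)f(g) plus (χ(g) - χ(x))f(g), and the norm of the latter tends to zero.
    have h1 : ContinuousAt (fun g => (⟨g, χ x • f g⟩ : 𝒜.Total)) x :=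
      ((𝒜.continuous_smul (χ x)).comp f.continuous_toFun).continuousAt
    have h2 : ContinuousAt (fun g => (⟨g, (χ g - χ x) • f g⟩ : 𝒜.Total)) x := by
      have e : (⟨x, (χ x - χ x) • f x⟩ : 𝒜.Total) = ⟨x, 0⟩ := by rw [sub_self, zero_smul]
      rw [ContinuousAt, e]
      refine Filter.Tendsto.mono_right ?_ (𝒜.tendsto_zero x)
      refine Filter.tendsto_inf.2 ⟨Filter.tendsto_comap_iff.2 Filter.tendsto_id,
        Filter.tendsto_comap_iff.2 ?_⟩
      refine squeeze_zero (fun g => norm_nonneg _)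
        (g := fun g => ‖χ g - χ x‖ * f.supNorm) (fun g => ?_) ?_
      · simp only [Function.comp]
        rw [norm_smul]
        gcongr
        exact f.norm_apply_le g
      · have : Continuous fun g => ‖χ g - χ x‖ * f.supNorm := by fun_prop
        simpa using this.tendsto x
    refine (𝒜.continuousAt_add h1 h2).congr (Filter.Eventually.of_forall fun g => ?_)
    simp only
    rw [← add_smul, add_sub_cancel]
  compact_support := by
    obtain ⟨K, hK, h⟩ := f.compact_support
    exact ⟨K, hK, fun g hg => by rw [show f g = 0 from h g hg, smul_zero]⟩

theorem scale_apply (χ : C(G, ℂ)) (f : 𝒜.Cc) (g : G) : scale χ f g = χ g • f g := rfl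

/-- Where s is injective, the support of `k` has only one arrow with source s g, so the convolution
sum reduces to the term f(g)* k(g). -/
theorem star_mul_apply_of_injOn (f : 𝒜.Cc) {k : 𝒜.Cc} {U : Set G} (hU : Set.InjOn s U)
    (hk : ∀ h, h ∉ U → k h = 0) {g : G} (hg : g ∈ U) :
    (star f * k) (s g) = 𝒜.fmul (isProd_inv_left g) (𝒜.fstar rfl (f g)) (k g) := by
  rw [mul_apply, finsum_eq_single _ ⟨(inv g, g), isProd_inv_left g⟩]
  · congr 1
    rw [star_apply]
    have : ∀ (l : G) (e : inv g = inv l), l = g →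
        𝒜.fstar e (f l) = 𝒜.fstar rfl (f g) := by rintro l _ rfl; rfl
    rw [this _ _ (inv_inv_eq g)]
  · rintro ⟨⟨a, b⟩, p⟩ hne
    by_cases hb : b ∈ U
    · refine absurd ?_ hne
      have h1 : b = g := hU hb hg (by rw [← p.s_eq, s_s])
      subst h1
      have h2 : a = inv b := p.unique_left (isProd_inv_left b)
      subst h2
      rfl
    · show 𝒜.fmul p ((star f) a) (k b) = 0
      rw [hk b hb, map_zero]

theorem star_mul_apply_eq_zero (f : 𝒜.Cc) {k : 𝒜.Cc} {U : Set G} (hk : ∀ h, h ∉ U → k h = 0)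
    {x : G} (hx : ∀ g ∈ U, s g ≠ s x) : (star f * k) x = 0 := by
  rw [mul_apply]
  refine (finsum_congr fun p => ?_).trans finsum_zero
  rw [hk p.1.2 fun h => hx _ h p.2.s_eq.symm, map_zero]

theorem norm₂_le_supNorm_of_injOn {k : 𝒜.Cc} {U : Set G} (hU : Set.InjOn s U)
    (hk : ∀ h, h ∉ U → k h = 0) : k.norm₂ ≤ k.supNorm := by
  refine (sq_le_sq₀ k.norm₂_nonneg k.supNorm_nonneg).1 ?_
  rw [norm₂_sq]
  refine lp.norm_le_of_forall_le (sq_nonneg _) fun x => ?_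
  change ‖(star k * k) x.1‖ ≤ _
  by_cases hx : ∃ g ∈ U, s g = x.1
  · obtain ⟨g, hg, hgx⟩ := hx
    rw [← hgx, star_mul_apply_of_injOn k hU hk hg, 𝒜.norm_fstar_fmul_self]
    exact pow_le_pow_left₀ (norm_nonneg _) (k.norm_apply_le g) 2
  · rw [star_mul_apply_eq_zero k hk fun g hg h => hx ⟨g, hg, h.trans x.2.s_eq⟩, norm_zero]
    positivity

variable [LocallyCompactSpace G]

/-- Cutting f down near g to a section k supported where s is injective gives f(g)* f(g) = (f* *
k)(s g). Hence ‖f(g)‖² ≤ ‖f* * k‖₂ ≤ ‖f‖_r ‖k‖₂ ≤ ‖f‖_r ‖f‖_∞, and it remains to take the supremum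
over g and cancel ‖f‖_∞. -/
theorem supNorm_le_redNorm (f : 𝒜.Cc) : f.supNorm ≤ f.redNorm := by
  have hstar : (star f).redNorm = f.redNorm := (redSeminorm 𝒜).star_eq f
  have key : ∀ g, ‖f g‖ ^ 2 ≤ f.redNorm * f.supNorm := by
    intro g
    obtain ⟨U, hUo, hg, hU⟩ := exists_isOpen_injOn_s g
    obtain ⟨χ, hχg, hχU, hχ⟩ := exists_continuous_zero_one_of_isCompact
      (isCompact_singleton (x := g)) hUo.isClosed_compl (by simpa using hg)
    replace hχg : χ g = 0 := hχg rfl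
    -- Urysohn's function is 0 at `g` and 1 outside `U`; the cut-off is its complement.
    let χ' : C(G, ℂ) := ⟨fun h => ((1 - χ h : ℝ) : ℂ), by fun_prop⟩
    have hχ1 : ∀ h, ‖χ' h‖ ≤ 1 := fun h => by
      simp only [χ', ContinuousMap.coe_mk, Complex.norm_real]
      rw [Real.norm_of_nonneg (by linarith [(hχ h).2])]
      linarith [(hχ h).1]
    let k := scale χ' f
    have hk : ∀ h, h ∉ U → k h = 0 := fun h hh => by
      have : χ h = 1 := hχU hh
      simp [k, scale_apply, χ', this]
    have hkg : k g = f g := by simp [k, scale_apply, χ', hχg]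
    have hkn : k.supNorm ≤ f.supNorm := supNorm_le f.supNorm_nonneg fun h => by
      rw [scale_apply, norm_smul]
      exact (mul_le_of_le_one_left (norm_nonneg _) (hχ1 h)).trans (f.norm_apply_le h)
    have h1 : ‖f g‖ ^ 2 = ‖(star f * k) (s g)‖ := by
      rw [star_mul_apply_of_injOn f hU hk hg, hkg, 𝒜.norm_fstar_fmul_self]
    rw [h1]
    calc _ ≤ (star f * k).norm₂ := norm_apply_le_norm₂ _ _
      _ ≤ f.redNorm * k.norm₂ := hstar ▸ norm₂_mul_le (star f) k
      _ ≤ f.redNorm * f.supNorm := by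
        gcongr
        · exact f.redNorm_nonneg
        · exact (norm₂_le_supNorm_of_injOn hU hk).trans hkn
  have h2 : f.supNorm ≤ √(f.redNorm * f.supNorm) :=
    supNorm_le (Real.sqrt_nonneg _) fun g => Real.le_sqrt_of_sq_le (key g)
  have h3 := (Real.le_sqrt f.supNorm_nonneg
    (mul_nonneg f.redNorm_nonneg f.supNorm_nonneg)).1 h2
  rcases f.supNorm_nonneg.eq_or_lt with h0 | h0
  · rw [← h0]; exact f.redNorm_nonneg
  · rw [sq] at h3
    exact le_of_mul_le_mul_right h3 h0

end Cc

end FellBundle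

/-! ### Square roots in subalgebras, and sections over the unit space as C*-algebras -/

namespace CStarAlgebra

attribute [local instance] CStarAlgebra.spectralOrder CStarAlgebra.spectralOrderedRing

/-- A positive element of a C*-subalgebra has a square root in the subalgebra. -/
theorem exists_mem_eq_star_mul_self {A S : Type*} [NonUnitalCStarAlgebra A] [SetLike S A]
    [NonUnitalSubringClass S A] [SMulMemClass S ℂ A] [StarMemClass S A] (s : S)
    (hs : IsClosed (s : Set A)) {a : A} (ha : 0 ≤ a) (has : a ∈ s) :
    ∃ b ∈ s, a = star b * b := by
  refine ⟨CFC.sqrt a, ?_, ?_⟩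
  · have : IsClosed (s : Set A) := hs
    have h : cfcₙ Real.sqrt a ∈ s := cfcₙ_mem (𝕜' := ℂ) Real.sqrt has
    rwa [← CFC.sqrt_eq_real_sqrt a ha] at h
  · rw [(CFC.sqrt_nonneg a).isSelfAdjoint.star_eq, CFC.sqrt_mul_sqrt_self a ha]

end CStarAlgebra

namespace FellBundle

variable {G : Type u} [TopologicalSpace G] [EtaleGroupoid G] {𝒜 : FellBundle G}

/-- Continuity of addition at the pair (a, 0), combined with the axiom `tendsto_zero`, by which
tubes of small norm over a neighbourhood of x lie in any given neighbourhood of the zero of the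
fibre. -/
theorem exists_forall_add_mem {x : G} {a : 𝒜.fiber x} {V : Set 𝒜.Total}
    (hV : V ∈ 𝓝 (⟨x, a⟩ : 𝒜.Total)) :
    ∃ W : Set 𝒜.Total, IsOpen W ∧ ⟨x, a⟩ ∈ W ∧ ∃ U ∈ 𝓝 x, ∃ δ > 0, ∀ (g : G) (u v : 𝒜.fiber g),
      (⟨g, u⟩ : 𝒜.Total) ∈ W → g ∈ U → ‖v‖ < δ → (⟨g, u + v⟩ : 𝒜.Total) ∈ V := by
  let _ : TopologicalSpace (Σ g, 𝒜.fiber g × 𝒜.fiber g) := TopologicalSpace.induced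
      (fun t : Σ g, 𝒜.fiber g × 𝒜.fiber g =>
        ((⟨t.1, t.2.1⟩, ⟨t.1, t.2.2⟩) : 𝒜.Total × 𝒜.Total)) inferInstance
  have h : (fun t : Σ g, 𝒜.fiber g × 𝒜.fiber g => (⟨t.1, t.2.1 + t.2.2⟩ : 𝒜.Total)) ⁻¹' V ∈
      𝓝 (⟨x, a, 0⟩ : Σ g, 𝒜.fiber g × 𝒜.fiber g) := by
    refine 𝒜.continuous_add.continuousAt ?_
    simpa using hV
  rw [nhds_induced, Filter.mem_comap] at h
  obtain ⟨S, hS, hSV⟩ := h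
  rw [nhds_prod_eq, Filter.mem_prod_iff] at hS
  obtain ⟨W, hW, W', hW', hWS⟩ := hS
  obtain ⟨W₀, hW₀, hW₀o, hmem⟩ := mem_nhds_iff.1 hW
  have h0 := 𝒜.tendsto_zero x hW'
  rw [Filter.mem_inf_iff] at h0
  obtain ⟨t₁, ⟨U, hU, hUt⟩, t₂, ⟨D, hD, hDt⟩, rfl⟩ := h0
  obtain ⟨δ, hδ, hδD⟩ := Metric.mem_nhds_iff.1 hD
  refine ⟨W₀, hW₀o, hmem, U, hU, δ, hδ, fun g u v hu hg hv => ?_⟩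
  refine @hSV ⟨g, u, v⟩ (hWS ⟨hW₀ hu, hUt hg, hDt (hδD ?_)⟩)
  simpa using hv

/-- A uniform limit of continuous sections is continuous. -/
theorem continuous_of_uniform_approx (f : ∀ g, 𝒜.fiber g)
    (h : ∀ ε > 0, ∃ f' : ∀ g, 𝒜.fiber g, Continuous (fun g => (⟨g, f' g⟩ : 𝒜.Total)) ∧
      ∀ g, ‖f g - f' g‖ < ε) : Continuous fun g => (⟨g, f g⟩ : 𝒜.Total) := by
  rw [continuous_iff_continuousAt]
  intro x
  refine fun V hV => Filter.mem_map.2 ?_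
  obtain ⟨W, hWo, hW, U, hU, δ, hδ, hadd⟩ := exists_forall_add_mem hV
  -- Two perturbations are needed: from f(x) to f'(x), to land in `W`, and, at nearby g, from f'(g)
  -- in `W` back to f(g) in `V`.
  obtain ⟨W', -, hW', U', hU', δ', hδ', hadd'⟩ := exists_forall_add_mem (hWo.mem_nhds hW)
  obtain ⟨f', hf', hff'⟩ := h (min δ δ') (lt_min hδ hδ')
  have h1 : (⟨x, f' x⟩ : 𝒜.Total) ∈ W := by
    have := hadd' x (f x) (f' x - f x) hW' (mem_of_mem_nhds hU')
      (by rw [norm_sub_rev]; exact (hff' x).trans_le (min_le_right _ _))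
    rwa [add_sub_cancel] at this
  filter_upwards [hf'.continuousAt.eventually (hWo.mem_nhds h1), hU] with g hg hgU
  have := hadd g (f' g) (f g - f' g) hg hgU ((hff' g).trans_le (min_le_left _ _))
  rwa [add_sub_cancel] at this

variable [T2Space G]

namespace Cc

/-- The sections in `Γ_c(𝒜⁰)` vanishing outside a set `K`, as families of elements of the fibres
over the units. -/
def diagonalSubalgebra (𝒜 : FellBundle G) (K : Set G) : NonUnitalStarSubalgebra ℂ 𝒜.UnitAlg where
  carrier := {u | ∃ f : 𝒜.Cc, f.IsDiagonal ∧ (∀ g, g ∉ K → f g = 0) ∧ onUnits f = u}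
  add_mem' := by
    rintro _ _ ⟨f, hf, hfK, rfl⟩ ⟨f', hf', hfK', rfl⟩
    refine ⟨f + f', fun g hg => ?_, fun g hg => ?_, map_add _ _ _⟩
    · rw [add_apply, hf g hg, hf' g hg, add_zero]
    · rw [add_apply, hfK g hg, hfK' g hg, add_zero]
  zero_mem' := ⟨0, fun _ _ => rfl, fun _ _ => rfl, map_zero _⟩
  mul_mem' := by
    rintro _ _ ⟨f, hf, hfK, rfl⟩ ⟨f', hf', hfK', rfl⟩
    refine ⟨f * f', hf.mul hf', fun g hg => ?_, onUnits_mul_of_isDiagonal_left hf f'⟩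
    rw [mul_apply_of_isDiagonal_left hf, hfK' g hg, map_zero]
  smul_mem' := by
    rintro c _ ⟨f, hf, hfK, rfl⟩
    refine ⟨c • f, fun g hg => ?_, fun g hg => ?_, map_smul _ _ _⟩
    · rw [smul_apply, hf g hg, smul_zero]
    · rw [smul_apply, hfK g hg, smul_zero]
  star_mem' := by
    rintro _ ⟨f, hf, hfK, rfl⟩
    refine ⟨star f, hf.star, fun g hg => ?_, onUnits_star f⟩
    by_cases hu : IsUnitArrow g
    · have h1 : f (inv g) = 0 := hfK _ (hu.inv_eq ▸ hg)
      rw [star_apply, h1, map_zero]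
    · exact hf.star g hu

/-- A uniform limit of continuous sections is continuous and still vanishes off `K`. Fixing `K` is
essential: without it the limit need not have compact support. -/
theorem isClosed_diagonalSubalgebra {K : Set G} (hK : IsCompact K) :
    IsClosed (diagonalSubalgebra 𝒜 K : Set 𝒜.UnitAlg) := by
  classical
  refine isClosed_of_closure_subset fun u hu => ?_
  let f : ∀ g, 𝒜.fiber g := fun g => if h : IsUnitArrow g then u ⟨g, h⟩ else 0
  have hfu : ∀ g (h : IsUnitArrow g), f g = u ⟨g, h⟩ := fun g h => dif_pos h
  have hf0 : ∀ g, ¬ IsUnitArrow g → f g = 0 := fun g h => dif_neg h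
  have happrox : ∀ ε > 0, ∃ f' : 𝒜.Cc, f'.IsDiagonal ∧ (∀ g, g ∉ K → f' g = 0) ∧
      ∀ g, ‖f g - f' g‖ < ε := by
    intro ε hε
    obtain ⟨_, ⟨f', hd, hfK, rfl⟩, hdist⟩ := Metric.mem_closure_iff.1 hu ε hε
    refine ⟨f', hd, hfK, fun g => ?_⟩
    by_cases hg : IsUnitArrow g
    · rw [hfu g hg]
      refine lt_of_le_of_lt ?_ hdist
      rw [dist_eq_norm]
      exact lp.norm_apply_le_norm ENNReal.top_ne_zero (u - onUnits f') ⟨g, hg⟩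
    · rw [hf0 g hg, hd g hg, sub_zero, norm_zero]
      exact hε
  have hfK : ∀ g, g ∉ K → f g = 0 := by
    intro g hg
    by_contra hne
    obtain ⟨f', -, hfK, hf'⟩ := happrox ‖f g‖ (norm_pos_iff.2 hne)
    have := hf' g
    rw [hfK g hg, sub_zero] at this
    exact lt_irrefl _ this
  let F : 𝒜.Cc := ⟨f, continuous_of_uniform_approx f fun ε hε => by
    obtain ⟨f', -, -, hf'⟩ := happrox ε hε
    exact ⟨f', f'.continuous_toFun, hf'⟩, K, hK, hfK⟩
  exact ⟨F, fun g hg => dif_neg hg, hfK, Subtype.ext (funext fun x => dif_pos x.2)⟩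

/-- Extension by zero, from families of elements of the fibres over the units to sections. -/
noncomputable def extend (𝒜 : FellBundle G) (K : Set G) :
    diagonalSubalgebra 𝒜 K →⋆ₙₐ[ℂ] 𝒜.Cc :=
  -- A section in Γ_c(𝒜⁰) is determined by its values on the units, so the chosen extensions respect
  -- all operations.
  have h (u : diagonalSubalgebra 𝒜 K) := u.2.choose_spec
  { toFun := fun u => u.2.choose
    map_smul' := fun c u => (h (c • u)).1.ext
      (fun g hg => by rw [smul_apply, (h u).1 g hg, smul_zero])
      (by rw [map_smul, (h _).2.2, (h _).2.2]; rfl)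
    map_zero' := (h 0).1.ext (fun _ _ => rfl) (by rw [(h _).2.2, map_zero]; rfl)
    map_add' := fun u v => (h (u + v)).1.ext
      (fun g hg => by rw [add_apply, (h u).1 g hg, (h v).1 g hg, add_zero])
      (by rw [map_add, (h _).2.2, (h _).2.2, (h _).2.2]; rfl)
    map_mul' := fun u v => (h (u * v)).1.ext ((h u).1.mul (h v).1)
      (by rw [onUnits_mul_of_isDiagonal_left (h u).1, (h _).2.2, (h _).2.2, (h _).2.2]; rfl)
    map_star' := fun u => (h (star u)).1.ext (h u).1.star
      (by rw [onUnits_star, (h _).2.2, (h _).2.2]; rfl) }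

theorem onUnits_extend {K : Set G} (u : diagonalSubalgebra 𝒜 K) : onUnits (extend 𝒜 K u) = u :=
  u.2.choose_spec.2.2

theorem isDiagonal_extend {K : Set G} (u : diagonalSubalgebra 𝒜 K) :
    (extend 𝒜 K u).IsDiagonal := u.2.choose_spec.1

theorem IsDiagonal.exists_extend_eq {d : 𝒜.Cc} (hd : d.IsDiagonal) :
    ∃ K, IsCompact K ∧ ∃ u : diagonalSubalgebra 𝒜 K, extend 𝒜 K u = d := by
  obtain ⟨K, hK, hdK⟩ := d.compact_support
  let u : diagonalSubalgebra 𝒜 K := ⟨onUnits d, d, hd, hdK, rfl⟩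
  exact ⟨K, hK, u, (isDiagonal_extend u).ext hd (onUnits_extend u)⟩

theorem norm_extend {K : Set G} (u : diagonalSubalgebra 𝒜 K) :
    (extend 𝒜 K u).supNorm = ‖u‖ := by
  rw [(isDiagonal_extend u).supNorm_eq, onUnits_extend]; rfl

/-- The section lies in the C*-algebra of diagonal sections supported in some compact `K`, and
*-homomorphisms of C*-algebras are contractive. -/
theorem IsDiagonal.norm_map_le {d : 𝒜.Cc} (hd : d.IsDiagonal) {A : Type*}
    [NonUnitalCStarAlgebra A] (j : 𝒜.Cc →⋆ₙₐ[ℂ] A) : ‖j d‖ ≤ d.supNorm := by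
  obtain ⟨K, hK, u, rfl⟩ := hd.exists_extend_eq
  have := isClosed_diagonalSubalgebra (𝒜 := 𝒜) hK
  rw [norm_extend]
  exact NonUnitalStarAlgHom.norm_apply_le (j.comp (extend 𝒜 K)) u

/-- An injective *-homomorphism of C*-algebras is isometric. All gradings therefore induce the same
norm on Γ_c(𝒜⁰), which is why the closure of its image is a copy of Γ_0(𝒜⁰). -/
theorem IsDiagonal.norm_map_eq {d : 𝒜.Cc} (hd : d.IsDiagonal) {A : Type*}
    [NonUnitalCStarAlgebra A] (j : 𝒜.Cc →⋆ₙₐ[ℂ] A) (hj : Function.Injective j) :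
    ‖j d‖ = d.supNorm := by
  obtain ⟨K, hK, u, rfl⟩ := hd.exists_extend_eq
  have := isClosed_diagonalSubalgebra (𝒜 := 𝒜) hK
  rw [norm_extend]
  refine NonUnitalStarAlgHom.norm_map (j.comp (extend 𝒜 K)) (hj.comp fun u v h => ?_) u
  exact Subtype.ext ((onUnits_extend u).symm.trans
    ((congrArg onUnits h).trans (onUnits_extend v)))

section order

attribute [local instance] CStarAlgebra.spectralOrder CStarAlgebra.spectralOrderedRing

theorem IsDiagonal.exists_eq_star_mul_self {d : 𝒜.Cc} (hd : d.IsDiagonal) (h : 0 ≤ onUnits d) :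
    ∃ b : 𝒜.Cc, b.IsDiagonal ∧ d = Star.star b * b := by
  obtain ⟨K, hK, hdK⟩ := d.compact_support
  obtain ⟨u, hu, hdu⟩ := CStarAlgebra.exists_mem_eq_star_mul_self (diagonalSubalgebra 𝒜 K)
    (isClosed_diagonalSubalgebra hK) h ⟨d, hd, hdK, rfl⟩
  obtain ⟨b, hb, -, rfl⟩ := hu
  refine ⟨b, hb, hd.ext (hb.star.mul hb) ?_⟩
  rw [hdu, onUnits_mul_of_isDiagonal_left hb.star, onUnits_star]

/-- The restriction is fibrewise positive, and its square root stays in the closed subalgebra over a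
compact set, so it is again a continuous section. This yields the positivity of the conditional
expectation. -/
theorem exists_restrict_star_mul_self_eq (f : 𝒜.Cc) :
    ∃ b : 𝒜.Cc, b.IsDiagonal ∧ (star f * f).restrict = star b * b :=
  (isDiagonal_restrict _).exists_eq_star_mul_self
    (by rw [onUnits_restrict]; exact f.onUnits_star_mul_self_nonneg)

end order

/-- A product of an arrow of U with the inverse of an arrow of U is defined only if their sources
agree, hence only if they are the same arrow, and then it is a unit. -/
theorem isDiagonal_mul_star_of_injOn {k : 𝒜.Cc} {U : Set G} (hU : Set.InjOn s U)
    (hk : ∀ h, h ∉ U → k h = 0) : (k * star k).IsDiagonal := by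
  intro g hg
  rw [mul_apply]
  refine (finsum_congr fun p => ?_).trans finsum_zero
  by_cases ha : p.1.1 ∈ U
  · by_cases hb : inv p.1.2 ∈ U
    · refine absurd ?_ hg
      have h1 : p.1.1 = inv p.1.2 := hU ha hb (by rw [s_inv]; exact p.2.1)
      have h2 := p.2
      rw [h1] at h2
      rw [h2.unique (isProd_inv_left _)]
      exact isUnitArrow_s _
    · rw [star_apply, hk _ hb, map_zero, map_zero]
  · rw [hk _ ha, map_zero, LinearMap.zero_apply]

theorem sum_apply {ι : Type*} (S : Finset ι) (f : ι → 𝒜.Cc) (g : G) :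
    (∑ i ∈ S, f i) g = ∑ i ∈ S, f i g := by
  classical
  induction S using Finset.induction_on with
  | empty => rfl
  | insert i S hi ih => rw [Finset.sum_insert hi, Finset.sum_insert hi, add_apply, ih]

variable [LocallyCompactSpace G]

/-- Every compactly supported section is a sum of sections supported in bisections. -/
theorem exists_sum_injOn (f : 𝒜.Cc) : ∃ (n : ℕ) (k : Fin n → 𝒜.Cc), f = ∑ i, k i ∧
    ∀ i, ∃ U : Set G, Set.InjOn s U ∧ ∀ h, h ∉ U → k i h = 0 := by
  obtain ⟨K, hK, hf⟩ := f.compact_support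
  choose U hU hmem hinj using exists_isOpen_injOn_s (G := G)
  obtain ⟨t, -, ht⟩ := hK.elim_nhds_subcover U fun g _ => (hU g).mem_nhds (hmem g)
  let c : Fin t.card → G := fun i => (t.equivFin.symm i : G)
  have hcov : K ⊆ ⋃ i, U (c i) := by
    refine ht.trans fun x hx => ?_
    obtain ⟨g, hg, hxg⟩ := Set.mem_iUnion₂.1 hx
    refine Set.mem_iUnion.2 ⟨t.equivFin ⟨g, hg⟩, ?_⟩
    simpa [c] using hxg
  obtain ⟨χ, hχU, hχ1, -, -⟩ :=
    exists_continuous_sum_one_of_isOpen_isCompact (fun i => hU (c i)) hK hcov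
  let χ' : Fin t.card → C(G, ℂ) := fun i => ⟨fun g => (χ i g : ℂ), by fun_prop⟩
  refine ⟨t.card, fun i => scale (χ' i) f, ?_, fun i => ⟨U (c i), hinj (c i), fun h hh => ?_⟩⟩
  · refine Cc.ext fun g => ?_
    rw [sum_apply]
    simp only [scale_apply]
    rw [← Finset.sum_smul]
    by_cases hg : g ∈ K
    · have h1 : ∑ i, χ' i g = 1 := by
        have h2 := hχ1 hg
        simp only [Finset.sum_apply, Pi.one_apply] at h2
        have h3 : ((∑ i, χ i g : ℝ) : ℂ) = 1 := by rw [h2]; simp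
        rw [← h3]
        push_cast
        rfl
      rw [h1, one_smul]
    · rw [show f g = 0 from hf g hg, smul_zero]
  · have h1 : χ i h = 0 := by
      by_contra hne
      exact hh (hχU i (subset_tsupport _ hne))
    simp [scale_apply, χ', h1]

/-- The norm of a section in representations is bounded. -/
theorem exists_norm_map_le (f : 𝒜.Cc) : ∃ C : ℝ, ∀ (A : Type u) [NonUnitalCStarAlgebra A]
    (π : 𝒜.Cc →⋆ₙₐ[ℂ] A), ‖π f‖ ≤ C := by
  obtain ⟨n, k, rfl, hk⟩ := exists_sum_injOn f
  -- The C*-identity gives ‖π(k)‖² = ‖π(k k*)‖, and k k* is diagonal, where every homomorphism is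
  -- contractive for the supremum norm.
  refine ⟨∑ i, √(k i * star (k i)).supNorm, fun A _ π => ?_⟩
  rw [map_sum]
  refine norm_sum_le_of_le _ fun i _ => Real.le_sqrt_of_sq_le ?_
  obtain ⟨U, hU, hkU⟩ := hk i
  rw [sq, ← CStarRing.norm_self_mul_star, ← map_star, ← map_mul]
  exact (isDiagonal_mul_star_of_injOn hU hkU).norm_map_le π

end Cc

end FellBundle

/-! ### Morphisms of Fell bundles and the growth criterion -/

namespace FellBundle

variable {G : Type u} [TopologicalSpace G] [EtaleGroupoid G] {𝒜 ℬ : FellBundle G}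

namespace Hom

variable (φ : Hom 𝒜 ℬ)

/-- The homomorphism of the fibres over a unit. -/
def onUnitFiber (x : {x : G // IsUnitArrow x}) : 𝒜.UnitFiber x →⋆ₙₐ[ℂ] ℬ.UnitFiber x where
  toFun := φ.toFun x.1
  map_smul' := (φ.toFun x.1).map_smul
  map_zero' := (φ.toFun x.1).map_zero
  map_add' := (φ.toFun x.1).map_add
  map_mul' a b := φ.map_fmul x.2.isProd_self a b
  map_star' a := φ.map_fstar x.2.inv_eq a

/-- Through ‖a‖² = ‖a* a‖ this reduces to the fibre over a unit, where φ is a *-homomorphism of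
C*-algebras. -/
theorem norm_apply_le {g : G} (a : 𝒜.fiber g) : ‖φ.toFun g a‖ ≤ ‖a‖ := by
  refine (sq_le_sq₀ (norm_nonneg _) (norm_nonneg _)).1 ?_
  rw [← ℬ.norm_fstar_fmul_self, ← 𝒜.norm_fstar_fmul_self, ← φ.map_fstar, ← φ.map_fmul]
  exact NonUnitalStarAlgHom.norm_apply_le (φ.onUnitFiber ⟨s g, isUnitArrow_s g⟩)
    (show 𝒜.UnitFiber ⟨s g, isUnitArrow_s g⟩ from
      𝒜.fmul (isProd_inv_left g) (𝒜.fstar rfl a) a)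

theorem mapCc_apply (f : 𝒜.Cc) (g : G) : φ.mapCc f g = φ.toFun g (f g) := rfl

theorem supNorm_mapCc_le (f : 𝒜.Cc) : (φ.mapCc f).supNorm ≤ f.supNorm :=
  Cc.supNorm_le f.supNorm_nonneg fun g => (φ.norm_apply_le _).trans (f.norm_apply_le g)

/-- The homomorphism `f ↦ φ ∘ f` of the convolution algebras. -/
noncomputable def mapCcHom [T2Space G] : 𝒜.Cc →⋆ₙₐ[ℂ] ℬ.Cc where
  toFun := φ.mapCc
  map_smul' c f := Cc.ext fun g => (φ.toFun g).map_smul c (f g)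
  map_zero' := Cc.ext fun g => (φ.toFun g).map_zero
  map_add' f f' := Cc.ext fun g => (φ.toFun g).map_add (f g) (f' g)
  map_mul' f f' := Cc.ext fun g => by
    rw [mapCc_apply, Cc.mul_apply, Cc.mul_apply]
    refine (AddMonoidHom.map_finsum (φ.toFun g).toAddMonoidHom (Cc.finite_mul f f' g)).trans ?_
    exact finsum_congr fun p => φ.map_fmul p.2 _ _
  map_star' f := Cc.ext fun g => φ.map_fstar _ _

end Hom

variable [T2Space G]

namespace Cc

/-- The tool for comparing ‖·‖_r with other norms: the constant may depend on ξ, so only the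
exponential rate of ⟨ξ, (f* f)ⁿ ξ⟩ has to be controlled. -/
theorem redNorm_le_sqrt_of_growth {f : 𝒜.Cc} {ρ : ℝ} (hρ : 0 ≤ ρ)
    (h : ∀ ξ : 𝒜.Cc, ∃ C : ℝ, ∀ n,
      ‖onUnits (star ξ * ((star f * f) * ·)^[n] ξ)‖ ≤ C * ρ ^ n) : f.redNorm ≤ √ρ := by
  refine redNorm_le (Real.sqrt_nonneg ρ) fun ξ => ?_
  obtain ⟨C, hC⟩ := h ξ
  have h1 := norm₂_mul_le_of_growth (star_star_mul_self f) hρ hC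
  refine (sq_le_sq₀ (norm₂_nonneg _) (mul_nonneg (Real.sqrt_nonneg _) ξ.norm₂_nonneg)).1 ?_
  rw [mul_pow, Real.sq_sqrt hρ]
  refine (norm₂_mul_sq_le f ξ).trans ?_
  nlinarith [ξ.norm₂_nonneg]

/-- Restriction to the unit space, as a linear map. -/
noncomputable def restrictLin (𝒜 : FellBundle G) : 𝒜.Cc →ₗ[ℂ] 𝒜.Cc where
  toFun := restrict
  map_add' f f' := (isDiagonal_restrict _).ext
    (fun g hg => by
      rw [add_apply, isDiagonal_restrict f g hg, isDiagonal_restrict f' g hg, add_zero])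
    (by rw [map_add, onUnits_restrict, onUnits_restrict, onUnits_restrict, map_add])
  map_smul' c f := (isDiagonal_restrict _).ext
    (fun g hg => by
      rw [RingHom.id_apply, smul_apply, isDiagonal_restrict f g hg, smul_zero])
    (by rw [RingHom.id_apply, map_smul, onUnits_restrict, onUnits_restrict, map_smul])

/-- The `*`-subalgebra `Γ_c(𝒜⁰)` of `Γ_c(𝒜)`. -/
noncomputable def diagonal (𝒜 : FellBundle G) : NonUnitalStarSubalgebra ℂ 𝒜.Cc where
  carrier := {f | f.IsDiagonal}
  add_mem' {f f'} hf hf' := fun g hg => by rw [add_apply, hf g hg, hf' g hg, add_zero]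
  zero_mem' := fun _ _ => rfl
  mul_mem' hf hf' := hf.mul hf'
  smul_mem' c f hf := fun g hg => by rw [smul_apply, hf g hg, smul_zero]
  star_mem' hf := hf.star

end Cc

/-! ### The conditional expectation of a completion -/

section grading

attribute [local instance] CStarAlgebra.spectralOrder CStarAlgebra.spectralOrderedRing

open Cc

/-- Restriction is contractive, as ‖i(f|G⁰)‖ ≤ ‖f|G⁰‖_∞ ≤ ‖f‖_∞ ≤ ‖i(f)‖. It thus extends by
continuity, and its properties pass from sections to limits. -/
theorem exists_conditionalExpectation {A : Type u} [NonUnitalCStarAlgebra A]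
    (i : 𝒜.Cc →⋆ₙₐ[ℂ] A) (hi : DenseRange i) (h : ∀ f, f.supNorm ≤ ‖i f‖) :
    ∃ E : A →ₗ[ℂ] A, IsConditionalExpectation (closure (i '' {f | f.IsDiagonal})) E ∧
      ∀ f, E (i f) = i f.restrict := by
  let il : 𝒜.Cc →ₗ[ℂ] A := { toFun := i, map_add' := map_add i, map_smul' := map_smul i }
  have hbound : ∀ f : 𝒜.Cc, ‖(il ∘ₗ restrictLin 𝒜) f‖ ≤ 1 * ‖il f‖ := fun f => by
    rw [one_mul]
    refine (f.isDiagonal_restrict.norm_map_le i).trans (le_trans ?_ (h f))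
    rw [supNorm_restrict]
    exact f.norm_onUnits_le
  let E : A →L[ℂ] A := (il ∘ₗ restrictLin 𝒜).extendOfNorm il
  have hE : ∀ f, E (i f) = i f.restrict :=
    LinearMap.extendOfNorm_eq (f := il ∘ₗ restrictLin 𝒜) (e := il) hi ⟨1, hbound⟩
  have hEc : Continuous E := E.continuous
  let B : NonUnitalStarSubalgebra ℂ A :=
    (NonUnitalStarSubalgebra.map i (diagonal 𝒜)).topologicalClosure
  have hB : (B : Set A) = closure (i '' {f | f.IsDiagonal}) := rfl
  have hBcl : IsClosed (B : Set A) := isClosed_closure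
  have hmem : ∀ a, E a ∈ closure (i '' {f : 𝒜.Cc | f.IsDiagonal}) := fun a =>
    hi.induction_on (p := fun a => E a ∈ closure (i '' {f : 𝒜.Cc | f.IsDiagonal})) a
      (isClosed_closure.preimage hEc) fun f => by
        rw [hE]; exact subset_closure ⟨_, isDiagonal_restrict f, rfl⟩
  refine ⟨E.toLinearMap, ⟨hmem, ?_, ?_, ?_, ?_, ?_⟩, hE⟩
  · refine closure_minimal ?_ (isClosed_eq hEc continuous_id)
    rintro _ ⟨d, hd, rfl⟩
    exact (hE d).trans (by rw [hd.restrict_eq])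
  · intro a
    simpa using LinearMap.norm_extendOfNorm_apply_le (f := il ∘ₗ restrictLin 𝒜) (e := il) hi 1
      hbound a
  · intro a
    -- Positivity in `A` is a closed condition. The square root inside the closed subalgebra `B` is
    -- extracted only after passing to the limit.
    have hpos : 0 ≤ E (star a * a) := by
      refine hi.induction_on (p := fun a => 0 ≤ E (star a * a)) a
        (isClosed_le continuous_const (by fun_prop)) fun f => ?_
      obtain ⟨b, -, hb⟩ := f.exists_restrict_star_mul_self_eq
      rw [← map_star, ← map_mul, hE, hb, map_mul, map_star]
      exact star_mul_self_nonneg _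
    exact CStarAlgebra.exists_mem_eq_star_mul_self B hBcl hpos (hmem _)
  · intro b hb a
    refine closure_minimal (t := {b | E (b * a) = b * E a}) ?_
      (isClosed_eq (by fun_prop) (by fun_prop)) hb
    rintro _ ⟨d, hd, rfl⟩
    refine hi.induction_on (p := fun a => E (i d * a) = i d * E a) a
      (isClosed_eq (by fun_prop) (by fun_prop)) fun f => ?_
    rw [← map_mul, hE, hE, restrict_mul_left hd, map_mul]
  · intro a b hb
    refine closure_minimal (t := {b | E (a * b) = E a * b}) ?_
      (isClosed_eq (by fun_prop) (by fun_prop)) hb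
    rintro _ ⟨d, hd, rfl⟩
    refine hi.induction_on (p := fun a => E (a * i d) = E a * i d) a
      (isClosed_eq (by fun_prop) (by fun_prop)) fun f => ?_
    rw [← map_mul, hE, hE, restrict_mul_right f hd, map_mul]

end grading

/-- The completion of `Γ_c(𝒜)` in a C*-seminorm dominating the supremum norm is topologically
graded. -/
noncomputable def gradingOfSeminorm (p : CStarSeminorm 𝒜.Cc) (hp : ∀ f : 𝒜.Cc, f.supNorm ≤ p f) :
    TopGrading 𝒜 where
  alg := p.Compl
  i := p.toCompl
  injective_i := (injective_iff_map_eq_zero _).2 fun f hf => by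
    refine Cc.eq_zero_of_supNorm (le_antisymm ((hp f).trans ?_) f.supNorm_nonneg)
    rw [← p.norm_toCompl, hf, norm_zero]
  denseRange_i := p.denseRange_toCompl
  exists_condExp := exists_conditionalExpectation _ p.denseRange_toCompl fun f => by
    rw [p.norm_toCompl]; exact hp f

theorem norm_gradingOfSeminorm (p : CStarSeminorm 𝒜.Cc) (hp : ∀ f : 𝒜.Cc, f.supNorm ≤ p f)
    (f : 𝒜.Cc) : ‖(gradingOfSeminorm p hp).i f‖ = p f := p.norm_toCompl f

/-! ### The universal norm, and functoriality of the reduced norm -/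

namespace Cc

/-- The norms of a section in the representations on Hilbert spaces. -/
def repNorms (f : 𝒜.Cc) : Set ℝ :=
  {t : ℝ | ∃ (H : Type u) (_ : NormedAddCommGroup H)
    (_ : InnerProductSpace ℂ H) (_ : CompleteSpace H) (π : 𝒜.Cc →⋆ₙₐ[ℂ] (H →L[ℂ] H)),
    t = ‖π f‖}

/-- The universal norm. -/
noncomputable def fullNorm (f : 𝒜.Cc) : ℝ := sSup f.repNorms

variable [LocallyCompactSpace G]

theorem isLUB_fullNorm (f : 𝒜.Cc) : IsLUB f.repNorms f.fullNorm := by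
  obtain ⟨C, hC⟩ := f.exists_norm_map_le
  refine isLUB_csSup ⟨_, PUnit, inferInstance, inferInstance, inferInstance, 0, rfl⟩ ⟨C, ?_⟩
  rintro _ ⟨H, _, _, _, π, rfl⟩
  exact hC _ π

theorem fullNorm_le {f : 𝒜.Cc} {C : ℝ} (h : ∀ (H : Type u) [NormedAddCommGroup H]
    [InnerProductSpace ℂ H] [CompleteSpace H] (π : 𝒜.Cc →⋆ₙₐ[ℂ] (H →L[ℂ] H)), ‖π f‖ ≤ C) :
    f.fullNorm ≤ C := by
  refine f.isLUB_fullNorm.2 ?_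
  rintro _ ⟨H, _, _, _, π, rfl⟩
  exact h H π

/-- By Gelfand–Naimark the norm of `j f` is attained in a Hilbert space representation, and
composing it with `j` gives a representation of Γ_c(𝒜). -/
theorem norm_map_le_fullNorm (f : 𝒜.Cc) {A : Type u} [NonUnitalCStarAlgebra A]
    (j : 𝒜.Cc →⋆ₙₐ[ℂ] A) : ‖j f‖ ≤ f.fullNorm := by
  obtain ⟨H, _, _, _, π, hπ⟩ := exists_representation_norm_le (j f)
  exact hπ.trans (f.isLUB_fullNorm.1 ⟨H, _, _, _, π.comp j, rfl⟩)

theorem fullNorm_nonneg (f : 𝒜.Cc) : 0 ≤ f.fullNorm :=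
  (norm_nonneg _).trans (f.norm_map_le_fullNorm (0 : 𝒜.Cc →⋆ₙₐ[ℂ] PUnit.{u + 1} →L[ℂ] PUnit.{u + 1}))

theorem fullNorm_smul_le (c : ℂ) (f : 𝒜.Cc) : (c • f).fullNorm ≤ ‖c‖ * f.fullNorm :=
  fullNorm_le fun H _ _ _ π => by
    rw [map_smul, norm_smul]
    exact mul_le_mul_of_nonneg_left (f.norm_map_le_fullNorm π) (norm_nonneg c)

/-- The universal norm, as a C*-seminorm. -/
noncomputable def fullSeminorm (𝒜 : FellBundle G) : CStarSeminorm 𝒜.Cc where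
  toFun := fullNorm
  add_le' f g := fullNorm_le fun H _ _ _ π => by
    rw [map_add]
    exact (norm_add_le _ _).trans
      (add_le_add (f.norm_map_le_fullNorm π) (g.norm_map_le_fullNorm π))
  smul' c f := by
    refine le_antisymm (fullNorm_smul_le c f) ?_
    by_cases hc : c = 0
    · rw [hc, norm_zero, zero_mul]; exact fullNorm_nonneg _
    · have := fullNorm_smul_le c⁻¹ (c • f)
      rwa [smul_smul, inv_mul_cancel₀ hc, one_smul, norm_inv,
        le_inv_mul_iff₀ (norm_pos_iff.2 hc)] at this
  mul_le' f g := fullNorm_le fun H _ _ _ π => by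
    rw [map_mul]
    exact (norm_mul_le _ _).trans
      (mul_le_mul (f.norm_map_le_fullNorm π) (g.norm_map_le_fullNorm π) (norm_nonneg _)
        f.fullNorm_nonneg)
  sq_le' f := by
    refine (Real.le_sqrt f.fullNorm_nonneg (fullNorm_nonneg _)).1
      (fullNorm_le fun H _ _ _ π => Real.le_sqrt_of_sq_le ?_)
    rw [sq, ← CStarRing.norm_star_mul_self, ← map_star, ← map_mul]
    exact norm_map_le_fullNorm _ π

/-- The completion in the reduced norm is one of the C*-algebras dominated by the universal norm. -/
theorem supNorm_le_fullNorm (f : 𝒜.Cc) : f.supNorm ≤ f.fullNorm :=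
  f.supNorm_le_redNorm.trans
    (((redSeminorm 𝒜).norm_toCompl f).symm.le.trans (f.norm_map_le_fullNorm _))

/-- The reduced norm does not increase under the maps induced by morphisms of Fell bundles. -/
theorem redNorm_mapCc_le (φ : Hom 𝒜 ℬ) (f : 𝒜.Cc) : (φ.mapCc f).redNorm ≤ f.redNorm := by
  have h0 := (star f * f).redNorm_nonneg
  have hle : (star f * f).redNorm ≤ f.redNorm ^ 2 := by
    have h1 : (star f).redNorm = f.redNorm := (redSeminorm 𝒜).star_eq f
    have := redNorm_mul_le (star f) f
    rwa [h1, ← sq] at this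
  refine (redNorm_le_sqrt_of_growth h0 fun ξ => ?_).trans
    (Real.sqrt_le_iff.2 ⟨f.redNorm_nonneg, hle⟩)
  set c := star f * f with hc
  have hφc : star (φ.mapCc f) * φ.mapCc f = φ.mapCc c := by
    have h1 := map_mul φ.mapCcHom (star f) f
    rw [map_star] at h1
    exact h1.symm
  rw [hφc]
  -- The shift by one avoids the zeroth power of c: the n-th iterate applied to c itself is cⁿ⁺¹, an
  -- element of Γ_c(𝒜) to which φ applies.
  have hiter : ∀ n, (φ.mapCc c * ·)^[n + 1] ξ = φ.mapCc ((c * ·)^[n] c) * ξ := by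
    intro n
    induction n with
    | zero => rfl
    | succ n ih =>
      rw [Function.iterate_succ_apply', ih, Function.iterate_succ_apply' (c * ·) n,
        ← _root_.mul_assoc]
      congr 1
      exact (map_mul φ.mapCcHom _ _).symm
  have hred : ∀ n, ((c * ·)^[n] c).redNorm ≤ c.redNorm ^ (n + 1) := by
    intro n
    induction n with
    | zero => simp
    | succ n ih =>
      rw [Function.iterate_succ_apply', pow_succ']
      exact (redNorm_mul_le _ _).trans (by gcongr)
  obtain ⟨L, hL, hξ⟩ := exists_supNorm_mul_le (star ξ)
  -- The second entry covers n = 0, which the estimate for positive powers omits.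
  refine ⟨max (L * L) ‖onUnits (star ξ * ξ)‖, fun n => ?_⟩
  cases n with
  | zero => simp
  | succ n =>
    rw [hiter]
    set w := (c * ·)^[n] c
    calc _ ≤ (star ξ * (φ.mapCc w * ξ)).supNorm := norm_onUnits_le _
      _ ≤ L * (φ.mapCc w * ξ).supNorm := hξ _
      -- Taking adjoints turns right multiplication by ξ into left multiplication by ξ*, so the same
      -- constant `L` serves twice.
      _ = L * (star ξ * star (φ.mapCc w)).supNorm := by rw [← star_mul, supNorm_star]
      _ ≤ L * (L * (φ.mapCc w).supNorm) := by
        rw [← supNorm_star (φ.mapCc w)]; gcongr; exact hξ _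
      _ ≤ L * (L * c.redNorm ^ (n + 1)) := by
        gcongr
        -- φ is contractive for the supremum norm, which lies below the reduced norm, and the latter
        -- is submultiplicative on powers of c.
        exact (φ.supNorm_mapCc_le w).trans (w.supNorm_le_redNorm.trans (hred n))
      _ = L * L * c.redNorm ^ (n + 1) := by ring
      _ ≤ _ := by gcongr; exact le_max_left _ _

end Cc

end FellBundle

/-! ### Minimality of the reduced norm, and existence of both completions -/

namespace TopGrading

open FellBundle FellBundle.Cc

variable {G : Type u} [TopologicalSpace G] [EtaleGroupoid G] [T2Space G] {𝒜 : FellBundle G}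

/-- The reduced norm is the smallest C*-norm of a topological grading. -/
theorem redNorm_le_norm (T : TopGrading 𝒜) (f : 𝒜.Cc) : f.redNorm ≤ ‖T.i f‖ := by
  obtain ⟨E, hE, hEi⟩ := T.exists_condExp
  -- On diagonal sections `T.i` is isometric for the supremum norm, and E is contractive: ‖w|G⁰‖_∞ =
  -- ‖E(i(w))‖ ≤ ‖i(w)‖.
  have hw : ∀ w : 𝒜.Cc, ‖onUnits w‖ ≤ ‖T.i w‖ := fun w => by
    rw [← supNorm_restrict, ← w.isDiagonal_restrict.norm_map_eq T.i T.injective_i, ← hEi]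
    exact hE.norm_le _
  have hc : ‖T.i (star f * f)‖ = ‖T.i f‖ ^ 2 := by
    rw [map_mul, map_star, CStarRing.norm_star_mul_self, sq]
  -- The norm of ⟨ξ, (f* f)ⁿ ξ⟩ is at most ‖i(ξ*)‖ ‖i(ξ)‖ ‖i(f* f)‖ⁿ, of growth rate ‖i(f)‖².
  have := redNorm_le_sqrt_of_growth (f := f) (norm_nonneg (T.i (star f * f))) fun ξ => by
    refine ⟨‖T.i (star ξ)‖ * ‖T.i ξ‖, fun n => (hw _).trans ?_⟩
    rw [map_mul, _root_.mul_assoc]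
    refine (norm_mul_le _ _).trans (mul_le_mul_of_nonneg_left ?_ (norm_nonneg _))
    induction n with
    | zero => simp
    | succ n ih =>
      rw [Function.iterate_succ_apply', map_mul, pow_succ', mul_left_comm]
      exact (norm_mul_le _ _).trans (mul_le_mul_of_nonneg_left ih (norm_nonneg _))
  rwa [hc, Real.sqrt_sq (norm_nonneg _)] at this

theorem IsReduced.norm_eq {T : TopGrading 𝒜} (hT : T.IsReduced) (f : 𝒜.Cc) :
    ‖T.i f‖ = f.redNorm := (hT f).unique (isLUB_redNorm f)

variable [LocallyCompactSpace G]

theorem IsFull.norm_eq {T : TopGrading 𝒜} (hT : T.IsFull) (f : 𝒜.Cc) :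
    ‖T.i f‖ = f.fullNorm := (hT f).unique f.isLUB_fullNorm

theorem exists_isFull (𝒜 : FellBundle G) : ∃ T : TopGrading 𝒜, T.IsFull :=
  ⟨gradingOfSeminorm (fullSeminorm 𝒜) supNorm_le_fullNorm, fun f =>
    (congrArg (IsLUB _) (norm_gradingOfSeminorm _ _ f)).mpr f.isLUB_fullNorm⟩

theorem exists_isReduced (𝒜 : FellBundle G) : ∃ T : TopGrading 𝒜, T.IsReduced :=
  ⟨gradingOfSeminorm (redSeminorm 𝒜) supNorm_le_redNorm, fun f =>
    (congrArg (IsLUB _) (norm_gradingOfSeminorm _ _ f)).mpr (isLUB_redNorm f)⟩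

end TopGrading

/-! ### Existence of the induced maps, of ψ and of η -/

section induced

open FellBundle FellBundle.Cc

variable {G : Type u} [TopologicalSpace G] [EtaleGroupoid G] [T2Space G]
  {C : ∀ 𝒜 : FellBundle G, TopGrading 𝒜}

theorem mapsFrom_of_isReduced (hC : ∀ 𝒜, (C 𝒜).IsReduced) : MapsFrom C := fun X =>
  exists_starAlgHom_extension X.grading.i X.grading.denseRange_i (C X.bundle).i fun f => by
    rw [(hC X.bundle).norm_eq]; exact X.grading.redNorm_le_norm f

variable [LocallyCompactSpace G]

theorem hasInducedMaps_of_isFull (hC : ∀ 𝒜, (C 𝒜).IsFull) : HasInducedMaps C := fun 𝒜 ℬ φ =>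
  exists_starAlgHom_extension (C 𝒜).i (C 𝒜).denseRange_i ((C ℬ).i.comp φ.mapCcHom) fun f => by
    rw [(hC 𝒜).norm_eq]; exact f.norm_map_le_fullNorm _

theorem mapsOnto_of_isFull (hC : ∀ 𝒜, (C 𝒜).IsFull) : MapsOnto C := fun X =>
  exists_starAlgHom_extension (C X.bundle).i (C X.bundle).denseRange_i X.grading.i fun f => by
    rw [(hC X.bundle).norm_eq]; exact f.norm_map_le_fullNorm _

theorem hasInducedMaps_of_isReduced (hC : ∀ 𝒜, (C 𝒜).IsReduced) : HasInducedMaps C :=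
  fun 𝒜 ℬ φ =>
    exists_starAlgHom_extension (C 𝒜).i (C 𝒜).denseRange_i ((C ℬ).i.comp φ.mapCcHom) fun f => by
      rw [(hC 𝒜).norm_eq]
      exact ((hC ℬ).norm_eq _).trans_le (redNorm_mapCc_le φ f)

end induced

/-! ### Maximal-normal equivalences from idempotent (co)reflections -/

namespace MaxNor

open CategoryTheory.Limits

universe v w

section adjunctions

variable {𝒞 : Type w} [Category.{v} 𝒞] {M N : 𝒞 ⥤ 𝒞} {ψ : M ⟶ 𝟭 𝒞} {η : 𝟭 𝒞 ⟶ N}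

theorem isIso_of_maximal (y : (maximal ψ).FullSubcategory) : IsIso (ψ.app y.obj) := y.property

theorem isIso_of_normal (y : (normal η).FullSubcategory) : IsIso (η.app y.obj) := y.property

attribute [local instance] isIso_of_maximal isIso_of_normal

/-- If `M` sends `ψ_x` to `ψ_{M x}`, the corestriction of `M` to the objects fixed by `ψ` is right
adjoint to the inclusion, with counit `ψ`. -/
noncomputable def adjunctionCorefl (hM : ∀ x, IsIso (ψ.app (M.obj x)))
    (hψ : ∀ x, M.map (ψ.app x) = ψ.app (M.obj x)) : (maximal ψ).ι ⊣ corefl ψ hM where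
  unit :=
    { app y := ObjectProperty.homMk (inv (ψ.app y.obj))
      naturality y z f := by
        ext
        change f.hom ≫ inv (ψ.app z.obj) = inv (ψ.app y.obj) ≫ M.map f.hom
        rw [IsIso.comp_inv_eq, Category.assoc, ψ.naturality, IsIso.inv_hom_id_assoc]
        rfl }
  counit :=
    { app x := ψ.app x
      naturality x y f := ψ.naturality f }
  left_triangle_components y := IsIso.inv_hom_id (ψ.app y.obj)
  right_triangle_components x := by
    ext
    have := hM x
    change inv (ψ.app (M.obj x)) ≫ M.map (ψ.app x) = 𝟙 _
    rw [hψ x, IsIso.inv_hom_id]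

/-- If `N` sends `η_x` to `η_{N x}`, the corestriction of `N` to the objects fixed by `η` is left
adjoint to the inclusion, with unit `η`. -/
noncomputable def adjunctionRefl (hN : ∀ x, IsIso (η.app (N.obj x)))
    (hη : ∀ x, N.map (η.app x) = η.app (N.obj x)) : refl η hN ⊣ (normal η).ι where
  unit :=
    { app x := η.app x
      naturality x y f := η.naturality f }
  counit :=
    { app y := ObjectProperty.homMk (inv (η.app y.obj))
      naturality y z f := by
        ext
        change N.map f.hom ≫ inv (η.app z.obj) = inv (η.app y.obj) ≫ f.hom
        rw [IsIso.comp_inv_eq, Category.assoc]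
        erw [η.naturality f.hom]
        rw [IsIso.inv_hom_id_assoc] }
  left_triangle_components x := by
    ext
    have := hN x
    change N.map (η.app x) ≫ inv (η.app (N.obj x)) = 𝟙 _
    rw [hη x, IsIso.hom_inv_id]
  right_triangle_components y := IsIso.hom_inv_id (η.app y.obj)

variable (hM : ∀ x, IsIso (ψ.app (M.obj x))) (hN : ∀ x, IsIso (η.app (N.obj x)))
  (hψ : ∀ x, M.map (ψ.app x) = ψ.app (M.obj x)) (hη : ∀ x, N.map (η.app x) = η.app (N.obj x))

/-- The unit of the composite adjunction at y is ψ_y⁻¹ followed by M(η_y). -/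
theorem isIso_unit_comp (hMη : ∀ x, IsIso (M.map (η.app x))) :
    IsIso ((adjunctionCorefl hM hψ).comp (adjunctionRefl hN hη)).unit := by
  refine @NatIso.isIso_of_isIso_app _ _ _ _ _ _ _ fun y => ?_
  rw [← ObjectProperty.isIso_hom_iff, Adjunction.comp_unit_app]
  have := hMη y.obj
  change IsIso (inv (ψ.app y.obj) ≫ M.map (η.app y.obj))
  infer_instance

/-- The counit at y is N(ψ_y) followed by η_y⁻¹. -/
theorem isIso_counit_comp (hNψ : ∀ x, IsIso (N.map (ψ.app x))) :
    IsIso ((adjunctionCorefl hM hψ).comp (adjunctionRefl hN hη)).counit := by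
  refine @NatIso.isIso_of_isIso_app _ _ _ _ _ _ _ fun y => ?_
  rw [← ObjectProperty.isIso_hom_iff, Adjunction.comp_counit_app]
  have := hNψ y.obj
  change IsIso (N.map (ψ.app y.obj) ≫ inv (η.app y.obj))
  infer_instance

/-- By naturality ψ_x followed by η_x is η_{Mx} followed by the isomorphism N(ψ_x), and η_{Mx} is
the universal arrow from M x to a normal object. Uniqueness comes from applying N to a factorization
and using N(η_x) = η_{Nx}. -/
theorem nonempty_isInitial (x : 𝒞) (h : IsIso (N.map (ψ.app x)))
    (hη : N.map (η.app x) = η.app (N.obj x)) :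
    Nonempty (IsInitial (StructuredArrow.mk (S := M.obj x) (T := (normal η).ι)
      (Y := (refl η hN).obj x) (ψ.app x ≫ η.app x))) := by
  have hNx := hN x
  refine ⟨IsInitial.ofUniqueHom (fun Y => StructuredArrow.homMk (ObjectProperty.homMk
    (inv (N.map (ψ.app x)) ≫ N.map Y.hom ≫ inv (η.app Y.right.obj))) ?_) fun Y m => ?_⟩
  · change (ψ.app x ≫ η.app x) ≫ inv (N.map (ψ.app x)) ≫ N.map Y.hom ≫ inv (η.app Y.right.obj) =
      Y.hom
    have e : ψ.app x ≫ η.app x = η.app (M.obj x) ≫ N.map (ψ.app x) := η.naturality (ψ.app x)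
    have e' : Y.hom ≫ η.app Y.right.obj = η.app (M.obj x) ≫ N.map Y.hom := η.naturality Y.hom
    rw [e, Category.assoc, IsIso.hom_inv_id_assoc]
    erw [← reassoc_of% e']
    exact (congrArg (Y.hom ≫ ·) (IsIso.hom_inv_id _)).trans (Category.comp_id _)
  · apply StructuredArrow.hom_ext
    ext
    change m.right.hom = inv (N.map (ψ.app x)) ≫ N.map Y.hom ≫ inv (η.app Y.right.obj)
    have w : (ψ.app x ≫ η.app x) ≫ m.right.hom = Y.hom := StructuredArrow.w m
    have e : m.right.hom ≫ η.app Y.right.obj = η.app (N.obj x) ≫ N.map m.right.hom :=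
      η.naturality m.right.hom
    refine (IsIso.eq_inv_comp _).mpr ((IsIso.eq_comp_inv _).mpr ?_)
    rw [← w, N.map_comp, N.map_comp, hη, Category.assoc, Category.assoc]
    exact congrArg (N.map (ψ.app x) ≫ ·) e

/-- The dual argument: the arrow is also M(η_x) followed by the couniversal ψ_{Nx}. -/
theorem nonempty_isTerminal (x : 𝒞) (h : IsIso (M.map (η.app x)))
    (hψ : M.map (ψ.app x) = ψ.app (M.obj x)) :
    Nonempty (IsTerminal (CostructuredArrow.mk (T := N.obj x)
      (S := (maximal ψ).ι) (Y := (corefl ψ hM).obj x) (ψ.app x ≫ η.app x))) := by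
  have hMx := hM x
  refine ⟨IsTerminal.ofUniqueHom (fun Y => CostructuredArrow.homMk (ObjectProperty.homMk
    (inv (ψ.app Y.left.obj) ≫ M.map Y.hom ≫ inv (M.map (η.app x)))) ?_) fun Y m => ?_⟩
  · change (inv (ψ.app Y.left.obj) ≫ M.map Y.hom ≫ inv (M.map (η.app x))) ≫ ψ.app x ≫ η.app x =
      Y.hom
    have e : M.map (η.app x) ≫ ψ.app (N.obj x) = ψ.app x ≫ η.app x := ψ.naturality (η.app x)
    have e' : M.map Y.hom ≫ ψ.app (N.obj x) = ψ.app Y.left.obj ≫ Y.hom := ψ.naturality Y.hom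
    rw [← e, Category.assoc, Category.assoc, IsIso.inv_hom_id_assoc]
    erw [e']
    exact IsIso.inv_hom_id_assoc _ _
  · apply CostructuredArrow.hom_ext
    ext
    change m.left.hom = inv (ψ.app Y.left.obj) ≫ M.map Y.hom ≫ inv (M.map (η.app x))
    have w : m.left.hom ≫ ψ.app x ≫ η.app x = Y.hom := CostructuredArrow.w m
    have e : M.map m.left.hom ≫ ψ.app (M.obj x) = ψ.app Y.left.obj ≫ m.left.hom :=
      ψ.naturality m.left.hom
    refine (IsIso.eq_inv_comp _).mpr ((IsIso.eq_comp_inv _).mpr ?_)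
    rw [← w, M.map_comp, M.map_comp, hψ, ← Category.assoc]
    exact congrArg (· ≫ M.map (η.app x)) e.symm

/-- An idempotent coreflection `ψ` and an idempotent reflection `η` such that `M η` and `N ψ` are
isomorphisms form a maximal-normal equivalence. -/
theorem maximalNormalEquivalence_of_isIso_map (hM : ∀ x, IsIso (ψ.app (M.obj x)))
    (hN : ∀ x, IsIso (η.app (N.obj x))) (hψ : ∀ x, M.map (ψ.app x) = ψ.app (M.obj x))
    (hη : ∀ x, N.map (η.app x) = η.app (N.obj x)) (hMη : ∀ x, IsIso (M.map (η.app x)))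
    (hNψ : ∀ x, IsIso (N.map (ψ.app x))) : MaximalNormalEquivalence ψ η :=
  ⟨hM, hN, adjunctionCorefl hM hψ, adjunctionRefl hN hη, fun _ => rfl, fun _ => rfl,
    isIso_unit_comp hM hN hψ hη hMη, isIso_counit_comp hM hN hψ hη hNψ,
    ⟨fun x => nonempty_isInitial hN x (hNψ x) (hη x),
      fun x => nonempty_isTerminal hM x (hMη x) (hψ x), hMη, hNψ⟩,
    ⟨NatIso.ofComponents
      (fun x => ((normal η).isoMk (@asIso _ _ _ _ (N.map (ψ.app x)) (hNψ x)) :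
        (corefl ψ hM ⋙ (maximal ψ).ι ⋙ refl η hN).obj x ≅ (refl η hN).obj x))
      (fun {x y} f => by
        ext
        change N.map (M.map f) ≫ N.map (ψ.app y) = N.map (ψ.app x) ≫ N.map f
        rw [← N.map_comp, ← N.map_comp, ψ.naturality, Functor.id_map]) |>.symm⟩,
    ⟨NatIso.ofComponents
      (fun x => ((maximal ψ).isoMk (@asIso _ _ _ _ (M.map (η.app x)) (hMη x)) :
        (corefl ψ hM).obj x ≅ (refl η hN ⋙ (normal η).ι ⋙ corefl ψ hM).obj x))
      (fun {x y} f => by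
        ext
        change M.map f ≫ M.map (η.app y) = M.map (η.app x) ≫ M.map (N.map f)
        rw [← M.map_comp, ← M.map_comp, ← η.naturality, Functor.id_map])⟩⟩

end adjunctions

theorem MaximalNormalEquivalence.nonempty_equivalence {𝒞 : Type w} [Category.{v} 𝒞]
    {M N : 𝒞 ⥤ 𝒞} {ψ : M ⟶ 𝟭 𝒞} {η : 𝟭 𝒞 ⟶ N} (h : MaximalNormalEquivalence ψ η) :
    Nonempty ((maximal ψ).FullSubcategory ≌ (normal η).FullSubcategory) := by
  obtain ⟨_, _, adjM, adjN, -, -, hu, hc, -⟩ := h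
  exact ⟨(adjM.comp adjN).toEquivalence⟩

end MaxNor

theorem theorem7p2 (G : Type u) [TopologicalSpace G] [T2Space G] [LocallyCompactSpace G]
    [EtaleGroupoid G] :
    -- every Fell bundle has a full and a reduced C*-algebra, topologically graded by it
    (∀ 𝒜 : FellBundle G, ∃ T : TopGrading 𝒜, T.IsFull) ∧
    (∀ 𝒜 : FellBundle G, ∃ T : TopGrading 𝒜, T.IsReduced) ∧
    -- whichever models `C 𝒜` of `C*(𝒜)` and `Cr 𝒜` of `C*_r(𝒜)` are used, the functors `M` and `N`
    -- and the transformations `ψ` and `η` that they define exist and give the equivalence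
    ∀ C Cr : ∀ 𝒜 : FellBundle G, TopGrading 𝒜,
      (∀ 𝒜, (C 𝒜).IsFull) → (∀ 𝒜, (Cr 𝒜).IsReduced) →
      ∃ (hC : HasInducedMaps C) (hψ : MapsOnto C) (hCr : HasInducedMaps Cr) (hη : MapsFrom Cr),
        Nonempty ((MaxNor.maximal (psi C hC hψ)).FullSubcategory ≌
          (MaxNor.normal (eta Cr hCr hη)).FullSubcategory) ∧
        MaxNor.MaximalNormalEquivalence (psi C hC hψ) (eta Cr hCr hη) := by
  refine ⟨TopGrading.exists_isFull, TopGrading.exists_isReduced, fun C Cr hC hCr =>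
    ⟨hasInducedMaps_of_isFull hC, mapsOnto_of_isFull hC, hasInducedMaps_of_isReduced hCr,
      mapsFrom_of_isReduced hCr, ?_⟩⟩
  -- An endomorphism lying over the identity of the bundle is the identity.
  have isIso_of_eq_id {X : TopGradedAlg G} {f : X ⟶ X} (h : f.bundleHom = FellBundle.Hom.id _) :
      IsIso f := by
    rw [show f = 𝟙 X from TopGradedAlg.Hom.ext' h]
    infer_instance
  have h : MaxNor.MaximalNormalEquivalence (psi C (hasInducedMaps_of_isFull hC)
      (mapsOnto_of_isFull hC)) (eta Cr (hasInducedMaps_of_isReduced hCr)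
      (mapsFrom_of_isReduced hCr)) :=
    MaxNor.maximalNormalEquivalence_of_isIso_map
      -- M depends on the bundle alone, so ψ_{Mx} and M(η_x) are definitionally endomorphisms of M
      -- x, as η_{Nx} and N(ψ_x) are of N x.
      (fun x => isIso_of_eq_id (X := ⟨x.bundle, C x.bundle⟩) rfl)
      (fun x => isIso_of_eq_id (X := ⟨x.bundle, Cr x.bundle⟩) rfl)
      (fun x => TopGradedAlg.Hom.ext' rfl) (fun x => TopGradedAlg.Hom.ext' rfl)
      (fun x => isIso_of_eq_id (X := ⟨x.bundle, C x.bundle⟩) rfl)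
      (fun x => isIso_of_eq_id (X := ⟨x.bundle, Cr x.bundle⟩) rfl)
  exact ⟨h.nonempty_equivalence, h⟩
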